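/- **Setting.** Let $n\in\mathbb N$, let $D\in\mathbb R^{n\times n}$ be symmetric and positive definite and let $f:\mathbb R^n\to\mathbb R^n$ be smooth. $C^m_{\mathrm{ub}}(\mathbb R)$ is the space of $m$ times differentiable functions on $\mathbb R$ all of whose derivatives up to order $m$ are bounded and uniformly continuous, with the $W^{m,\infty}$-norm. Assume: * (H1) $u_{\mathrm{wt}}(x,t)=\phi_0(k_0x-\omega_0t)$, with $k_0\neq0$, $\omega_0\in\mathbb R$ and $\phi_0:\mathbb R\to\mathbb R^n$ nonconstant, smooth and $1$-periodic, solves $\partial_tu=Du_{xx}+f(u)$; * (D3) $0$ is a simple eigenvalue of $\mathcal L(0)$, where $\mathcal L(\xi)=k_0^2D(\partial_\zeta+\mathrm i\xi)^2+\omega_0(\partial_\zeta+\mathrm i\xi)+f'(\phi_0)$ acts on $L^2_{\mathrm{per}}(0,1)$ with domain $H^2_{\mathrm{per}}(0,1)$. **Critical curve.** Let $\xi_0\in(0,\pi)$ and, for $|\xi|<\xi_0$, let $\lambda_c(\xi)$ be simple eigenvalues of $\mathcal L(\xi)$, analytic in $\xi$, with eigenfunctions $\Phi_\xi$ (analytic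 in $\xi$) and eigenfunctions $\widetilde\Phi_\xi$ (smooth in $\xi$) of $\mathcal L(\xi)^*$ to the simple eigenvalue $\overline{\lambda_c(\xi)}$, such that $\Phi_0=\phi_0'$ and $\langle\widetilde\Phi_0,\Phi_\xi\rangle_{L^2(0,1)}=\langle\widetilde\Phi_\xi,\Phi_\xi\rangle_{L^2(0,1)}=1$. Let $\rho:\mathbb R\to[0,1]$ and $\chi:[0,\infty)\to[0,1]$ be smooth with $\rho(\xi)=1$ for $|\xi|<\xi_0/2$, $\rho(\xi)=0$ for $|\xi|>\xi_0$, $\chi=0$ on $[0,1]$, $\chi=1$ on $[2,\infty)$, and set $$S_p^0(t)v(\zeta)=\chi(t)\int_{\mathbb R}\frac1{2\pi}\int_{\mathbb R}\rho(\xi)\mathrm e^{\mathrm i\xi(\zeta-\bar\zeta)}\mathrm e^{\lambda_c(\xi)t}\,\widetilde\Phi_\xi(\bar\zeta)^*\,\mathrm d\xi\;v(\bar\zeta)\,\mathrm d\bar\zeta .$$ **Family of wave trains.** Let $r>0$ and let $\phi:\mathbb R\times(k_0-r,k_0+r)\to\mathbb R^n$ and $\omega:(k_0-r,k_0+r)\to\mathbb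 R$ be smooth such that for each $k$ the function $\phi(\cdot;k)$ is $1$-periodic and $\phi(kx-\omega(k)t;k)$ solves $\partial_tu=Du_{xx}+f(u)$, and such that $\omega(k_0)=\omega_0$, $\phi(\cdot;k_0)=\phi_0$, $\langle\widetilde\Phi_0,\partial_k\phi(\cdot;k_0)\rangle_{L^2(0,1)}=0$. Let $r_0\in(0,\frac12)$ with $|k_0|r_0<r$. Set $a=\omega_0-k_0\omega'(k_0)$. Fix $t_*\in(0,1]$ and $R>0$. **Perturbation and modulation.** For $\mathring v_0\in C_{\mathrm{ub}}(\mathbb R)$ and $\gamma_0\in C^1_{\mathrm{ub}}(\mathbb R)$ with $\|\gamma_0'\|_\infty<r_0$, put $u_0(\zeta)=\phi_0(\zeta+\gamma_0(\zeta))+\mathring v_0(\zeta)$ and $v_0(\zeta)=u_0(\zeta-\gamma_0(\zeta))-\phi_0(\zeta)$. Let $u\in C([0,T),C_{\mathrm{ub}})\cap C((0,T),C^2_{\mathrm{ub}})\cap C^1((0,T),C_{\mathrm{ub}})$, $T\in(0,\infty]$, be a classical solution of $$\partial_tu=k_0^2Du_{\zeta\zeta}+\omega_0u_\zeta+f(u),\qquad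 u(0)=u_0 .$$ Let $\gamma\in C([0,\tau),C^1_{\mathrm{ub}})\cap\bigcap_{j,l\in\mathbb N_0}C^j((0,\tau),C^l_{\mathrm{ub}})$, $0<\tau\le\max\{1,T\}$, be a real-valued solution, with $\|\gamma_\zeta(t)\|_\infty<r_0$ for $t\in[0,\tau)$, of $$\gamma(t)=S_p^0(t)\big(v_0+\phi_0'\gamma_0+\gamma_0'v_0\big)+\int_0^tS_p^0(t-s)\,\mathcal N\big(v(s),\gamma(s),\partial_t\gamma(s)\big)\,\mathrm ds+(1-\chi(t))\,\mathrm e^{-\partial_\zeta^4t}\gamma_0 ,$$ where $v(\zeta,t)=u(\zeta-\gamma(\zeta,t),t)-\phi_0(\zeta)$ and $$\begin{aligned}\mathcal N(v,\gamma,\gamma_t)={}&\big(f(\phi_0+v)-f(\phi_0)-f'(\phi_0)v\big)(1-\gamma_\zeta)\\&+\partial_\zeta\Big(-\gamma_tv+\omega_0\gamma_\zeta v+\tfrac{k_0^2}{1-\gamma_\zeta}D\big(\gamma_\zeta^2\phi_0'-\tfrac{\gamma_{\zeta\zeta}v}{1-\gamma_\zeta}\big)\Big)+\partial_\zeta^2\Big(k_0^2D\big(2\gamma_\zeta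 v+\tfrac{\gamma_\zeta^2v}{1-\gamma_\zeta}\big)\Big).\end{aligned}$$ Define the modified forward-modulated perturbation and $\tilde\gamma$ by $$\mathring z(\zeta,t)=u(\zeta,t)-\phi\big(\zeta+\gamma(\zeta,t)(1+\gamma_\zeta(\zeta,t));\,k_0(1+\gamma_\zeta(\zeta,t))\big),\qquad \tilde\gamma=\partial_t\gamma-a\gamma_\zeta .$$ **Claim.** There exists a constant $C>0$, independent of $\mathring v_0$, $\gamma_0$, $u$, $\gamma$, $T$, $\tau$ and $t$, such that $$\begin{aligned}\|\mathring z(t)\|_{C^1_{\mathrm{ub}}}\le C\Bigg(&\|\mathring z(t)\|_\infty+\bigg(\mathrm e^{t_*-t}\|\mathring z(t_*)\|_{C^2_{\mathrm{ub}}}^2+\int_{t_*}^t\mathrm e^{s-t}\Big(\|\mathring z(s)\|_\infty^2+\|\gamma_{\zeta\zeta}(s)\|_{C^3_{\mathrm{ub}}}^2+\|\partial_s\gamma_\zeta(s)\|_{C^2_{\mathrm{ub}}}^2\\&+\|\tilde\gamma(s)\|_{C^2_{\mathrm{ub}}}^2+\|\gamma_\zeta(s)\|_\infty^2\big(\|\gamma_\zeta(s)\|_\infty^2+\|\partial_s\gamma(s)\|_\infty^2\big)\Big)\mathrm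 ds\bigg)^{1/2}\Bigg)\end{aligned}$$ for every $t\ge t_*$ with $t<\tau$, $t<T$ and $$\sup_{t_*\le s\le t}\big(\|\mathring z(s)\|_{C^1_{\mathrm{ub}}}+\|\gamma(s)\|_{C^2_{\mathrm{ub}}}\big)\le R .$$ -/

import Mathlib

open scoped ContDiff BoundedContinuousFunction

noncomputable section

namespace WaveTrain

/-! ## The spaces `C_ub^m(ℝ)` and curves in them -/

section FunctionSpaces

variable {V : Type*} [NormedAddCommGroup V] [NormedSpace ℝ V]

/-- `g ∈ C_ub^m(ℝ)`: `g` is `m` times continuously differentiable and all derivatives up to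
order `m` are bounded and uniformly continuous. -/
def IsCub (m : ℕ) (g : ℝ → V) : Prop :=
  ContDiff ℝ m g ∧
    ∀ j ≤ m, UniformContinuous (iteratedDeriv j g) ∧ ∃ B : ℝ, ∀ x, ‖iteratedDeriv j g x‖ ≤ B

/-- The supremum norm on the real line (used for bounded functions only). -/
def supNorm (g : ℝ → V) : ℝ := ⨆ x, ‖g x‖

/-- The `W^{m,∞}`-norm, as the sum of the supremum norms of the derivatives up to order `m`
(used for elements of `C_ub^m(ℝ)` only). -/
def cubNorm (m : ℕ) (g : ℝ → V) : ℝ := ∑ j ∈ Finset.range (m + 1), supNorm (iteratedDeriv j g)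

/-- `U t` is the jet `(u t, ∂u t, …, ∂^l u t)` of `u t ∈ C_ub^l(ℝ)` for all `t ∈ I`. The jet map
embeds `C_ub^l(ℝ)` as a closed subspace of a finite product of spaces of bounded continuous
functions, and the product norm restricts to (an equivalent form of) the `W^{l,∞}`-norm. -/
def IsJet (l : ℕ) (I : Set ℝ) (u : ℝ → ℝ → V) (U : ℝ → Fin (l + 1) → (ℝ →ᵇ V)) : Prop :=
  ∀ t ∈ I, IsCub l (u t) ∧ ∀ i x, U t i x = iteratedDeriv (i : ℕ) (u t) x

/-- `u ∈ C^j(I, C_ub^l(ℝ))`, where `u t` is the function at parameter value `t`. -/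
def CurveContDiff (j l : ℕ) (I : Set ℝ) (u : ℝ → ℝ → V) : Prop :=
  ∃ U : ℝ → Fin (l + 1) → (ℝ →ᵇ V), ContDiffOn ℝ j U I ∧ IsJet l I u U

/-- `u` is an analytic map from `I` to `C_ub^l(ℝ)`. -/
def CurveAnalytic (l : ℕ) (I : Set ℝ) (u : ℝ → ℝ → V) : Prop :=
  ∃ U : ℝ → Fin (l + 1) → (ℝ →ᵇ V), AnalyticOnNhd ℝ U I ∧ IsJet l I u U

/-- The temporal derivative of a function `u t ζ` of time and space. -/
def dt (u : ℝ → ℝ → V) (t ζ : ℝ) : V := deriv (fun s => u s ζ) t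

end FunctionSpaces

/-- The time interval `[0, T)` with `T ∈ [-∞, ∞]`. -/
def timesFromZero (T : EReal) : Set ℝ := {t | 0 ≤ t ∧ (t : EReal) < T}

/-- The time interval `(0, T)` with `T ∈ [-∞, ∞]`. -/
def positiveTimes (T : EReal) : Set ℝ := {t | 0 < t ∧ (t : EReal) < T}

section System

variable {n : ℕ}

/-- Real state space `ℝ^n` with the Euclidean norm. -/
abbrev State (n : ℕ) : Type := EuclideanSpace ℝ (Fin n)

/-- Multiplication of a vector of `ℝ^n` by a real matrix. -/
def act (D : Matrix (Fin n) (Fin n) ℝ) (v : State n) : State n := Matrix.toEuclideanCLM (𝕜 := ℝ) D v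

/-- The Jacobian matrix of `f` at `x`. -/
def jacobian (f : State n → State n) (x : State n) : Matrix (Fin n) (Fin n) ℝ :=
  Matrix.of fun i j => (fderiv ℝ f x (EuclideanSpace.single j 1)) i

/-- `U(x,t) = ψ(k x - freq * t)` is a wave-train solution of `∂ₜ U = D U_xx + f(U)` with smooth
`1`-periodic profile `ψ`. -/
structure IsWaveTrain (D : Matrix (Fin n) (Fin n) ℝ) (f : State n → State n) (k freq : ℝ)
    (ψ : ℝ → State n) : Prop where
  smooth : ContDiff ℝ ∞ ψ
  periodic : Function.Periodic ψ 1
  solves : ∀ x t : ℝ,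
    deriv (fun s => ψ (k * x - freq * s)) t
      = act D (iteratedDeriv 2 (fun y => ψ (k * y - freq * t)) x) + f (ψ (k * x - freq * t))

/-- Hypothesis (H1): a nonconstant wave train with nonzero wavenumber. -/
structure HypH1 (D : Matrix (Fin n) (Fin n) ℝ) (f : State n → State n) (k₀ ω₀ : ℝ)
    (φ₀ : ℝ → State n) : Prop where
  wavenumber_ne_zero : k₀ ≠ 0
  isWaveTrain : IsWaveTrain D f k₀ ω₀ φ₀
  nonconstant : ∃ x y, φ₀ x ≠ φ₀ y

/-! ## Bloch operators -/

/-- `u ∈ H²_per(0,1)` (through its continuous representative) with first and second derivative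
`u₁`, `u₂`: `u` and `u₁` are `1`-periodic primitives of `u₁` and `u₂`, and `u₂ ∈ L²_per(0,1)`. -/
structure IsH2Per (u u₁ u₂ : ℝ → Fin n → ℂ) : Prop where
  periodic : Function.Periodic u 1
  periodic_fst : Function.Periodic u₁ 1
  periodic_snd : Function.Periodic u₂ 1
  memLp : MeasureTheory.MemLp u₂ 2 (MeasureTheory.volume.restrict (Set.Ioc 0 1))
  primitive_fst : ∀ x, u₁ x = u₁ 0 + ∫ y in (0 : ℝ)..x, u₂ y
  primitive : ∀ x, u x = u 0 + ∫ y in (0 : ℝ)..x, u₁ y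

/-- The expression `k₀² D (∂ + iξ)² u + c (∂ + iξ) u + A u` for `u` with derivatives `u₁`, `u₂`. -/
def blochOp (D : Matrix (Fin n) (Fin n) ℝ) (k₀ c : ℝ) (A : ℝ → Matrix (Fin n) (Fin n) ℝ) (ξ : ℝ)
    (u u₁ u₂ : ℝ → Fin n → ℂ) (ζ : ℝ) : Fin n → ℂ :=
  ((k₀ : ℂ) ^ 2) • (D.map Complex.ofReal).mulVec
      (u₂ ζ + (2 * Complex.I * ξ) • u₁ ζ - ((ξ : ℂ) ^ 2) • u ζ)
    + (c : ℂ) • (u₁ ζ + (Complex.I * ξ) • u ζ)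
    + ((A ζ).map Complex.ofReal).mulVec (u ζ)

/-- `μ` is an (algebraically) simple eigenvalue, with eigenfunction `Ψ`, of the operator
`k₀² D (∂ + iξ)² + c (∂ + iξ) + A` on `L²_per(0,1)` with domain `H²_per(0,1)`: the eigenspace is
spanned by `Ψ ≠ 0`, and there is no generalized eigenfunction of second order. -/
structure IsSimpleEigenpair (D : Matrix (Fin n) (Fin n) ℝ) (k₀ c : ℝ)
    (A : ℝ → Matrix (Fin n) (Fin n) ℝ) (ξ : ℝ) (μ : ℂ) (Ψ : ℝ → Fin n → ℂ) : Prop where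
  ne_zero : Ψ ≠ 0
  eigen : ∃ Ψ₁ Ψ₂, IsH2Per Ψ Ψ₁ Ψ₂ ∧ ∀ᵐ ζ : ℝ, blochOp D k₀ c A ξ Ψ Ψ₁ Ψ₂ ζ = μ • Ψ ζ
  geometric : ∀ u u₁ u₂, IsH2Per u u₁ u₂ →
    (∀ᵐ ζ : ℝ, blochOp D k₀ c A ξ u u₁ u₂ ζ = μ • u ζ) → ∃ a : ℂ, u = a • Ψ
  algebraic : ¬ ∃ u u₁ u₂, IsH2Per u u₁ u₂ ∧
    ∀ᵐ ζ : ℝ, blochOp D k₀ c A ξ u u₁ u₂ ζ - μ • u ζ = Ψ ζ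

/-- `(μ, Ψ)` is a simple eigenpair of the Bloch operator
`L(ξ) = k₀² D (∂ + iξ)² + ω₀ (∂ + iξ) + f'(φ₀)`. -/
def IsBlochEigenpair (D : Matrix (Fin n) (Fin n) ℝ) (f : State n → State n) (k₀ ω₀ : ℝ)
    (φ₀ : ℝ → State n) (ξ : ℝ) (μ : ℂ) (Ψ : ℝ → Fin n → ℂ) : Prop :=
  IsSimpleEigenpair D k₀ ω₀ (fun ζ => jacobian f (φ₀ ζ)) ξ μ Ψ

/-- `(μ, Ψ)` is a simple eigenpair of the adjoint
`L(ξ)^* = k₀² D (∂ + iξ)² - ω₀ (∂ + iξ) + f'(φ₀)ᵀ` (recall that `D` is real symmetric). -/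
def IsAdjointBlochEigenpair (D : Matrix (Fin n) (Fin n) ℝ) (f : State n → State n) (k₀ ω₀ : ℝ)
    (φ₀ : ℝ → State n) (ξ : ℝ) (μ : ℂ) (Ψ : ℝ → Fin n → ℂ) : Prop :=
  IsSimpleEigenpair D k₀ (-ω₀) (fun ζ => (jacobian f (φ₀ ζ)).transpose) ξ μ Ψ

/-- Hypothesis (D3): `0` is a simple eigenvalue of `L(0)`. -/
def HypD3 (D : Matrix (Fin n) (Fin n) ℝ) (f : State n → State n) (k₀ ω₀ : ℝ)
    (φ₀ : ℝ → State n) : Prop :=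
  ∃ Ψ, IsBlochEigenpair D f k₀ ω₀ φ₀ 0 0 Ψ

/-- A real vector regarded as a complex one. -/
def toComplex (v : State n) : Fin n → ℂ := fun i => (v i : ℂ)

/-- The pairing `g^* w` of complex vectors. -/
def pairing (g w : Fin n → ℂ) : ℂ := ∑ i, (starRingEnd ℂ) (g i) * w i

/-- The inner product `⟨g, h⟩` of `L²(0,1)`. -/
def innerL2 (g h : ℝ → Fin n → ℂ) : ℂ := ∫ ζ in (0 : ℝ)..1, pairing (g ζ) (h ζ)

/-- The critical spectral curve: simple eigenvalues `lam ξ` of `L(ξ)`, `|ξ| < ξ₀`, depending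
analytically on `ξ`, with analytic eigenfunctions `Φ ξ` that continue `φ₀'` and adjoint
eigenfunctions `Φt ξ`, smooth in `ξ`, under the stated normalizations. Analyticity and smoothness
in `ξ` hold with values in spaces of periodic functions of arbitrarily high regularity. -/
structure IsCriticalCurve (D : Matrix (Fin n) (Fin n) ℝ) (f : State n → State n) (k₀ ω₀ : ℝ)
    (φ₀ : ℝ → State n) (ξ₀ : ℝ) (lam : ℝ → ℂ) (Φ Φt : ℝ → ℝ → Fin n → ℂ) : Prop where
  pos : 0 < ξ₀
  lt_pi : ξ₀ < Real.pi
  analytic : AnalyticOnNhd ℝ lam (Set.Ioo (-ξ₀) ξ₀)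
  eigen : ∀ ξ ∈ Set.Ioo (-ξ₀) ξ₀, IsBlochEigenpair D f k₀ ω₀ φ₀ ξ (lam ξ) (Φ ξ)
  eigen_zero : Φ 0 = fun ζ => toComplex (deriv φ₀ ζ)
  eigen_analytic : ∀ m, CurveAnalytic m (Set.Ioo (-ξ₀) ξ₀) Φ
  eigen_normalized : ∀ ξ ∈ Set.Ioo (-ξ₀) ξ₀, innerL2 (Φt 0) (Φ ξ) = 1
  adjoint : ∀ ξ ∈ Set.Ioo (-ξ₀) ξ₀,
    IsAdjointBlochEigenpair D f k₀ ω₀ φ₀ ξ ((starRingEnd ℂ) (lam ξ)) (Φt ξ)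
  adjoint_smooth : ∀ j m, CurveContDiff j m (Set.Ioo (-ξ₀) ξ₀) Φt
  adjoint_normalized : ∀ ξ ∈ Set.Ioo (-ξ₀) ξ₀, innerL2 (Φt ξ) (Φ ξ) = 1

/-- A smooth family of wave trains `φ(k x - freq(k) t; k)`, `|k - k₀| < r`, continuing `φ₀` in the
wavenumber, with the phase fixed by means of the adjoint eigenfunction `Φt₀` of `L(0)`. Here
`φ y k` stands for `φ(y;k)` and `freq k` for the temporal frequency at wavenumber `k`. -/
structure IsWaveTrainFamily (D : Matrix (Fin n) (Fin n) ℝ) (f : State n → State n) (k₀ ω₀ : ℝ)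
    (φ₀ : ℝ → State n) (Φt₀ : ℝ → Fin n → ℂ) (r : ℝ) (φ : ℝ → ℝ → State n) (freq : ℝ → ℝ) :
    Prop where
  pos : 0 < r
  smooth : ContDiffOn ℝ ∞ (fun p : ℝ × ℝ => φ p.1 p.2) (Set.univ ×ˢ Set.Ioo (k₀ - r) (k₀ + r))
  smooth_freq : ContDiffOn ℝ ∞ freq (Set.Ioo (k₀ - r) (k₀ + r))
  isWaveTrain : ∀ k ∈ Set.Ioo (k₀ - r) (k₀ + r), IsWaveTrain D f k (freq k) (fun y => φ y k)
  freq_eq : freq k₀ = ω₀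
  profile_eq : (fun y => φ y k₀) = φ₀
  gauge : innerL2 Φt₀ (fun ζ => toComplex (deriv (fun k => φ ζ k) k₀)) = 0

/-! ## The reaction-diffusion system in the co-moving frame -/

/-- `u ∈ C([0,T), C_ub) ∩ C((0,T), C_ub²) ∩ C¹((0,T), C_ub)` is a classical solution of
`∂ₜ u = k₀² D u_ζζ + ω₀ u_ζ + f(u)` with initial condition `u₀`. -/
structure IsClassicalSolution (D : Matrix (Fin n) (Fin n) ℝ) (f : State n → State n) (k₀ ω₀ : ℝ)
    (T : EReal) (u₀ : ℝ → State n) (u : ℝ → ℝ → State n) : Prop where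
  pos : 0 < T
  initial : u 0 = u₀
  continuous : CurveContDiff 0 0 (timesFromZero T) u
  continuous_two : CurveContDiff 0 2 (positiveTimes T) u
  differentiable : CurveContDiff 1 0 (positiveTimes T) u
  solves : ∀ t ∈ positiveTimes T, ∀ ζ,
    dt u t ζ = (k₀ ^ 2) • act D (iteratedDeriv 2 (u t) ζ) + ω₀ • deriv (u t) ζ + f (u t ζ)

/-! ## The phase modulation -/

/-- A smooth frequency cut-off. -/
structure IsFrequencyCutoff (ξ₀ : ℝ) (ρ : ℝ → ℝ) : Prop where
  smooth : ContDiff ℝ ∞ ρ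
  mem_Icc : ∀ ξ, ρ ξ ∈ Set.Icc (0 : ℝ) 1
  eq_one : ∀ ξ, |ξ| < ξ₀ / 2 → ρ ξ = 1
  eq_zero : ∀ ξ, ξ₀ < |ξ| → ρ ξ = 0

/-- A smooth temporal cut-off on `[0,∞)`. -/
structure IsTemporalCutoff (χ : ℝ → ℝ) : Prop where
  smooth : ContDiffOn ℝ ∞ χ (Set.Ici 0)
  mem_Icc : ∀ t, 0 ≤ t → χ t ∈ Set.Icc (0 : ℝ) 1
  eq_zero : ∀ t ∈ Set.Icc (0 : ℝ) 1, χ t = 0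
  eq_one : ∀ t, 2 ≤ t → χ t = 1

/-- The kernel `G_p⁰(ζ, ζ', t) = (2π)⁻¹ ∫ ρ(ξ) e^{iξ(ζ-ζ')} e^{lam(ξ) t} Φt_ξ(ζ')^* dξ`, a row
vector. -/
def principalKernel (ρ : ℝ → ℝ) (lam : ℝ → ℂ) (Φt : ℝ → ℝ → Fin n → ℂ) (ζ ζb t : ℝ) (i : Fin n) :
    ℂ :=
  ((2 * Real.pi : ℝ) : ℂ)⁻¹ * ∫ ξ : ℝ, (ρ ξ : ℂ) * Complex.exp (Complex.I * ξ * (ζ - ζb))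
    * Complex.exp (lam ξ * t) * (starRingEnd ℂ) (Φt ξ ζb i)

/-- The principal part `S_p⁰(t) v (ζ) = χ(t) ∫ G_p⁰(ζ, ζ', t) v(ζ') dζ'` of the semigroup. -/
def principalPart (ρ χ : ℝ → ℝ) (lam : ℝ → ℂ) (Φt : ℝ → ℝ → Fin n → ℂ) (t : ℝ) (v : ℝ → State n)
    (ζ : ℝ) : ℂ :=
  (χ t : ℂ) * ∫ ζb : ℝ, ∑ i, principalKernel ρ lam Φt ζ ζb t i * (v ζb i : ℂ)

/-- The semigroup `e^{-∂⁴ t}` on `C_ub(ℝ)`: convolution with the inverse Fourier transform of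
`e^{-ξ⁴ t}` for `t > 0`. -/
def biharmonicSemigroup (t : ℝ) (g : ℝ → ℝ) (ζ : ℝ) : ℝ :=
  if 0 < t then
    ∫ ζb : ℝ, ((2 * Real.pi)⁻¹ * ∫ ξ : ℝ, Real.cos (ξ * (ζ - ζb)) * Real.exp (-(ξ ^ 4 * t))) * g ζb
  else g ζ

/-- `Q(v,γ) = (f(φ₀+v) - f(φ₀) - f'(φ₀)v)(1 - γ_ζ)`. -/
def nonlinQ (f : State n → State n) (φ₀ : ℝ → State n) (v : ℝ → State n) (γ : ℝ → ℝ) (ζ : ℝ) :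
    State n :=
  (1 - deriv γ ζ) • (f (φ₀ ζ + v ζ) - f (φ₀ ζ) - fderiv ℝ f (φ₀ ζ) (v ζ))

/-- `R(v,γ,γ_t) = -γ_t v + ω₀ γ_ζ v + k₀²/(1-γ_ζ) D (γ_ζ² φ₀' - γ_ζζ v/(1-γ_ζ))`. -/
def nonlinR (D : Matrix (Fin n) (Fin n) ℝ) (k₀ ω₀ : ℝ) (φ₀ : ℝ → State n) (v : ℝ → State n)
    (γ γt : ℝ → ℝ) (ζ : ℝ) : State n :=
  -(γt ζ • v ζ) + (ω₀ * deriv γ ζ) • v ζ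
    + (k₀ ^ 2 / (1 - deriv γ ζ)) • act D
        ((deriv γ ζ) ^ 2 • deriv φ₀ ζ - (iteratedDeriv 2 γ ζ / (1 - deriv γ ζ)) • v ζ)

/-- `S(v,γ) = k₀² D (2 γ_ζ v + γ_ζ² v/(1-γ_ζ))`. -/
def nonlinS (D : Matrix (Fin n) (Fin n) ℝ) (k₀ : ℝ) (v : ℝ → State n) (γ : ℝ → ℝ) (ζ : ℝ) :
    State n :=
  (k₀ ^ 2) • act D ((2 * deriv γ ζ) • v ζ + ((deriv γ ζ) ^ 2 / (1 - deriv γ ζ)) • v ζ)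

/-- `N(v,γ,γ_t) = Q(v,γ) + ∂_ζ R(v,γ,γ_t) + ∂_ζ² S(v,γ)`. -/
def nonlinN (D : Matrix (Fin n) (Fin n) ℝ) (f : State n → State n) (k₀ ω₀ : ℝ) (φ₀ : ℝ → State n)
    (v : ℝ → State n) (γ γt : ℝ → ℝ) (ζ : ℝ) : State n :=
  nonlinQ f φ₀ v γ ζ + deriv (nonlinR D k₀ ω₀ φ₀ v γ γt) ζ
    + iteratedDeriv 2 (nonlinS D k₀ v γ) ζ

/-- The inverse-modulated perturbation `v(ζ,t) = u(ζ - γ(ζ,t), t) - φ₀(ζ)`. -/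
def invPert (φ₀ : ℝ → State n) (u : ℝ → ℝ → State n) (γ : ℝ → ℝ → ℝ) (t ζ : ℝ) : State n :=
  u t (ζ - γ t ζ) - φ₀ ζ

/-- The right-hand side of the integral equation for the phase modulation,
`S_p⁰(t)(v₀ + φ₀'γ₀ + γ₀'v₀) + ∫₀ᵗ S_p⁰(t-s) N(v(s),γ(s),∂ₜγ(s)) ds + (1-χ(t)) e^{-∂⁴t} γ₀`,
with `v₀(ζ) = u₀(ζ - γ₀(ζ)) - φ₀(ζ)`. -/
def phaseRHS (D : Matrix (Fin n) (Fin n) ℝ) (f : State n → State n) (k₀ ω₀ : ℝ) (φ₀ : ℝ → State n)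
    (ρ χ : ℝ → ℝ) (lam : ℝ → ℂ) (Φt : ℝ → ℝ → Fin n → ℂ) (u₀ : ℝ → State n) (γ₀ : ℝ → ℝ)
    (u : ℝ → ℝ → State n) (γ : ℝ → ℝ → ℝ) (t ζ : ℝ) : ℂ :=
  let v₀ : ℝ → State n := fun y => u₀ (y - γ₀ y) - φ₀ y
  principalPart ρ χ lam Φt t (fun y => v₀ y + γ₀ y • deriv φ₀ y + deriv γ₀ y • v₀ y) ζ
    + (∫ s in (0 : ℝ)..t, principalPart ρ χ lam Φt (t - s)
        (nonlinN D f k₀ ω₀ φ₀ (invPert φ₀ u γ s) (γ s) (dt γ s)) ζ)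
    + (((1 - χ t) * biharmonicSemigroup t γ₀ ζ : ℝ) : ℂ)

/-- `γ ∈ C([0,τ), C_ub¹) ∩ ⋂ C^j((0,τ), C_ub^l)` is a (real) solution on `[0,τ)` of the integral
equation for the phase modulation associated with the solution `u` on `[0,T)` with initial
condition `u₀`, and `‖γ_ζ(t)‖_∞ < r₀` for `t ∈ [0,τ)`. -/
structure IsPhaseModulation (D : Matrix (Fin n) (Fin n) ℝ) (f : State n → State n) (k₀ ω₀ : ℝ)
    (φ₀ : ℝ → State n) (ρ χ : ℝ → ℝ) (lam : ℝ → ℂ) (Φt : ℝ → ℝ → Fin n → ℂ) (r₀ : ℝ)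
    (u₀ : ℝ → State n) (γ₀ : ℝ → ℝ) (T : EReal) (u : ℝ → ℝ → State n) (τ : EReal)
    (γ : ℝ → ℝ → ℝ) : Prop where
  pos : 0 < τ
  le_max : τ ≤ max 1 T
  continuous : CurveContDiff 0 1 (timesFromZero τ) γ
  smooth : ∀ j l, CurveContDiff j l (positiveTimes τ) γ
  equation : ∀ t ∈ timesFromZero τ, ∀ ζ,
    (γ t ζ : ℂ) = phaseRHS D f k₀ ω₀ φ₀ ρ χ lam Φt u₀ γ₀ u γ t ζ
  small : ∀ t ∈ timesFromZero τ, supNorm (deriv (γ t)) < r₀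

/-! ## The modified forward-modulated perturbation and the damping estimate -/

/-- The modified forward-modulated perturbation
`z(ζ,t) = u(ζ,t) - φ(ζ + γ(ζ,t)(1 + γ_ζ(ζ,t)); k₀(1 + γ_ζ(ζ,t)))`. -/
def modPert (k₀ : ℝ) (φ : ℝ → ℝ → State n) (u : ℝ → ℝ → State n) (γ : ℝ → ℝ → ℝ) (t ζ : ℝ) :
    State n :=
  u t ζ - φ (ζ + γ t ζ * (1 + deriv (γ t) ζ)) (k₀ * (1 + deriv (γ t) ζ))

/-- `γ̃ = ∂ₜγ - a γ_ζ` with `a = ω₀ - k₀ freq'(k₀)`. -/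
def gammaTilde (k₀ ω₀ : ℝ) (freq : ℝ → ℝ) (γ : ℝ → ℝ → ℝ) (t ζ : ℝ) : ℝ :=
  dt γ t ζ - (ω₀ - k₀ * deriv freq k₀) * deriv (γ t) ζ

/-- The sum of squared norms at time `s` in the integrand of the damping estimate. -/
def dampingSource (k₀ ω₀ : ℝ) (freq : ℝ → ℝ) (z : ℝ → ℝ → State n) (γ : ℝ → ℝ → ℝ) (s : ℝ) : ℝ :=
  supNorm (z s) ^ 2
    + cubNorm 3 (iteratedDeriv 2 (γ s)) ^ 2
    + cubNorm 2 (dt (fun t => deriv (γ t)) s) ^ 2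
    + cubNorm 2 (gammaTilde k₀ ω₀ freq γ s) ^ 2
    + supNorm (deriv (γ s)) ^ 2 * (supNorm (deriv (γ s)) ^ 2 + supNorm (dt γ s) ^ 2)

end System

end WaveTrain

end

open WaveTrain

/-! Since the sup norm of `z = u - w`, with `w` the modulated wave train, is allowed on the
right-hand side, only the gradient of `z` has to be estimated. The perturbation solves a forced
linear system `z_t = k₀² D z_ζζ + ω₀ z_ζ + G`, and parabolic smoothing bounds `z_ζ` by the sup norms
of `z` and `G` over the distant past, and by `z_ζ` itself only over a short recent time span, where
it can be absorbed. The argument works directly in the sup norm, without energies.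

The forcing is `G = f(u) - f(w) + Res(w)`. The reaction difference is controlled in `C¹` by `z` and
`z_ζ` (`exists_reaction_bound`). For the residual, put `κ = k₀(1 + γ_ζ)` and `δ = γ_ζ² + γ γ_ζζ`.
The phase `θ = ζ + γ(1 + γ_ζ)` satisfies `k₀ θ_ζ = κ + k₀ δ`, so the profile equation at wavenumber
`κ` cancels the leading terms. After Taylor expansion of the frequency at `k₀`, the terms linear in
`γ_ζ` and `γ_t` that multiply `∂_y φ` combine to `-(γ_t - a γ_ζ)`, which explains the value of `a`.
Every other term contains `γ_ζζ`, `γ_ζζζ`, `∂ₜγ_ζ`, `δ`, `γ_ζ γ_t` or a quadratic Taylor remainder.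
Hence the residual is bounded in `C¹` by a constant times `S`, where `S²` is `dampingSource`
(`ModulationData.residual_small`, `exists_isForcedSolution`).

For the gradient, an eigenbasis of `D` decouples the linear part, and adding and subtracting each
component creates the damping `e^{-(t-s)}`. A Duhamel formula with Gaussian averages
(`hasDerivAt_average`) represents each component. The average of the source `H(s)` has Lipschitz
constant at most the minimum of `‖H_ζ‖` and a constant times `‖H‖/√(t-s)` (`abs_deriv_le`). The
first bound is used for `s` close to `t`, the second otherwise. Cauchy-Schwarz turns the remaining
integral of `S` into the root of an integral of `S²`, and the supremum of `e^{s/2}‖z_ζ(s)‖` comes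
back with a factor at most `1/2` and is absorbed (`exists_gradient_bound`). -/

namespace WaveTrain

section Library

open MeasureTheory ProbabilityTheory Filter Topology

/-! ## Gaussian averages and the gradient estimate for the damped heat equation -/

/-- The standard Gaussian measure on the real line. -/
noncomputable abbrev stdGaussian : Measure ℝ := gaussianReal 0 1

lemma gaussianPDFReal_std (x : ℝ) :
    gaussianPDFReal 0 1 x = (√(2 * Real.pi))⁻¹ * Real.exp (-(1 / 2) * x ^ 2) := by
  rw [gaussianPDFReal_def]
  simp only [NNReal.coe_one, mul_one, sub_zero]
  congr 2
  ring

lemma hasDerivAt_gaussianPDFReal_std (x : ℝ) :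
    HasDerivAt (gaussianPDFReal 0 1) (-(x * gaussianPDFReal 0 1 x)) x := by
  have h : HasDerivAt (fun y : ℝ => (√(2 * Real.pi))⁻¹ * Real.exp (-(1 / 2) * y ^ 2))
      ((√(2 * Real.pi))⁻¹ * (Real.exp (-(1 / 2) * x ^ 2) * (-(1 / 2) * ((2 : ℕ) * x ^ 1)))) x :=
    (((hasDerivAt_pow 2 x).const_mul (-(1 / 2 : ℝ))).exp).const_mul _
  rw [show gaussianPDFReal 0 1 = fun y : ℝ => (√(2 * Real.pi))⁻¹ * Real.exp (-(1 / 2) * y ^ 2)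
    from funext gaussianPDFReal_std]
  convert h using 1
  push_cast
  ring

lemma integrable_id_mul_gaussianPDFReal_std :
    Integrable (fun x : ℝ => x * gaussianPDFReal 0 1 x) := by
  have h := (integrable_mul_exp_neg_mul_sq (b := 1 / 2) (by norm_num)).const_mul
    ((√(2 * Real.pi))⁻¹)
  refine h.congr (ae_of_all _ fun x => ?_)
  simp only [gaussianPDFReal_std]
  ring

lemma integrable_abs_stdGaussian : Integrable (fun x : ℝ => |x|) stdGaussian := by
  have h := (memLp_id_gaussianReal (μ := 0) (v := 1) 1).integrable le_rfl
  exact h.abs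

lemma integrable_of_bounded_stdGaussian {w : ℝ → ℝ} {M : ℝ} (hw : Continuous w)
    (hM : ∀ x, |w x| ≤ M) : Integrable w stdGaussian :=
  Integrable.of_bound hw.aestronglyMeasurable M (ae_of_all _ hM)

lemma measurable_of_hasDerivAt {w w' : ℝ → ℝ} (hw : ∀ x, HasDerivAt w (w' x) x) :
    Measurable w' := by
  rw [show w' = deriv w from funext fun x => (hw x).deriv.symm]
  exact measurable_deriv w

/-- Gaussian integration by parts. -/
lemma integral_id_mul_stdGaussian {w w' : ℝ → ℝ} {M : ℝ} (hw : ∀ x, HasDerivAt w (w' x) x)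
    (hM : ∀ x, |w x| ≤ M) (hM' : ∀ x, |w' x| ≤ M) :
    ∫ x, x * w x ∂stdGaussian = ∫ x, w' x ∂stdGaussian := by
  have hwc : Continuous w := continuous_iff_continuousAt.2 fun x => (hw x).continuousAt
  rw [integral_gaussianReal_eq_integral_smul one_ne_zero,
    integral_gaussianReal_eq_integral_smul one_ne_zero]
  simp only [smul_eq_mul]
  have h := integral_mul_deriv_eq_deriv_mul_of_integrable (u := w) (u' := w')
    (v := fun x => -gaussianPDFReal 0 1 x) (v' := fun x => x * gaussianPDFReal 0 1 x)
    (fun x _ => hw x)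
    (fun x _ => (hasDerivAt_gaussianPDFReal_std x).fun_neg.congr_deriv (neg_neg _))
    (integrable_id_mul_gaussianPDFReal_std.bdd_mul (c := M) hwc.aestronglyMeasurable
      (ae_of_all _ hM))
    (((integrable_gaussianPDFReal 0 1).neg).bdd_mul (c := M)
      (measurable_of_hasDerivAt hw).aestronglyMeasurable
      (ae_of_all _ hM'))
    (((integrable_gaussianPDFReal 0 1).neg).bdd_mul (c := M) hwc.aestronglyMeasurable
      (ae_of_all _ hM))
  calc ∫ x, gaussianPDFReal 0 1 x * (x * w x) = ∫ x, w x * (x * gaussianPDFReal 0 1 x) := by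
        congr 1; ext x; ring
    _ = -∫ x, w' x * -gaussianPDFReal 0 1 x := h
    _ = ∫ x, gaussianPDFReal 0 1 x * w' x := by
        rw [← integral_neg]; congr 1; ext x; ring

/-- Integration by parts after an affine change of variables. It serves twice: to trade a derivative
of the source for a factor `1/b`, and to cancel diffusion against the shrinking width of the
Gaussian. -/
lemma integral_id_mul_comp_stdGaussian {w w' : ℝ → ℝ} {M : ℝ} (a b : ℝ)
    (hw : ∀ x, HasDerivAt w (w' x) x) (hM : ∀ x, |w x| ≤ M)
    (hM' : ∀ x, |w' x| ≤ M) :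
    ∫ x, x * w (a + b * x) ∂stdGaussian = b * ∫ x, w' (a + b * x) ∂stdGaussian := by
  rw [← integral_const_mul]
  refine integral_id_mul_stdGaussian (M := max M (|b| * M)) (w := fun x => w (a + b * x))
    (w' := fun x => b * w' (a + b * x)) (fun x => ?_)
    (fun x => (hM _).trans (le_max_left _ _)) (fun x => ?_)
  · have h2 : HasDerivAt (fun y : ℝ => a + b * y) b x := by
      simpa using ((hasDerivAt_id x).const_mul b).const_add a
    have h3 := (hw (a + b * x)).comp x h2
    rw [mul_comm] at h3
    exact h3
  · rw [abs_mul]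
    exact (mul_le_mul_of_nonneg_left (hM' _) (abs_nonneg _)).trans (le_max_right _ _)

/-- The Lipschitz constant of a Gaussian average is controlled by the sup norm of the function. -/
lemma abs_integral_sub_stdGaussian_le {H H' : ℝ → ℝ} {A B b : ℝ} (hb : 0 < b)
    (hH : ∀ x, HasDerivAt H (H' x) x) (hA : ∀ x, |H x| ≤ A)
    (hB : ∀ x, |H' x| ≤ B) (y₁ y₂ : ℝ) :
    |∫ x, H (y₁ + b * x) ∂stdGaussian - ∫ x, H (y₂ + b * x) ∂stdGaussian|
      ≤ min B ((∫ x, |x| ∂stdGaussian) * A / b) * |y₁ - y₂| := by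
  have hHcont : Continuous H := continuous_iff_continuousAt.2 fun x => (hH x).continuousAt
  have hder : ∀ y, HasDerivAt (fun y => ∫ x, H (y + b * x) ∂stdGaussian)
      (∫ x, H' (y + b * x) ∂stdGaussian) y := by
    intro y
    refine (hasDerivAt_integral_of_dominated_loc_of_deriv_le (μ := stdGaussian)
      (F := fun y x => H (y + b * x)) (F' := fun y x => H' (y + b * x)) (bound := fun _ => B)
      (s := Set.univ) univ_mem ?_ ?_ ?_ ?_ (integrable_const B) ?_).2
    · exact Eventually.of_forall fun y =>
        (hHcont.comp (by fun_prop : Continuous fun x : ℝ => y + b * x)).aestronglyMeasurable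
    · exact integrable_of_bounded_stdGaussian
        (hHcont.comp (by fun_prop : Continuous fun x : ℝ => y + b * x)) fun x => hA _
    · exact ((measurable_of_hasDerivAt hH).comp (g := H')
        (by fun_prop : Measurable fun x : ℝ => y + b * x)).aestronglyMeasurable
    · exact ae_of_all _ fun x y _ => hB _
    · refine ae_of_all _ fun x y _ => ?_
      simpa using (hH (y + b * x)).comp_add_const y (b * x)
  have hbound : ∀ y, ‖∫ x, H' (y + b * x) ∂stdGaussian‖
      ≤ min B ((∫ x, |x| ∂stdGaussian) * A / b) := by
    intro y
    refine le_min ?_ ?_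
    · simpa using norm_integral_le_of_norm_le_const (μ := stdGaussian)
        (f := fun x => H' (y + b * x)) (C := B) (ae_of_all _ fun x => hB (y + b * x))
    -- Integration by parts moves the derivative from `H` to the Gaussian: `b E H'(y + bN) = E N H(y
    -- + bN)`, which is at most `A E|N|` in absolute value.
    · have h1 := integral_id_mul_comp_stdGaussian (M := max A B) y b hH
        (fun x => (hA x).trans (le_max_left _ _)) (fun x => (hB x).trans (le_max_right _ _))
      have h2 : ‖∫ x, x * H (y + b * x) ∂stdGaussian‖ ≤ ∫ x, |x| * A ∂stdGaussian := by
        refine norm_integral_le_of_norm_le (integrable_abs_stdGaussian.mul_const A)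
          (ae_of_all _ fun x => ?_)
        rw [norm_mul]
        exact mul_le_mul_of_nonneg_left (hA _) (abs_nonneg _)
      rw [h1, integral_mul_const, norm_mul, Real.norm_of_nonneg hb.le] at h2
      rw [le_div_iff₀ hb, mul_comm]
      exact h2
  have h := convex_univ.norm_image_sub_le_of_norm_hasDerivWithin_le
    (f := fun y => ∫ x, H (y + b * x) ∂stdGaussian)
    (fun y _ => (hder y).hasDerivWithinAt) (fun y _ => hbound y) (Set.mem_univ y₂)
    (Set.mem_univ y₁)
  simpa [Real.norm_eq_abs] using h

/-- A scalar function of time and space together with its derivatives, bounded on a time interval,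
that solves the damped advection-diffusion equation `∂ₜq = d q_xx + c q_x - q + H`. -/
structure IsDampedHeatSolution (d c t₀ t₁ M : ℝ) (q qs qx qxx H : ℝ → ℝ → ℝ) : Prop where
  fderiv : ∀ s ∈ Set.Icc t₀ t₁, ∀ x, HasFDerivAt (fun p : ℝ × ℝ => q p.1 p.2)
    ((ContinuousLinearMap.fst ℝ ℝ ℝ).smulRight (qs s x)
      + (ContinuousLinearMap.snd ℝ ℝ ℝ).smulRight (qx s x)) (s, x)
  deriv_snd : ∀ s ∈ Set.Icc t₀ t₁, ∀ x, HasDerivAt (qx s) (qxx s x) x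
  continuous_source : ∀ s ∈ Set.Icc t₀ t₁, Continuous (H s)
  bound : ∀ s ∈ Set.Icc t₀ t₁, ∀ x, |q s x| ≤ M ∧ |qs s x| ≤ M ∧ |qx s x| ≤ M ∧ |qxx s x| ≤ M
  eq : ∀ s ∈ Set.Icc t₀ t₁, ∀ x, qs s x = d * qxx s x + c * qx s x - q s x + H s x

/-! ### Duhamel formula and gradient bound for the scalar damped equation -/

namespace IsDampedHeatSolution

variable {d c t₀ t₁ M : ℝ} {q qs qx qxx H : ℝ → ℝ → ℝ}

lemma deriv_fst_path (h : IsDampedHeatSolution d c t₀ t₁ M q qs qx qxx H) {s : ℝ}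
    (hs : s ∈ Set.Icc t₀ t₁) {X : ℝ → ℝ} {X' : ℝ} (hX : HasDerivAt X X' s) :
    HasDerivAt (fun s => q s (X s)) (qs s (X s) + X' * qx s (X s)) s := by
  have h1 := (h.fderiv s hs (X s)).comp_hasDerivAt s ((hasDerivAt_id s).prodMk hX)
  simpa [Function.comp_def] using h1

lemma deriv_space (h : IsDampedHeatSolution d c t₀ t₁ M q qs qx qxx H) {s : ℝ}
    (hs : s ∈ Set.Icc t₀ t₁) (x : ℝ) : HasDerivAt (q s) (qx s x) x := by
  have h1 := (h.fderiv s hs x).comp_hasDerivAt x ((hasDerivAt_const x s).prodMk (hasDerivAt_id x))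
  simpa [Function.comp_def] using h1

lemma continuous_space (h : IsDampedHeatSolution d c t₀ t₁ M q qs qx qxx H) {s : ℝ}
    (hs : s ∈ Set.Icc t₀ t₁) : Continuous (q s) :=
  continuous_iff_continuousAt.2 fun x => (h.deriv_space hs x).continuousAt

lemma continuous_space_fst (h : IsDampedHeatSolution d c t₀ t₁ M q qs qx qxx H) {s : ℝ}
    (hs : s ∈ Set.Icc t₀ t₁) : Continuous (qx s) :=
  continuous_iff_continuousAt.2 fun x => (h.deriv_snd s hs x).continuousAt

lemma measurable_time (h : IsDampedHeatSolution d c t₀ t₁ M q qs qx qxx H) {s : ℝ}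
    (hs : s ∈ Set.Icc t₀ t₁) : Measurable (qs s) := by
  have h1 : qs s = fun x => d * qxx s x + c * qx s x - q s x + H s x := funext (h.eq s hs)
  rw [h1]
  have := (h.continuous_space hs).measurable
  have := (h.continuous_space_fst hs).measurable
  have := measurable_of_hasDerivAt (h.deriv_snd s hs)
  have := (h.continuous_source s hs).measurable
  fun_prop

/-- The Gaussian average `e^{-(t₁-s)} E q(s, y + c (t₁-s) + √(2d(t₁-s)) N)`. -/
noncomputable def average (d c t₁ : ℝ) (q : ℝ → ℝ → ℝ) (y s : ℝ) : ℝ :=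
  Real.exp (-(t₁ - s)) * ∫ x, q s (y + c * (t₁ - s) + √(2 * d * (t₁ - s)) * x) ∂stdGaussian

lemma continuousOn_average (h : IsDampedHeatSolution d c t₀ t₁ M q qs qx qxx H) (y : ℝ) :
    ContinuousOn (average d c t₁ q y) (Set.Icc t₀ t₁) := by
  unfold average
  refine ContinuousOn.mul (by fun_prop) ?_
  refine continuousOn_of_dominated (bound := fun _ => M) ?_ ?_ (integrable_const M) ?_
  · exact fun s hs => ((h.continuous_space hs).comp (by fun_prop)).aestronglyMeasurable
  · exact fun s hs => ae_of_all _ fun x => (h.bound s hs _).1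
  · refine ae_of_all _ fun x s hs => ContinuousAt.continuousWithinAt ?_
    have h1 := (h.fderiv s hs (y + c * (t₁ - s) + √(2 * d * (t₁ - s)) * x)).continuousAt
    exact ContinuousAt.comp (g := fun p : ℝ × ℝ => q p.1 p.2)
      (f := fun s => (s, y + c * (t₁ - s) + √(2 * d * (t₁ - s)) * x)) h1 (by fun_prop)

/-- A Duhamel formula in differential form. The exponential contributes `q`, the moving centre `-c
q_x`, and the shrinking width a multiple of `N q_x`. Gaussian integration by parts turns the
expectation of the latter into that of `-d q_xx`, so the expectation of `q + q_s - c q_x - d q_xx =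
H` is left. -/
lemma hasDerivAt_average (h : IsDampedHeatSolution d c t₀ t₁ M q qs qx qxx H) (hd : 0 < d)
    (y : ℝ) {s : ℝ} (hs : s ∈ Set.Ioo t₀ t₁) :
    HasDerivAt (average d c t₁ q y) (average d c t₁ H y s) s := by
  set X : ℝ → ℝ → ℝ := fun s x => y + c * (t₁ - s) + √(2 * d * (t₁ - s)) * x with hX
  set X' : ℝ → ℝ → ℝ := fun s x => -c + -(d / √(2 * d * (t₁ - s))) * x with hX'
  have hXd : ∀ r ∈ Set.Ioo t₀ t₁, ∀ x, HasDerivAt (fun s => X s x) (X' r x) r := by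
    intro r hr x
    have hpos : 0 < 2 * d * (t₁ - r) := by
      have := sub_pos.2 hr.2
      positivity
    have h1 : HasDerivAt (fun s : ℝ => t₁ - s) (-1) r := by
      simpa using (hasDerivAt_id r).const_sub t₁
    have h2 := (h1.const_mul (2 * d)).sqrt hpos.ne'
    have h3 := ((h1.const_mul c).const_add y).add (h2.mul_const x)
    refine h3.congr_deriv ?_
    simp only [hX']
    field_simp
  have hXc : ∀ s, Continuous (X s) := fun s => by simp only [hX]; fun_prop
  have hsI := Set.Ioo_subset_Icc_self hs
  have hM : 0 ≤ M := (abs_nonneg _).trans (h.bound s hsI 0).1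
  -- The width has unbounded derivative as `s` tends to `t₁`. Stopping at the midpoint gives a
  -- dominating function that is uniform near `s`.
  set m := (s + t₁) / 2 with hm
  have hsm : s < m := by rw [hm]; linarith [hs.2]
  have hmt : m < t₁ := by rw [hm]; linarith [hs.2]
  have hder := hasDerivAt_integral_of_dominated_loc_of_deriv_le (μ := stdGaussian)
      (F := fun s x => q s (X s x)) (F' := fun s x => qs s (X s x) + X' s x * qx s (X s x))
      (bound := fun x => M + (|c| + d / √(2 * d * (t₁ - m)) * |x|) * M)
      (s := Set.Ioo t₀ m) (x₀ := s) (Ioo_mem_nhds hs.1 hsm) ?_ ?_ ?_ ?_ ?_ ?_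
  rotate_left
  · filter_upwards [Ioo_mem_nhds hs.1 hs.2] with r hr
    exact ((h.continuous_space (Set.Ioo_subset_Icc_self hr)).comp (hXc r)).aestronglyMeasurable
  · exact integrable_of_bounded_stdGaussian ((h.continuous_space hsI).comp (hXc s))
      fun x => (h.bound s hsI _).1
  · have h1 := (h.measurable_time hsI).comp (hXc s).measurable
    have h2 := ((h.continuous_space_fst hsI).comp (hXc s)).measurable
    have h3 : Measurable (X' s) := by simp only [hX']; fun_prop
    exact (h1.add (h3.mul h2)).aestronglyMeasurable
  · refine ae_of_all _ fun x r hr => ?_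
    have hrI : r ∈ Set.Icc t₀ t₁ := ⟨hr.1.le, (hr.2.trans hmt).le⟩
    have hb := h.bound r hrI (X r x)
    refine (norm_add_le _ _).trans (add_le_add hb.2.1 ?_)
    rw [norm_mul]
    refine mul_le_mul ?_ hb.2.2.1 (norm_nonneg _) (by positivity)
    refine (norm_add_le _ _).trans ?_
    rw [norm_neg, norm_mul, norm_neg, Real.norm_of_nonneg (by positivity : 0 ≤ d / _)]
    have hle : 2 * d * (t₁ - m) ≤ 2 * d * (t₁ - r) := by
      have := hr.2
      gcongr
    have hpos : 0 < 2 * d * (t₁ - m) := by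
      have := sub_pos.2 hmt
      positivity
    have : 0 < √(2 * d * (t₁ - m)) := Real.sqrt_pos.2 hpos
    simp only [Real.norm_eq_abs]
    gcongr
  · exact (integrable_const M).add
      (((integrable_const _).add (integrable_abs_stdGaussian.const_mul _)).mul_const _)
  · refine ae_of_all _ fun x r hr => ?_
    have hrI : r ∈ Set.Ioo t₀ t₁ := ⟨hr.1, hr.2.trans hmt⟩
    exact h.deriv_fst_path (Set.Ioo_subset_Icc_self hrI) (hXd r hrI x)
  have hE : HasDerivAt (fun s => Real.exp (-(t₁ - s))) (Real.exp (-(t₁ - s))) s := by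
    have h1 : HasDerivAt (fun s : ℝ => -(t₁ - s)) 1 s := by
      exact ((hasDerivAt_id' s).const_sub t₁).fun_neg.congr_deriv (neg_neg _)
    simpa using h1.exp
  refine (hE.mul hder.2).congr_deriv ?_
  have hpos : 0 < 2 * d * (t₁ - s) := by
    have := sub_pos.2 hs.2
    positivity
  have hsq : √(2 * d * (t₁ - s)) ≠ 0 := (Real.sqrt_pos.2 hpos).ne'
  have hst := integral_id_mul_comp_stdGaussian (M := M) (y + c * (t₁ - s)) (√(2 * d * (t₁ - s)))
    (h.deriv_snd s hsI) (fun x => (h.bound s hsI x).2.2.1)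
    (fun x => (h.bound s hsI x).2.2.2)
  have iq : Integrable (fun x => q s (X s x)) stdGaussian :=
    integrable_of_bounded_stdGaussian ((h.continuous_space hsI).comp (hXc s))
      fun x => (h.bound s hsI _).1
  have iqxx : Integrable (fun x => qxx s (X s x)) stdGaussian :=
    Integrable.of_bound ((measurable_of_hasDerivAt (h.deriv_snd s hsI)).comp
      (hXc s).measurable).aestronglyMeasurable M (ae_of_all _ fun x => (h.bound s hsI _).2.2.2)
  have iqx : Integrable (fun x => x * qx s (X s x)) stdGaussian := by
    refine ((memLp_id_gaussianReal (μ := 0) (v := 1) 1).integrable le_rfl).mul_bdd (c := M)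
      ((h.continuous_space_fst hsI).comp (hXc s)).aestronglyMeasurable
      (ae_of_all _ fun x => (h.bound s hsI _).2.2.1)
  have key : ∫ x, H s (X s x) ∂stdGaussian
      = ∫ x, q s (X s x) ∂stdGaussian
        + ∫ x, (qs s (X s x) + X' s x * qx s (X s x)) ∂stdGaussian := by
    have e1 : ∀ x, H s (X s x) = (q s (X s x) + (qs s (X s x) + X' s x * qx s (X s x)))
        + (d / √(2 * d * (t₁ - s)) * (x * qx s (X s x)) - d * qxx s (X s x)) := by
      intro x
      rw [h.eq s hsI (X s x)]
      simp only [hX']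
      ring
    have e2 : ∫ x, (d / √(2 * d * (t₁ - s)) * (x * qx s (X s x)) - d * qxx s (X s x))
        ∂stdGaussian = 0 := by
      rw [integral_sub (iqx.const_mul _) (iqxx.const_mul _), integral_const_mul,
        integral_const_mul]
      have : ∫ x, x * qx s (X s x) ∂stdGaussian
        = √(2 * d * (t₁ - s)) * ∫ x, qxx s (X s x) ∂stdGaussian := hst
      rw [this, ← mul_assoc, div_mul_cancel₀ _ hsq, sub_self]
    have e3 := integral_add (iq.add hder.1)
      ((iqx.const_mul (d / √(2 * d * (t₁ - s)))).sub (iqxx.const_mul d))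
    have e4 := integral_add iq hder.1
    simp only [Pi.add_apply, Pi.sub_apply] at e3
    rw [integral_congr_ae (ae_of_all _ e1), e3, e2, e4, add_zero]
  simp only [average]
  change _ = Real.exp (-(t₁ - s)) * ∫ x, H s (X s x) ∂stdGaussian
  rw [key]
  ring

/-- Gradient estimate for the damped advection-diffusion equation. -/
theorem abs_deriv_le (h : IsDampedHeatSolution d c t₀ t₁ M q qs qx qxx H) (hd : 0 < d)
    (ht : t₀ ≤ t₁) {Hx : ℝ → ℝ → ℝ} {A B ψ : ℝ → ℝ} {K : ℝ}
    (hH : ∀ s ∈ Set.Ioo t₀ t₁, ∀ x, HasDerivAt (H s) (Hx s x) x)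
    (hA : ∀ s ∈ Set.Ioo t₀ t₁, ∀ x, |H s x| ≤ A s)
    (hB : ∀ s ∈ Set.Ioo t₀ t₁, ∀ x, |Hx s x| ≤ B s)
    (hK : ∀ x, |qx t₀ x| ≤ K)
    (hψ : IntegrableOn ψ (Set.Icc t₀ t₁))
    (hle : ∀ s ∈ Set.Ioo t₀ t₁, Real.exp (-(t₁ - s)) *
      min (B s) ((∫ x, |x| ∂stdGaussian) * A s / √(2 * d * (t₁ - s))) ≤ ψ s) (x : ℝ) :
    |qx t₁ x| ≤ Real.exp (-(t₁ - t₀)) * K + ∫ s in t₀..t₁, ψ s := by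
  have h0 : t₀ ∈ Set.Icc t₀ t₁ := ⟨le_rfl, ht⟩
  have h1 : t₁ ∈ Set.Icc t₀ t₁ := ⟨ht, le_rfl⟩
  have hK0 : 0 ≤ K := (abs_nonneg _).trans (hK 0)
  -- Two-point differences of the averages are compared between `t₀` and `t₁`. Only an integrable
  -- majorant `ψ` of their time derivative is used, so no regularity of the source in time is
  -- required.
  have key : ∀ y₁ y₂, q t₁ y₁ - q t₁ y₂
      ≤ (Real.exp (-(t₁ - t₀)) * K + ∫ s in t₀..t₁, ψ s) * |y₁ - y₂| := by
    intro y₁ y₂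
    have hmono := intervalIntegral.sub_le_integral_of_hasDeriv_right_of_le ht
      ((h.continuousOn_average y₁).sub (h.continuousOn_average y₂))
      (fun s hs => ((h.hasDerivAt_average hd y₁ hs).sub
        (h.hasDerivAt_average hd y₂ hs)).hasDerivWithinAt)
      (hψ.mul_const |y₁ - y₂|) (fun s hs => by
        have hpos : 0 < 2 * d * (t₁ - s) := by
          have := sub_pos.2 hs.2
          positivity
        have e := abs_integral_sub_stdGaussian_le (Real.sqrt_pos.2 hpos) (hH s hs)
          (hA s hs) (hB s hs) (y₁ + c * (t₁ - s)) (y₂ + c * (t₁ - s))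
        rw [add_sub_add_right_eq_sub] at e
        unfold average
        rw [← mul_sub]
        calc _ ≤ Real.exp (-(t₁ - s)) * _ :=
              mul_le_mul_of_nonneg_left ((le_abs_self _).trans e) (Real.exp_pos _).le
          _ ≤ ψ s * |y₁ - y₂| := by
              rw [← mul_assoc]
              exact mul_le_mul_of_nonneg_right (hle s hs) (abs_nonneg _))
    -- At `s = t₁` the Gaussian has width zero and the average is `q` itself.
    have e1 : ∀ y, average d c t₁ q y t₁ = q t₁ y := fun y => by simp [average]
    have e0 : average d c t₁ q y₁ t₀ - average d c t₁ q y₂ t₀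
        ≤ Real.exp (-(t₁ - t₀)) * (K * |y₁ - y₂|) := by
      unfold average
      rw [← mul_sub]
      refine mul_le_mul_of_nonneg_left ?_ (Real.exp_pos _).le
      have i : ∀ y, Integrable (fun x => q t₀ (y + c * (t₁ - t₀) + √(2 * d * (t₁ - t₀)) * x))
          stdGaussian := fun y => integrable_of_bounded_stdGaussian
        ((h.continuous_space h0).comp (by fun_prop)) fun x => (h.bound t₀ h0 _).1
      rw [← integral_sub (i y₁) (i y₂)]
      refine (le_abs_self _).trans ?_
      have hb : ∀ x, ‖q t₀ (y₁ + c * (t₁ - t₀) + √(2 * d * (t₁ - t₀)) * x)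
          - q t₀ (y₂ + c * (t₁ - t₀) + √(2 * d * (t₁ - t₀)) * x)‖ ≤ K * |y₁ - y₂| := by
        intro x
        have e := convex_univ.norm_image_sub_le_of_norm_hasDerivWithin_le (f := q t₀)
          (fun y _ => (h.deriv_space h0 y).hasDerivWithinAt) (fun y _ => hK y)
          (Set.mem_univ (y₂ + c * (t₁ - t₀) + √(2 * d * (t₁ - t₀)) * x))
          (Set.mem_univ (y₁ + c * (t₁ - t₀) + √(2 * d * (t₁ - t₀)) * x))
        rw [add_sub_add_right_eq_sub, add_sub_add_right_eq_sub] at e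
        exact e
      simpa using norm_integral_le_of_norm_le_const (μ := stdGaussian) (ae_of_all _ hb)
    rw [intervalIntegral.integral_mul_const] at hmono
    simp only [Pi.sub_apply, e1] at hmono
    linarith
  -- Adding the estimates for the pairs `(1, 0)` and `(0, 1)` shows that the Lipschitz constant is
  -- nonnegative, without any sign condition on `ψ`.
  have hC : 0 ≤ Real.exp (-(t₁ - t₀)) * K + ∫ s in t₀..t₁, ψ s := by
    have k1 := key 1 0
    have k2 := key 0 1
    rw [show |(1 : ℝ) - 0| = 1 by norm_num] at k1
    rw [show |(0 : ℝ) - 1| = 1 by norm_num] at k2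
    linarith
  set C := Real.exp (-(t₁ - t₀)) * K + ∫ s in t₀..t₁, ψ s with hCdef
  have hL : LipschitzWith C.toNNReal (q t₁) := by
    refine LipschitzWith.of_dist_le_mul fun y₁ y₂ => ?_
    rw [Real.dist_eq, Real.dist_eq]
    have := key y₂ y₁
    have := key y₁ y₂
    rw [abs_sub_comm y₂] at *
    rw [Real.coe_toNNReal _ hC]
    refine abs_le.2 ⟨?_, ?_⟩ <;> linarith
  have := (h.deriv_space h1 x).le_of_lipschitz hL
  rwa [Real.coe_toNNReal _ hC] at this

end IsDampedHeatSolution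

/-! ## Sup norms and curves in the spaces `C_ub^l` -/

section Norms

variable {V : Type*} [NormedAddCommGroup V]

lemma supNorm_nonneg (g : ℝ → V) : 0 ≤ supNorm g := Real.iSup_nonneg fun _ => norm_nonneg _

lemma norm_le_supNorm {g : ℝ → V} {B : ℝ} (hB : ∀ x, ‖g x‖ ≤ B) (x : ℝ) : ‖g x‖ ≤ supNorm g :=
  le_ciSup (f := fun x => ‖g x‖) ⟨B, by rintro _ ⟨y, rfl⟩; exact hB y⟩ x

lemma supNorm_le {g : ℝ → V} {B : ℝ} (hB : ∀ x, ‖g x‖ ≤ B) : supNorm g ≤ B := ciSup_le hB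

lemma supNorm_coe (g : ℝ →ᵇ V) : supNorm (g : ℝ → V) = ‖g‖ :=
  (BoundedContinuousFunction.norm_eq_iSup_norm g).symm

lemma supNorm_le_cubNorm [NormedSpace ℝ V] {m j : ℕ} (hj : j ≤ m) (g : ℝ → V) :
    supNorm (iteratedDeriv j g) ≤ cubNorm m g :=
  Finset.single_le_sum (f := fun j => supNorm (iteratedDeriv j g))
    (fun _ _ => supNorm_nonneg _) (Finset.mem_range.2 (Nat.lt_succ_of_le hj))

lemma cubNorm_nonneg [NormedSpace ℝ V] (m : ℕ) (g : ℝ → V) : 0 ≤ cubNorm m g :=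
  Finset.sum_nonneg fun _ _ => supNorm_nonneg _

lemma cubNorm_one [NormedSpace ℝ V] (g : ℝ → V) : cubNorm 1 g = supNorm g + supNorm (deriv g) := by
  simp [cubNorm, Finset.sum_range_succ]

/-- The sup norm of a pointwise continuous, bounded family is measurable in the parameter. -/
lemma aestronglyMeasurable_supNorm {w : ℝ → ℝ → V} {a b B : ℝ} (hab : a ≤ b)
    (hc : ∀ x, ContinuousOn (fun s => w s x) (Set.Icc a b))
    (hB : ∀ s ∈ Set.Icc a b, ∀ x, ‖w s x‖ ≤ B) :
    AEStronglyMeasurable (fun s => supNorm (w s)) (volume.restrict (Set.Icc a b)) := by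
  -- A supremum of continuous functions of time is lower semicontinuous, hence measurable;
  -- `Set.projIcc` extends the curve to all times.
  have h1 : LowerSemicontinuous fun s => ⨆ x, ‖w (Set.projIcc a b hab s) x‖ := by
    refine lowerSemicontinuous_ciSup (fun s => ⟨B, ?_⟩) fun x => ?_
    · rintro _ ⟨x, rfl⟩
      exact hB _ (Set.projIcc a b hab s).2 x
    · have h2 : Continuous fun s => w (Set.projIcc a b hab s) x :=
        (continuousOn_iff_continuous_domRestrict.1 (hc x)).comp continuous_projIcc
      exact h2.norm.lowerSemicontinuous
  refine h1.measurable.aestronglyMeasurable.congr ?_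
  filter_upwards [ae_restrict_mem measurableSet_Icc] with s hs
  simp only [supNorm, Set.projIcc_of_mem hab hs]

end Norms

/-! ### Curves of bounded functions and their jets -/

section Curves

variable {V : Type*} [NormedAddCommGroup V] [NormedSpace ℝ V]

/-- Joint differentiability follows by splitting `U r y` into the Taylor remainder `U r - U s - (r -
s) U'` at `y`, the term `(r - s) U' y`, and `U s y`. The remainder is `o(r - s)` uniformly in `y`
because it is small in the sup norm, and continuity of `U'` allows `U' y` to be replaced by `U' x`.
-/
lemma hasFDerivAt_eval {U : ℝ → (ℝ →ᵇ V)} {U' : ℝ →ᵇ V} {s x : ℝ} {w : V}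
    (hU : HasDerivAt U U' s) (hw : HasDerivAt (U s) w x) :
    HasFDerivAt (fun p : ℝ × ℝ => U p.1 p.2)
      ((ContinuousLinearMap.fst ℝ ℝ ℝ).smulRight (U' x)
        + (ContinuousLinearMap.snd ℝ ℝ ℝ).smulRight w) (s, x) := by
  have h1 : HasFDerivAt (fun p : ℝ × ℝ => (U p.1 - U s - (p.1 - s) • U') p.2)
      (0 : ℝ × ℝ →L[ℝ] V) (s, x) := by
    refine .of_isLittleO ?_
    have e := (hasDerivAt_iff_isLittleO.1 hU).comp_tendsto
      (continuous_fst.tendsto ((s, x) : ℝ × ℝ))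
    have e2 : (fun p : ℝ × ℝ => p.1 - s) =O[𝓝 (s, x)] fun p => p - (s, x) :=
      Asymptotics.IsBigO.of_bound 1 (Eventually.of_forall fun p => by
        simpa using norm_fst_le (p - (s, x)))
    have e3 := e.trans_isBigO e2
    refine (Asymptotics.IsBigO.of_bound 1 (Eventually.of_forall fun p => ?_)).trans_isLittleO e3
    have := (U p.1 - U s - (p.1 - s) • U').norm_coe_le_norm p.2
    simpa using this
  have h2 : HasFDerivAt (fun p : ℝ × ℝ => (p.1 - s) • U' p.2)
      ((ContinuousLinearMap.fst ℝ ℝ ℝ).smulRight (U' x)) (s, x) := by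
    refine .of_isLittleO ?_
    have e1 : (fun p : ℝ × ℝ => U' p.2 - U' x) =o[𝓝 (s, x)] fun _ => (1 : ℝ) := by
      rw [Asymptotics.isLittleO_one_iff]
      have : Tendsto (fun p : ℝ × ℝ => U' p.2 - U' x) (𝓝 (s, x)) (𝓝 (U' x - U' x)) :=
        Continuous.tendsto (by fun_prop) _
      rwa [sub_self] at this
    have e2 : (fun p : ℝ × ℝ => p.1 - s) =O[𝓝 (s, x)] fun p => p - (s, x) :=
      Asymptotics.IsBigO.of_bound 1 (Eventually.of_forall fun p => by
        simpa using norm_fst_le (p - (s, x)))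
    have e3 := (e2.norm_norm.mul_isLittleO e1.norm_left)
    refine Asymptotics.IsLittleO.of_norm_norm (e3.congr (fun p => ?_) fun p => ?_)
    · simp [← smul_sub, norm_smul]
    · simp
  have h3 : HasFDerivAt (fun p : ℝ × ℝ => U s p.2)
      ((ContinuousLinearMap.snd ℝ ℝ ℝ).smulRight w) (s, x) := by
    have := hw.hasFDerivAt.comp (s, x) (hasFDerivAt_snd (𝕜 := ℝ) (p := ((s, x) : ℝ × ℝ)))
    refine this.congr_fderiv ?_
    ext <;> simp
  have h := (h1.add h2).add h3
  rw [zero_add] at h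
  refine h.congr_of_eventuallyEq (Eventually.of_forall fun p => ?_)
  simp

/-- The time derivative of a curve of differentiable functions with differentiable curve of
derivatives is differentiable. -/
lemma hasDerivAt_derivative_of_curves {U W : ℝ → (ℝ →ᵇ V)} {U' W' : ℝ →ᵇ V} {s : ℝ}
    (h : ∀ᶠ r in 𝓝 s, ∀ x, HasDerivAt (U r) (W r x) x)
    (hU : HasDerivAt U U' s) (hW : HasDerivAt W W' s) (x : ℝ) : HasDerivAt U' (W' x) x := by
  rw [hasDerivAt_iff_tendsto_slope] at hU hW
  have hWu := (BoundedContinuousFunction.tendsto_iff_tendstoUniformly.1 hW)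
  -- The difference quotients of `U` in time have those of `W` as spatial derivatives, and the
  -- latter converge uniformly, so limit and spatial derivative can be interchanged.
  refine hasDerivAt_of_tendstoUniformlyOnFilter (l := 𝓝[≠] s)
    (f := fun r x => slope U s r x) (f' := fun r x => slope W s r x)
    (hWu.tendstoUniformlyOnFilter.mono_right le_top) ?_ ?_
  · have h1 : ∀ᶠ r in 𝓝[≠] s, ∀ x, HasDerivAt (U r) (W r x) x := h.filter_mono nhdsWithin_le_nhds
    filter_upwards [h1.prod_inl (𝓝 x)] with p hp
    have e := ((hp p.2).sub (h.self_of_nhds p.2)).const_smul (p.1 - s)⁻¹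
    exact e
  · refine Eventually.of_forall fun y => ?_
    exact ((BoundedContinuousFunction.evalCLM ℝ y).continuous.tendsto _).comp hU

/-- `U s j` and `P s j` are the `j`-th spatial derivatives of `w s` and of its time derivative. -/
structure IsCurveJet (l : ℕ) (I : Set ℝ) (w : ℝ → ℝ → V) (U P : ℝ → ℕ → (ℝ →ᵇ V)) : Prop where
  value : ∀ s ∈ I, ∀ j ≤ l, ∀ x, U s j x = iteratedDeriv j (w s) x
  time : ∀ s ∈ I, ∀ j ≤ l, HasDerivAt (fun r => U r j) (P s j) s
  space : ∀ s ∈ I, ∀ j < l, ∀ x, HasDerivAt (U s j) (U s (j + 1) x) x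
  space_time : ∀ s ∈ I, ∀ j < l, ∀ x, HasDerivAt (P s j) (P s (j + 1) x) x
  continuousOn : ∀ j ≤ l, ContinuousOn (fun s => U s j) I
  continuousOn_time : ∀ j ≤ l, ContinuousOn (fun s => P s j) I

lemma IsCub.hasDerivAt_iteratedDeriv {l j : ℕ} {g : ℝ → V} (hg : IsCub l g) (hj : j < l) (x : ℝ) :
    HasDerivAt (iteratedDeriv j g) (iteratedDeriv (j + 1) g x) x := by
  have h := (hg.1.differentiable_iteratedDeriv j (by exact_mod_cast hj)) x
  rw [iteratedDeriv_succ]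
  exact h.hasDerivAt

lemma CurveContDiff.exists_jet {l : ℕ} {I : Set ℝ} (hI : IsOpen I) {w : ℝ → ℝ → V}
    (h : CurveContDiff 1 l I w) : ∃ U P, IsCurveJet l I w U P := by
  obtain ⟨U, hU, hj⟩ := h
  -- `Fin.ofNat (l + 1) j` reduces `j` modulo `l + 1`; entries of the jet with `j > l` are therefore
  -- meaningless, and all statements about it carry `j ≤ l` or `j < l`.
  have hval : ∀ j ≤ l, ((Fin.ofNat (l + 1) j : Fin (l + 1)) : ℕ) = j := fun j hj => by
    simpa using Nat.mod_eq_of_lt (Nat.lt_succ_of_le hj)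
  have hd : ∀ s ∈ I, HasDerivAt U (deriv U s) s := fun s hs =>
    ((hU.differentiableOn (by simp)).differentiableAt (hI.mem_nhds hs)).hasDerivAt
  have hc : ContinuousOn (deriv U) I := hU.continuousOn_deriv_of_isOpen hI (by simp)
  have hval' : ∀ s ∈ I, ∀ j ≤ l, ∀ x,
      U s (Fin.ofNat (l + 1) j) x = iteratedDeriv j (w s) x := fun s hs j hjl x => by
    rw [(hj s hs).2, hval j hjl]
  have hspace : ∀ s ∈ I, ∀ j < l, ∀ x, HasDerivAt (U s (Fin.ofNat (l + 1) j))
      (U s (Fin.ofNat (l + 1) (j + 1)) x) x := fun s hs j hjl x => by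
    rw [hval' s hs (j + 1) hjl]
    have : (U s (Fin.ofNat (l + 1) j) : ℝ → V) = iteratedDeriv j (w s) :=
      funext (hval' s hs j hjl.le)
    rw [this]
    exact (hj s hs).1.hasDerivAt_iteratedDeriv hjl x
  refine ⟨fun s j => U s (Fin.ofNat (l + 1) j), fun s j => deriv U s (Fin.ofNat (l + 1) j),
    hval', fun s hs j _ => hasDerivAt_pi.1 (hd s hs) _, hspace, fun s hs j hjl x => ?_,
    fun j _ => (continuous_apply _).comp_continuousOn hU.continuousOn,
    fun j _ => (continuous_apply _).comp_continuousOn hc⟩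
  refine hasDerivAt_derivative_of_curves (s := s) ?_ (hasDerivAt_pi.1 (hd s hs) _)
    (hasDerivAt_pi.1 (hd s hs) _) x
  filter_upwards [hI.mem_nhds hs] with r hr
  exact hspace r hr j hjl

lemma CurveContDiff.exists_continuous_jet {l : ℕ} {I : Set ℝ} {w : ℝ → ℝ → V}
    (h : CurveContDiff 0 l I w) : ∃ U : ℝ → ℕ → (ℝ →ᵇ V),
      (∀ j ≤ l, ContinuousOn (fun s => U s j) I) ∧
        ∀ s ∈ I, IsCub l (w s) ∧ ∀ j ≤ l, ∀ x, U s j x = iteratedDeriv j (w s) x := by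
  obtain ⟨U, hU, hj⟩ := h
  refine ⟨fun s j => U s (Fin.ofNat (l + 1) j),
    fun j _ => (continuous_apply _).comp_continuousOn hU.continuousOn,
    fun s hs => ⟨(hj s hs).1, fun j hjl x => ?_⟩⟩
  have : ((Fin.ofNat (l + 1) j : Fin (l + 1)) : ℕ) = j := by
    simpa using Nat.mod_eq_of_lt (Nat.lt_succ_of_le hjl)
  rw [(hj s hs).2, this]

namespace IsCurveJet

variable {l : ℕ} {I : Set ℝ} {w : ℝ → ℝ → V} {U P : ℝ → ℕ → (ℝ →ᵇ V)}

lemma hasDerivAt_time (h : IsCurveJet l I w U P) {s : ℝ} (hs : s ∈ I) {j : ℕ} (hj : j ≤ l)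
    (x : ℝ) : HasDerivAt (fun r => U r j x) (P s j x) s :=
  (BoundedContinuousFunction.evalCLM ℝ x : (ℝ →ᵇ V) →L[ℝ] V).hasFDerivAt.comp_hasDerivAt s
    (h.time s hs j hj)

lemma iteratedDeriv_eq (h : IsCurveJet l I w U P) {s : ℝ} (hs : s ∈ I) {j : ℕ} (hj : j ≤ l) :
    iteratedDeriv j (w s) = U s j := funext fun x => (h.value s hs j hj x).symm

lemma eq_value (h : IsCurveJet l I w U P) {s : ℝ} (hs : s ∈ I) (x : ℝ) : w s x = U s 0 x := by
  simp [h.value s hs 0 (Nat.zero_le _)]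

lemma deriv_eq (h : IsCurveJet l I w U P) {s : ℝ} (hs : s ∈ I) (hl : 1 ≤ l) (x : ℝ) :
    deriv (w s) x = U s 1 x := by
  simp [h.value s hs 1 hl]

lemma dt_eq (h : IsCurveJet l I w U P) (hI : IsOpen I) {s : ℝ} (hs : s ∈ I) :
    dt w s = P s 0 := by
  ext x
  refine ((h.hasDerivAt_time hs (Nat.zero_le _) x).congr_of_eventuallyEq ?_).deriv
  filter_upwards [hI.mem_nhds hs] with r hr
  exact h.eq_value hr x

lemma dt_deriv_eq (h : IsCurveJet l I w U P) (hI : IsOpen I) {s : ℝ} (hs : s ∈ I) (hl : 1 ≤ l) :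
    dt (fun t => deriv (w t)) s = P s 1 := by
  ext x
  refine ((h.hasDerivAt_time hs hl x).congr_of_eventuallyEq ?_).deriv
  filter_upwards [hI.mem_nhds hs] with r hr
  exact h.deriv_eq hr hl x

lemma iteratedDeriv_time (h : IsCurveJet l I w U P) {s : ℝ} (hs : s ∈ I) (i : ℕ) {j : ℕ}
    (hj : i + j ≤ l) : iteratedDeriv j (P s i : ℝ → V) = P s (i + j) := by
  induction j with
  | zero => simp
  | succ j ih =>
    rw [iteratedDeriv_succ, ih (by lia)]
    ext x
    exact (h.space_time s hs (i + j) (by lia) x).deriv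

lemma iteratedDeriv_space (h : IsCurveJet l I w U P) {s : ℝ} (hs : s ∈ I) (i : ℕ) {j : ℕ}
    (hj : i + j ≤ l) : iteratedDeriv j (U s i : ℝ → V) = U s (i + j) := by
  induction j with
  | zero => simp
  | succ j ih =>
    rw [iteratedDeriv_succ, ih (by lia)]
    ext x
    exact (h.space s hs (i + j) (by lia) x).deriv

lemma hasFDerivAt (h : IsCurveJet l I w U P) {s : ℝ} (hs : s ∈ I) {j : ℕ} (hj : j < l) (x : ℝ) :
    HasFDerivAt (fun p : ℝ × ℝ => U p.1 j p.2)
      ((ContinuousLinearMap.fst ℝ ℝ ℝ).smulRight (P s j x)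
        + (ContinuousLinearMap.snd ℝ ℝ ℝ).smulRight (U s (j + 1) x)) (s, x) :=
  hasFDerivAt_eval (h.time s hs j hj.le) (h.space s hs j hj x)

lemma exists_bound (h : IsCurveJet l I w U P) {a b : ℝ} (hab : Set.Icc a b ⊆ I) :
    ∃ M, 0 ≤ M ∧ ∀ s ∈ Set.Icc a b, ∀ j ≤ l, ∀ x, ‖U s j x‖ ≤ M ∧ ‖P s j x‖ ≤ M := by
  have h1 : ∀ j, ∃ M, 0 ≤ M ∧ (j ≤ l → ∀ s ∈ Set.Icc a b, ‖U s j‖ ≤ M ∧ ‖P s j‖ ≤ M) := by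
    intro j
    by_cases hj : j ≤ l
    · obtain ⟨M₁, h₁⟩ := isCompact_Icc.exists_bound_of_continuousOn
        ((h.continuousOn j hj).mono hab)
      obtain ⟨M₂, h₂⟩ := isCompact_Icc.exists_bound_of_continuousOn
        ((h.continuousOn_time j hj).mono hab)
      exact ⟨max 0 (max M₁ M₂), le_max_left _ _, fun _ s hs =>
        ⟨(h₁ s hs).trans (by simp), (h₂ s hs).trans (by simp)⟩⟩
    · exact ⟨0, le_rfl, fun h => absurd h hj⟩
  choose M hM0 hM using h1
  refine ⟨∑ j ∈ Finset.range (l + 1), M j, Finset.sum_nonneg fun j _ => hM0 j,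
    fun s hs j hj x => ?_⟩
  have hle : M j ≤ ∑ j ∈ Finset.range (l + 1), M j :=
    Finset.single_le_sum (fun j _ => hM0 j) (Finset.mem_range.2 (Nat.lt_succ_of_le hj))
  exact ⟨((U s j).norm_coe_le_norm x).trans (((hM j hj s hs).1).trans hle),
    ((P s j).norm_coe_le_norm x).trans (((hM j hj s hs).2).trans hle)⟩

end IsCurveJet

end Curves

lemma isOpen_positiveTimes (T : EReal) : IsOpen (positiveTimes T) := by
  have : positiveTimes T = Set.Ioi 0 ∩ (fun t : ℝ => (t : EReal)) ⁻¹' Set.Iio T := rfl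
  rw [this]
  exact isOpen_Ioi.inter (isOpen_Iio.preimage continuous_coe_real_ereal)

/-! ## Functions of phase and wavenumber -/

section Profiles

variable {V W : Type*} [NormedAddCommGroup V] [NormedSpace ℝ V]
  [NormedAddCommGroup W] [NormedSpace ℝ W]

/-- The derivative with respect to the phase. -/
noncomputable def phaseDeriv (F : ℝ → ℝ → V) (y k : ℝ) : V := deriv (fun y => F y k) y

/-- The derivative with respect to the wavenumber. -/
noncomputable def wavenumberDeriv (F : ℝ → ℝ → V) (y k : ℝ) : V := deriv (fun k => F y k) k

/-- A function of phase and wavenumber, smooth for wavenumbers in `J` and `1`-periodic in the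
phase. -/
structure IsProfile (J : Set ℝ) (F : ℝ → ℝ → V) : Prop where
  smooth : ContDiffOn ℝ ∞ (fun p : ℝ × ℝ => F p.1 p.2) (Set.univ ×ˢ J)
  periodic : ∀ k ∈ J, Function.Periodic (fun y => F y k) 1

namespace IsProfile

variable {J : Set ℝ} {F G : ℝ → ℝ → V}

lemma differentiableAt (h : IsProfile J F) (hJ : IsOpen J) {k : ℝ} (hk : k ∈ J) (y : ℝ) :
    DifferentiableAt ℝ (fun p : ℝ × ℝ => F p.1 p.2) (y, k) :=
  (h.smooth.differentiableOn (by simp)).differentiableAt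
    ((isOpen_univ.prod hJ).mem_nhds ⟨Set.mem_univ _, hk⟩)

lemma phaseDeriv_eq (h : IsProfile J F) (hJ : IsOpen J) {k : ℝ} (hk : k ∈ J) (y : ℝ) :
    phaseDeriv F y k = _root_.fderiv ℝ (fun p : ℝ × ℝ => F p.1 p.2) (y, k) (1, 0) :=
  (HasFDerivAt.comp_hasDerivAt (f := fun y : ℝ => (y, k)) y
    (h.differentiableAt hJ hk y).hasFDerivAt
    ((hasDerivAt_id' y).prodMk (hasDerivAt_const y k))).deriv

lemma wavenumberDeriv_eq (h : IsProfile J F) (hJ : IsOpen J) {k : ℝ} (hk : k ∈ J) (y : ℝ) :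
    wavenumberDeriv F y k = _root_.fderiv ℝ (fun p : ℝ × ℝ => F p.1 p.2) (y, k) (0, 1) :=
  (HasFDerivAt.comp_hasDerivAt (f := fun k : ℝ => (y, k)) k
    (h.differentiableAt hJ hk y).hasFDerivAt
    ((hasDerivAt_const k y).prodMk (hasDerivAt_id' k))).deriv

lemma hasFDerivAt (h : IsProfile J F) (hJ : IsOpen J) {k : ℝ} (hk : k ∈ J) (y : ℝ) :
    HasFDerivAt (fun p : ℝ × ℝ => F p.1 p.2)
      ((ContinuousLinearMap.fst ℝ ℝ ℝ).smulRight (phaseDeriv F y k)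
        + (ContinuousLinearMap.snd ℝ ℝ ℝ).smulRight (wavenumberDeriv F y k)) (y, k) := by
  refine (h.differentiableAt hJ hk y).hasFDerivAt.congr_fderiv ?_
  rw [h.phaseDeriv_eq hJ hk, h.wavenumberDeriv_eq hJ hk]
  ext <;> simp

lemma smooth_fderiv_apply (h : IsProfile J F) (hJ : IsOpen J) (v : ℝ × ℝ) :
    ContDiffOn ℝ ∞ (fun p : ℝ × ℝ => _root_.fderiv ℝ (fun p : ℝ × ℝ => F p.1 p.2) p v)
      (Set.univ ×ˢ J) :=
  (h.smooth.fderiv_of_isOpen (m := ∞) (isOpen_univ.prod hJ) (by simp)).clm_apply contDiffOn_const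

protected lemma phaseDeriv (h : IsProfile J F) (hJ : IsOpen J) : IsProfile J (phaseDeriv F) where
  smooth := (h.smooth_fderiv_apply hJ (1, 0)).congr fun p hp => h.phaseDeriv_eq hJ hp.2 p.1
  periodic k hk y := by
    have e : (fun y => F y k) = fun y => F (y + 1) k := funext fun y => (h.periodic k hk y).symm
    calc phaseDeriv F (y + 1) k = deriv (fun y => F (y + 1) k) y :=
          (deriv_comp_add_const (fun y => F y k) 1 y).symm
      _ = phaseDeriv F y k := by rw [← e]; rfl

protected lemma wavenumberDeriv (h : IsProfile J F) (hJ : IsOpen J) :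
    IsProfile J (wavenumberDeriv F) where
  smooth := (h.smooth_fderiv_apply hJ (0, 1)).congr fun p hp => h.wavenumberDeriv_eq hJ hp.2 p.1
  periodic k hk y := by
    refine EventuallyEq.deriv_eq ?_
    filter_upwards [hJ.mem_nhds hk] with k' hk'
    exact h.periodic k' hk' y

lemma clm_comp (h : IsProfile J F) (A : V →L[ℝ] W) : IsProfile J fun y k => A (F y k) where
  smooth := h.smooth.continuousLinearMap_comp A
  periodic k hk y := congrArg A (h.periodic k hk y)

lemma add (hF : IsProfile J F) (hG : IsProfile J G) : IsProfile J fun y k => F y k + G y k where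
  smooth := hF.smooth.add hG.smooth
  periodic k hk y := congrArg₂ (· + ·) (hF.periodic k hk y) (hG.periodic k hk y)

lemma exists_bound (h : IsProfile J F) {K : Set ℝ} (hK : IsCompact K) (hKJ : K ⊆ J) :
    ∃ M, 0 ≤ M ∧ ∀ k ∈ K, ∀ y, ‖F y k‖ ≤ M := by
  obtain ⟨M, hM⟩ := ((isCompact_Icc (a := (0 : ℝ)) (b := 1)).prod hK).exists_bound_of_continuousOn
    (h.smooth.continuousOn.mono (Set.prod_mono (Set.subset_univ _) hKJ))
  refine ⟨max 0 M, le_max_left _ _, fun k hk y => ?_⟩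
  obtain ⟨y', hy', e⟩ := (h.periodic k (hKJ hk)).exists_mem_Ico₀ one_pos y
  rw [e]
  exact (hM (y', k) ⟨Set.Ico_subset_Icc_self hy', hk⟩).trans (le_max_right _ _)

lemma comp_hasDerivAt (h : IsProfile J F) (hJ : IsOpen J) {θ κ : ℝ → ℝ} {θ' κ' x : ℝ}
    (hθ : HasDerivAt θ θ' x) (hκ : HasDerivAt κ κ' x) (hk : κ x ∈ J) :
    HasDerivAt (fun x => F (θ x) (κ x))
      (θ' • phaseDeriv F (θ x) (κ x) + κ' • wavenumberDeriv F (θ x) (κ x)) x := by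
  have := (h.hasFDerivAt hJ hk (θ x)).comp_hasDerivAt x (hθ.prodMk hκ)
  simpa [Function.comp_def] using this

lemma comp_hasFDerivAt (h : IsProfile J F) (hJ : IsOpen J) {θ κ : ℝ × ℝ → ℝ} {p : ℝ × ℝ}
    {θs θx κs κx : ℝ}
    (hθ : HasFDerivAt θ ((ContinuousLinearMap.fst ℝ ℝ ℝ).smulRight θs
      + (ContinuousLinearMap.snd ℝ ℝ ℝ).smulRight θx) p)
    (hκ : HasFDerivAt κ ((ContinuousLinearMap.fst ℝ ℝ ℝ).smulRight κs
      + (ContinuousLinearMap.snd ℝ ℝ ℝ).smulRight κx) p) (hk : κ p ∈ J) :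
    HasFDerivAt (fun p => F (θ p) (κ p))
      ((ContinuousLinearMap.fst ℝ ℝ ℝ).smulRight
          (θs • phaseDeriv F (θ p) (κ p) + κs • wavenumberDeriv F (θ p) (κ p))
        + (ContinuousLinearMap.snd ℝ ℝ ℝ).smulRight
          (θx • phaseDeriv F (θ p) (κ p) + κx • wavenumberDeriv F (θ p) (κ p))) p := by
  have := (h.hasFDerivAt hJ hk (θ p)).comp p (hθ.prodMk hκ)
  refine this.congr_fderiv ?_
  ext <;> simp

end IsProfile

end Profiles

/-! ## Uniform `C¹`-bounds over a family of functions -/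

section Families

/-- Admissible spatial derivatives `g j` of a phase modulation and `p j` of its time derivative at
a fixed time, with the bounds that enter the residual estimate. -/
structure ModulationData (a r₀ R : ℝ) where
  /-- spatial derivatives of the phase modulation -/
  g : ℕ → ℝ → ℝ
  /-- spatial derivatives of the time derivative of the phase modulation -/
  p : ℕ → ℝ → ℝ
  /-- size of the source terms -/
  S : ℝ
  hasDerivAt_g : ∀ j < 4, ∀ x, HasDerivAt (g j) (g (j + 1) x) x
  hasDerivAt_p : ∀ j < 2, ∀ x, HasDerivAt (p j) (p (j + 1) x) x
  bound : ∀ j ≤ 2, ∀ x, |g j x| ≤ R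
  small : ∀ x, |g 1 x| ≤ r₀
  source_g : ∀ j, 2 ≤ j → j ≤ 4 → ∀ x, |g j x| ≤ S
  source_p : ∀ j, 1 ≤ j → j ≤ 2 → ∀ x, |p j x| ≤ S
  source_transport : ∀ j ≤ 1, ∀ x, |p j x - a * g (j + 1) x| ≤ S
  source_sq : ∀ x, |g 1 x| * |g 1 x| ≤ S
  source_mul : ∀ x, |g 1 x| * |p 0 x| ≤ S

variable {a r₀ R : ℝ} {V : Type*} [NormedAddCommGroup V] [NormedSpace ℝ V]

/-- A family of functions, bounded together with its derivatives. -/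
def IsBoundedFamily (T : ModulationData a r₀ R × ℝ → V) : Prop :=
  T =O[⊤] (fun _ => (1 : ℝ)) ∧ ∃ T' : ModulationData a r₀ R × ℝ → V,
    (∀ d x, HasDerivAt (fun x => T (d, x)) (T' (d, x)) x) ∧ T' =O[⊤] (fun _ => (1 : ℝ))

/-- A family of functions, controlled together with its derivatives by the source terms. -/
def IsSmallFamily (T : ModulationData a r₀ R × ℝ → V) : Prop :=
  T =O[⊤] (fun q => q.1.S) ∧ ∃ T' : ModulationData a r₀ R × ℝ → V,
    (∀ d x, HasDerivAt (fun x => T (d, x)) (T' (d, x)) x) ∧ T' =O[⊤] (fun q => q.1.S)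

lemma IsSmallFamily.add {T₁ T₂ : ModulationData a r₀ R × ℝ → V} (h₁ : IsSmallFamily T₁)
    (h₂ : IsSmallFamily T₂) : IsSmallFamily fun q => T₁ q + T₂ q := by
  obtain ⟨b₁, T₁', d₁, b₁'⟩ := h₁
  obtain ⟨b₂, T₂', d₂, b₂'⟩ := h₂
  exact ⟨b₁.add b₂, fun q => T₁' q + T₂' q, fun d x => (d₁ d x).add (d₂ d x), b₁'.add b₂'⟩

lemma IsSmallFamily.const_mul {c : ModulationData a r₀ R × ℝ → ℝ} (h : IsSmallFamily c) (m : ℝ) :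
    IsSmallFamily fun q => m * c q := by
  obtain ⟨b, c', d, b'⟩ := h
  exact ⟨b.const_mul_left m, fun q => m * c' q, fun e x => (d e x).const_mul m,
    b'.const_mul_left m⟩

lemma IsSmallFamily.smul {c : ModulationData a r₀ R × ℝ → ℝ} {T : ModulationData a r₀ R × ℝ → V}
    (h₁ : IsSmallFamily c) (h₂ : IsBoundedFamily T) : IsSmallFamily fun q => c q • T q := by
  obtain ⟨b₁, c', d₁, b₁'⟩ := h₁
  obtain ⟨b₂, T', d₂, b₂'⟩ := h₂
  refine ⟨?_, fun q => c q • T' q + c' q • T q, fun d x => (d₁ d x).smul (d₂ d x), ?_⟩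
  · simpa using b₁.smul b₂
  · simpa using (b₁.smul b₂').add (b₁'.smul b₂)

lemma IsSmallFamily.mul_bounded {c b : ModulationData a r₀ R × ℝ → ℝ} (h₁ : IsSmallFamily c)
    (h₂ : IsBoundedFamily b) : IsSmallFamily fun q => c q * b q := h₁.smul h₂

/-- The product of two small families, that are bounded themselves, is small. -/
lemma IsSmallFamily.mul {c b : ModulationData a r₀ R × ℝ → ℝ} (h₁ : IsSmallFamily c)
    (h₂ : IsSmallFamily b) (hc : c =O[⊤] fun _ => (1 : ℝ)) (hb : b =O[⊤] fun _ => (1 : ℝ)) :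
    IsSmallFamily fun q => c q * b q := by
  obtain ⟨b₁, c', d₁, b₁'⟩ := h₁
  obtain ⟨b₂, b', d₂, b₂'⟩ := h₂
  refine ⟨?_, fun q => c' q * b q + c q * b' q, fun d x => (d₁ d x).mul (d₂ d x), ?_⟩
  · simpa using b₁.mul hb
  · have e₁ := b₁'.mul hb
    have e₂ := hc.mul b₂'
    simp only [mul_one, one_mul] at e₁ e₂
    exact e₁.add e₂

/-- A big-O along `⊤` holds at every point, so a single constant serves all modulation data and all
positions. This is the source of uniformity in the solution, the modulation and time. -/
lemma IsSmallFamily.exists_bound {T : ModulationData a r₀ R × ℝ → V} (h : IsSmallFamily T) :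
    ∃ C, 0 ≤ C ∧ ∀ d x, ‖T (d, x)‖ ≤ C * d.S ∧
      ∃ T', HasDerivAt (fun x => T (d, x)) T' x ∧ ‖T'‖ ≤ C * d.S := by
  obtain ⟨b, T', d, b'⟩ := h
  obtain ⟨C, hC⟩ := Asymptotics.isBigO_top.1 b
  obtain ⟨C', hC'⟩ := Asymptotics.isBigO_top.1 b'
  have hS : ∀ e : ModulationData a r₀ R, 0 ≤ e.S := fun e =>
    (abs_nonneg _).trans (e.source_g 2 le_rfl (by norm_num) 0)
  refine ⟨max 0 (max C C'), le_max_left _ _, fun e x => ⟨?_, T' (e, x), d e x, ?_⟩⟩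
  · refine (hC (e, x)).trans ?_
    rw [Real.norm_of_nonneg (hS e)]
    exact mul_le_mul_of_nonneg_right (by simp) (hS e)
  · refine (hC' (e, x)).trans ?_
    rw [Real.norm_of_nonneg (hS e)]
    exact mul_le_mul_of_nonneg_right (by simp) (hS e)

/-! ### Bounded and small quantities built from the phase modulation -/

namespace ModulationData

lemma g_isBigO_one {j : ℕ} (hj : j ≤ 2) :
    (fun q : ModulationData a r₀ R × ℝ => q.1.g j q.2) =O[⊤] fun _ => (1 : ℝ) :=
  Asymptotics.isBigO_top.2 ⟨R, fun q => by simpa using q.1.bound j hj q.2⟩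

lemma isBigO_source {c : ModulationData a r₀ R × ℝ → ℝ} (h : ∀ q, |c q| ≤ q.1.S) :
    c =O[⊤] fun q => q.1.S :=
  Asymptotics.isBigO_top.2 ⟨1, fun q => by simpa using (h q).trans (le_abs_self _)⟩

lemma g_isBigO_source {j : ℕ} (hj : 2 ≤ j) (hj' : j ≤ 4) :
    (fun q : ModulationData a r₀ R × ℝ => q.1.g j q.2) =O[⊤] fun q => q.1.S :=
  isBigO_source fun q => q.1.source_g j hj hj' q.2

lemma p_isBigO_source {j : ℕ} (hj : 1 ≤ j) (hj' : j ≤ 2) :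
    (fun q : ModulationData a r₀ R × ℝ => q.1.p j q.2) =O[⊤] fun q => q.1.S :=
  isBigO_source fun q => q.1.source_p j hj hj' q.2

lemma g_one_sq_isBigO_source :
    (fun q : ModulationData a r₀ R × ℝ => q.1.g 1 q.2 * q.1.g 1 q.2) =O[⊤] fun q => q.1.S :=
  isBigO_source fun q => by simpa [abs_mul] using q.1.source_sq q.2

lemma g_bounded {j : ℕ} (hj : j ≤ 1) :
    IsBoundedFamily fun q : ModulationData a r₀ R × ℝ => q.1.g j q.2 :=
  ⟨g_isBigO_one (by lia), fun q => q.1.g (j + 1) q.2, fun d x => d.hasDerivAt_g j (by lia) x,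
    g_isBigO_one (by lia)⟩

lemma g_small {j : ℕ} (hj : 2 ≤ j) (hj' : j ≤ 3) :
    IsSmallFamily fun q : ModulationData a r₀ R × ℝ => q.1.g j q.2 :=
  ⟨g_isBigO_source hj (by lia), fun q => q.1.g (j + 1) q.2,
    fun d x => d.hasDerivAt_g j (by lia) x, g_isBigO_source (by lia) (by lia)⟩

lemma p_one_small : IsSmallFamily fun q : ModulationData a r₀ R × ℝ => q.1.p 1 q.2 :=
  ⟨p_isBigO_source le_rfl (by lia), fun q => q.1.p 2 q.2,
    fun d x => d.hasDerivAt_p 1 (by lia) x, p_isBigO_source (by lia) (by lia)⟩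

lemma transport_small :
    IsSmallFamily fun q : ModulationData a r₀ R × ℝ => q.1.p 0 q.2 - a * q.1.g 1 q.2 :=
  ⟨isBigO_source fun q => q.1.source_transport 0 (by lia) q.2,
    fun q => q.1.p 1 q.2 - a * q.1.g 2 q.2,
    fun d x => (d.hasDerivAt_p 0 (by lia) x).sub ((d.hasDerivAt_g 1 (by lia) x).const_mul a),
    isBigO_source fun q => q.1.source_transport 1 (by lia) q.2⟩

/-- The slope `γ_ζ` alone is bounded but not small; only its square is controlled by the source. The
derivative of the square is small because it contains the factor `γ_ζζ`. -/
lemma g_one_sq_small :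
    IsSmallFamily fun q : ModulationData a r₀ R × ℝ => q.1.g 1 q.2 * q.1.g 1 q.2 := by
  refine ⟨g_one_sq_isBigO_source, fun q => q.1.g 2 q.2 * q.1.g 1 q.2 + q.1.g 1 q.2 * q.1.g 2 q.2,
    fun d x => (d.hasDerivAt_g 1 (by lia) x).mul (d.hasDerivAt_g 1 (by lia) x), ?_⟩
  have h := (g_isBigO_source (a := a) (r₀ := r₀) (R := R) le_rfl (by lia)).mul
    (g_isBigO_one (a := a) (r₀ := r₀) (R := R) (j := 1) (by lia))
  have h' := (g_isBigO_one (a := a) (r₀ := r₀) (R := R) (j := 1) (by lia)).mul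
    (g_isBigO_source (a := a) (r₀ := r₀) (R := R) (j := 2) le_rfl (by lia))
  simp only [mul_one, one_mul] at h h'
  exact h.add h'

/-- The derivative contains `γ_ζζ γ_t`, where `γ_t` has no uniform bound of its own. Writing `γ_t =
(γ_t - a γ_ζ) + a γ_ζ` makes it a sum of products of one small and one bounded factor. -/
lemma g_one_mul_p_small :
    IsSmallFamily fun q : ModulationData a r₀ R × ℝ => q.1.g 1 q.2 * q.1.p 0 q.2 := by
  have e1 : (fun q : ModulationData a r₀ R × ℝ => q.1.g 1 q.2 * q.1.p 0 q.2)
      =O[⊤] fun q => q.1.S :=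
    isBigO_source fun q => by simpa [abs_mul] using q.1.source_mul q.2
  refine ⟨e1, fun q => q.1.g 2 q.2 * q.1.p 0 q.2 + q.1.g 1 q.2 * q.1.p 1 q.2,
    fun d x => (d.hasDerivAt_g 1 (by lia) x).mul (d.hasDerivAt_p 0 (by lia) x), ?_⟩
  have h1 := (g_isBigO_one (a := a) (r₀ := r₀) (R := R) (j := 2) le_rfl).mul
    (transport_small (a := a) (r₀ := r₀) (R := R)).1
  have h2 := ((g_isBigO_one (a := a) (r₀ := r₀) (R := R) (j := 1) (by lia)).mul
    (g_isBigO_source (a := a) (r₀ := r₀) (R := R) (j := 2) le_rfl (by lia))).const_mul_left a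
  have h3 := (g_isBigO_one (a := a) (r₀ := r₀) (R := R) (j := 1) (by lia)).mul
    (p_isBigO_source (a := a) (r₀ := r₀) (R := R) (j := 1) le_rfl (by lia))
  simp only [one_mul] at h1 h2 h3
  refine ((h1.add h2).add h3).congr_left fun q => ?_
  ring

/-- The defect `γ_ζ² + γ γ_ζζ` of the phase derivative. -/
def defect (q : ModulationData a r₀ R × ℝ) : ℝ :=
  q.1.g 1 q.2 * q.1.g 1 q.2 + q.1.g 2 q.2 * q.1.g 0 q.2

lemma defect_small : IsSmallFamily (defect (a := a) (r₀ := r₀) (R := R)) :=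
  g_one_sq_small.add ((g_small le_rfl (by lia)).mul_bounded (g_bounded (by lia)))

lemma defect_isBigO_one :
    (defect (a := a) (r₀ := r₀) (R := R)) =O[⊤] fun _ => (1 : ℝ) := by
  have h1 := (g_isBigO_one (a := a) (r₀ := r₀) (R := R) (j := 1) (by lia)).mul
    (g_isBigO_one (a := a) (r₀ := r₀) (R := R) (j := 1) (by lia))
  have h2 := (g_isBigO_one (a := a) (r₀ := r₀) (R := R) (j := 2) (by lia)).mul
    (g_isBigO_one (a := a) (r₀ := r₀) (R := R) (j := 0) (by lia))
  simp only [mul_one] at h1 h2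
  exact h1.add h2

/-- The modulated phase `ζ + γ(1 + γ_ζ)`. -/
def phase (d : ModulationData a r₀ R) (x : ℝ) : ℝ := x + d.g 0 x * (1 + d.g 1 x)

/-- The modulated wavenumber `k₀(1 + γ_ζ)`. -/
def wavenumber (k₀ : ℝ) (d : ModulationData a r₀ R) (x : ℝ) : ℝ := k₀ * (1 + d.g 1 x)

lemma hasDerivAt_phase (d : ModulationData a r₀ R) (x : ℝ) :
    HasDerivAt d.phase (1 + d.g 1 x + defect (d, x)) x := by
  have h := (hasDerivAt_id x).add ((d.hasDerivAt_g 0 (by lia) x).mul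
    ((d.hasDerivAt_g 1 (by lia) x).const_add 1))
  refine h.congr_deriv ?_
  simp only [defect]
  ring

lemma hasDerivAt_wavenumber (k₀ : ℝ) (d : ModulationData a r₀ R) (x : ℝ) :
    HasDerivAt (d.wavenumber k₀) (k₀ * d.g 2 x) x :=
  ((d.hasDerivAt_g 1 (by lia) x).const_add 1).const_mul k₀

lemma wavenumber_mem (k₀ : ℝ) (d : ModulationData a r₀ R) (x : ℝ) :
    d.wavenumber k₀ x ∈ Set.Icc (k₀ - |k₀| * r₀) (k₀ + |k₀| * r₀) := by
  have h : |k₀ * d.g 1 x| ≤ |k₀| * r₀ := by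
    rw [abs_mul]
    exact mul_le_mul_of_nonneg_left (d.small x) (abs_nonneg _)
  have := abs_le.1 h
  simp only [wavenumber]
  constructor <;> linarith

/-- The phase is unbounded, but the profile is periodic in it. The condition `|k₀| r₀ < r` confines
the wavenumber to a fixed compact subinterval, so compactness bounds the profile and its derivatives
uniformly. -/
lemma comp_bounded {k₀ r : ℝ} (hr : |k₀| * r₀ < r) {F : ℝ → ℝ → V}
    (hF : IsProfile (Set.Ioo (k₀ - r) (k₀ + r)) F) :
    IsBoundedFamily fun q : ModulationData a r₀ R × ℝ => F (q.1.phase q.2) (q.1.wavenumber k₀ q.2)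
    := by
  have hsub : Set.Icc (k₀ - |k₀| * r₀) (k₀ + |k₀| * r₀) ⊆ Set.Ioo (k₀ - r) (k₀ + r) :=
    Set.Icc_subset_Ioo (by linarith) (by linarith)
  have hb : ∀ {F : ℝ → ℝ → V}, IsProfile (Set.Ioo (k₀ - r) (k₀ + r)) F →
      (fun q : ModulationData a r₀ R × ℝ => F (q.1.phase q.2) (q.1.wavenumber k₀ q.2))
        =O[⊤] fun _ => (1 : ℝ) := by
    intro F hF
    obtain ⟨M, -, hM⟩ := hF.exists_bound isCompact_Icc hsub
    exact Asymptotics.isBigO_top.2 ⟨M, fun q => by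
      simpa using hM _ (q.1.wavenumber_mem k₀ q.2) (q.1.phase q.2)⟩
  refine ⟨hb hF, fun q => (1 + q.1.g 1 q.2 + defect q) •
      phaseDeriv F (q.1.phase q.2) (q.1.wavenumber k₀ q.2)
    + (k₀ * q.1.g 2 q.2) • wavenumberDeriv F (q.1.phase q.2) (q.1.wavenumber k₀ q.2),
    fun d x => hF.comp_hasDerivAt isOpen_Ioo (d.hasDerivAt_phase x) (d.hasDerivAt_wavenumber k₀ x)
      (hsub (d.wavenumber_mem k₀ x)), ?_⟩
  have h1 := (((Asymptotics.isBigO_refl (fun _ => (1 : ℝ)) ⊤).add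
    (g_isBigO_one (a := a) (r₀ := r₀) (R := R) (j := 1) (by lia))).add defect_isBigO_one).smul
      (hb (hF.phaseDeriv isOpen_Ioo))
  have h2 := ((g_isBigO_one (a := a) (r₀ := r₀) (R := R) (j := 2) le_rfl).const_mul_left k₀).smul
      (hb (hF.wavenumberDeriv isOpen_Ioo))
  simp only [smul_eq_mul, mul_one] at h1 h2
  exact h1.add h2

lemma one_add_g_bounded :
    IsBoundedFamily fun q : ModulationData a r₀ R × ℝ => 1 + q.1.g 1 q.2 :=
  ⟨(Asymptotics.isBigO_refl (fun _ => (1 : ℝ)) ⊤).add (g_isBigO_one (j := 1) (by lia)),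
    fun q => q.1.g 2 q.2, fun d x => (d.hasDerivAt_g 1 (by lia) x).const_add 1,
    g_isBigO_one le_rfl⟩

/-- The quadratic Taylor remainder of the dispersion relation along the modulated wavenumber. -/
lemma taylor_small {k₀ r : ℝ} (hr : |k₀| * r₀ < r) {ϖ : ℝ → ℝ}
    (hϖ : ContDiffOn ℝ ∞ ϖ (Set.Ioo (k₀ - r) (k₀ + r))) :
    IsSmallFamily fun q : ModulationData a r₀ R × ℝ =>
      ϖ (q.1.wavenumber k₀ q.2) - ϖ k₀ - deriv ϖ k₀ * (k₀ * q.1.g 1 q.2) := by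
  set J := Set.Ioo (k₀ - r) (k₀ + r) with hJ
  set K := Set.Icc (k₀ - |k₀| * r₀) (k₀ + |k₀| * r₀) with hK
  have hsub : K ⊆ J := Set.Icc_subset_Ioo (by linarith) (by linarith)
  have hd : ∀ k ∈ J, HasDerivAt ϖ (deriv ϖ k) k := fun k hk =>
    ((hϖ.differentiableOn (by simp)).differentiableAt (isOpen_Ioo.mem_nhds hk)).hasDerivAt
  have hϖ' : ContDiffOn ℝ ∞ (deriv ϖ) J := hϖ.deriv_of_isOpen isOpen_Ioo (by simp)
  have hd' : ∀ k ∈ J, HasDerivAt (deriv ϖ) (deriv (deriv ϖ) k) k := fun k hk =>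
    ((hϖ'.differentiableOn (by simp)).differentiableAt (isOpen_Ioo.mem_nhds hk)).hasDerivAt
  obtain ⟨L, hL⟩ := isCompact_Icc.exists_bound_of_continuousOn
    ((hϖ'.continuousOn_deriv_of_isOpen isOpen_Ioo (by simp)).mono hsub)
  have hmem : ∀ q : ModulationData a r₀ R × ℝ, q.1.wavenumber k₀ q.2 ∈ K :=
    fun q => q.1.wavenumber_mem k₀ q.2
  have hlip : ∀ k ∈ K, k₀ ∈ K → |deriv ϖ k - deriv ϖ k₀| ≤ L * |k - k₀| := fun k hk hk0 =>
    (convex_Icc _ _).norm_image_sub_le_of_norm_hasDerivWithin_le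
      (fun y hy => (hd' y (hsub hy)).hasDerivWithinAt) hL hk0 hk
  -- The inequality `0 ≤ r₀` is read off from a given datum, which is why this membership depends on
  -- `q`.
  have hk0 : ∀ q : ModulationData a r₀ R × ℝ, k₀ ∈ K := fun q => by
    have := (abs_nonneg _).trans (q.1.small 0)
    have : 0 ≤ |k₀| * r₀ := by positivity
    exact ⟨by linarith, by linarith⟩
  have hdiff : ∀ q : ModulationData a r₀ R × ℝ, q.1.wavenumber k₀ q.2 - k₀ = k₀ * q.1.g 1 q.2 :=
    fun q => by simp only [wavenumber]; ring
  refine ⟨?_, fun q => (deriv ϖ (q.1.wavenumber k₀ q.2) - deriv ϖ k₀) * (k₀ * q.1.g 2 q.2),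
    fun d x => ?_, ?_⟩
  · refine Asymptotics.IsBigO.trans (Asymptotics.isBigO_top.2 ⟨L * |k₀| ^ 2, fun q => ?_⟩)
      g_one_sq_isBigO_source
    set k := q.1.wavenumber k₀ q.2 with hk
    have hseg : Set.uIcc k₀ k ⊆ K := Set.uIcc_subset_Icc (hk0 q) (hmem q)
    -- On the segment from `k₀` to `k` the derivative of `ϖ y - ϖ'(k₀) y` is at most `L |k - k₀|`; a
    -- second use of the mean value inequality gives the quadratic bound.
    have e := (convex_uIcc k₀ k).norm_image_sub_le_of_norm_hasDerivWithin_le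
      (f := fun y => ϖ y - deriv ϖ k₀ * y) (f' := fun y => deriv ϖ y - deriv ϖ k₀)
      (C := L * |k - k₀|) (fun y hy => ((hd y (hsub (hseg hy))).sub
        ((hasDerivAt_id' y).const_mul _) |>.congr_deriv (by ring)).hasDerivWithinAt)
      (fun y hy => (hlip y (hseg hy) (hk0 q)).trans
        (mul_le_mul_of_nonneg_left ?_ ((norm_nonneg _).trans (hL k₀ (hk0 q)))))
      Set.left_mem_uIcc Set.right_mem_uIcc
    · have e1 : k - k₀ = k₀ * q.1.g 1 q.2 := hdiff q
      calc ‖ϖ k - ϖ k₀ - deriv ϖ k₀ * (k₀ * q.1.g 1 q.2)‖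
          = ‖(ϖ k - deriv ϖ k₀ * k) - (ϖ k₀ - deriv ϖ k₀ * k₀)‖ := by
            rw [← e1]; congr 1; ring
        _ ≤ L * |k - k₀| * ‖k - k₀‖ := e
        _ = L * |k₀| ^ 2 * ‖q.1.g 1 q.2 * q.1.g 1 q.2‖ := by
            rw [e1, norm_mul, norm_mul, abs_mul]
            simp only [Real.norm_eq_abs]
            ring
    · exact Set.abs_sub_left_of_mem_uIcc hy
  · have h1 := (hd _ (hsub (hmem (d, x)))).comp x (d.hasDerivAt_wavenumber k₀ x)
    have h2 := (h1.sub_const (ϖ k₀)).sub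
      (((d.hasDerivAt_g 1 (by lia) x).const_mul k₀).const_mul (deriv ϖ k₀))
    refine h2.congr_deriv ?_
    simp only
    ring
  · have h1 : (fun q : ModulationData a r₀ R × ℝ =>
        deriv ϖ (q.1.wavenumber k₀ q.2) - deriv ϖ k₀) =O[⊤] fun _ => (1 : ℝ) := by
      refine Asymptotics.IsBigO.trans (Asymptotics.isBigO_top.2 ⟨L * |k₀|, fun q => ?_⟩)
        (g_isBigO_one (j := 1) (by lia))
      have := hlip _ (hmem q) (hk0 q)
      rw [hdiff, abs_mul, ← mul_assoc] at this
      exact this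
    simpa using h1.mul
      ((g_isBigO_source (a := a) (r₀ := r₀) (R := R) le_rfl (by lia)).const_mul_left k₀)

end ModulationData

end Families

/-! ## The residual of the modulated wave train -/

section Residual

variable {n : ℕ}

/-- The profile equation is the partial differential equation at time `0` and position `y / k`; this
is where a nonzero wavenumber is needed. -/
lemma IsWaveTrain.profile_eq {D : Matrix (Fin n) (Fin n) ℝ} {f : State n → State n} {k freq : ℝ}
    {ψ : ℝ → State n} (h : IsWaveTrain D f k freq ψ) (hk : k ≠ 0) (y : ℝ) :
    (k ^ 2) • act D (deriv (deriv ψ) y) + freq • deriv ψ y + f (ψ y) = 0 := by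
  have hd : ∀ z, HasDerivAt ψ (deriv ψ z) z := fun z =>
    (h.smooth.differentiable (by simp) z).hasDerivAt
  have hd2 : ∀ z, HasDerivAt (deriv ψ) (deriv (deriv ψ) z) z := fun z =>
    ((h.smooth.deriv' (n := ∞)).differentiable (by simp) z).hasDerivAt
  have e := h.solves (y / k) 0
  have e0 : k * (y / k) - freq * 0 = y := by field_simp; ring
  have e1 : deriv (fun s => ψ (k * (y / k) - freq * s)) 0 = -(freq • deriv ψ y) := by
    have h1 : HasDerivAt (fun s : ℝ => k * (y / k) - freq * s) (-freq) 0 := by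
      simpa using ((hasDerivAt_id' (0 : ℝ)).const_mul freq).const_sub (k * (y / k))
    have h2 := (hd (k * (y / k) - freq * 0)).scomp (0 : ℝ) h1
    rw [e0] at h2
    simpa [Function.comp_def] using h2.deriv
  have h3 : ∀ z : ℝ, HasDerivAt (fun z : ℝ => k * z - freq * 0) k z := fun z => by
    simpa using (hasDerivAt_id' z).const_mul k
  have e2 : iteratedDeriv 2 (fun z => ψ (k * z - freq * 0)) (y / k)
      = (k ^ 2) • deriv (deriv ψ) y := by
    have h4 : deriv (fun z => ψ (k * z - freq * 0)) = fun z => k • deriv ψ (k * z - freq * 0) :=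
      funext fun z => ((hd _).scomp z (h3 z)).deriv
    have h5 := ((hd2 (k * (y / k) - freq * 0)).scomp (y / k) (h3 (y / k))).const_smul k
    rw [iteratedDeriv_succ, iteratedDeriv_one, h4, pow_two, mul_smul]
    rw [e0] at h5
    exact h5.deriv
  rw [e1, e2, e0] at e
  have e3 : act D ((k ^ 2) • deriv (deriv ψ) y) = (k ^ 2) • act D (deriv (deriv ψ) y) :=
    map_smul (Matrix.toEuclideanCLM (𝕜 := ℝ) D) _ _
  rw [e3] at e
  rw [add_right_comm, ← e, neg_add_cancel]

/-! ### Chain rule for the modulated wave train and expansion of its residual -/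

namespace ModulationData

variable {a r₀ R : ℝ} {V : Type*} [NormedAddCommGroup V] [NormedSpace ℝ V]

/-- The modulated wave train. -/
def modulated (k₀ : ℝ) (φ : ℝ → ℝ → V) (d : ModulationData a r₀ R) (x : ℝ) : V :=
  φ (d.phase x) (d.wavenumber k₀ x)

/-- The spatial derivative of the modulated wave train. -/
noncomputable def modulatedFst (k₀ : ℝ) (φ : ℝ → ℝ → V) (d : ModulationData a r₀ R) (x : ℝ) : V :=
  (1 + d.g 1 x + defect (d, x)) • d.modulated k₀ (phaseDeriv φ) x
    + (k₀ * d.g 2 x) • d.modulated k₀ (wavenumberDeriv φ) x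

/-- The second derivative of the modulated phase. -/
def phaseSnd (d : ModulationData a r₀ R) (x : ℝ) : ℝ :=
  d.g 2 x + 3 * (d.g 2 x * d.g 1 x) + d.g 3 x * d.g 0 x

/-- The second spatial derivative of the modulated wave train. -/
noncomputable def modulatedSnd (k₀ : ℝ) (φ : ℝ → ℝ → V) (d : ModulationData a r₀ R) (x : ℝ) : V :=
  (d.phaseSnd x • d.modulated k₀ (phaseDeriv φ) x
      + (1 + d.g 1 x + defect (d, x)) • d.modulatedFst k₀ (phaseDeriv φ) x)
    + ((k₀ * d.g 3 x) • d.modulated k₀ (wavenumberDeriv φ) x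
      + (k₀ * d.g 2 x) • d.modulatedFst k₀ (wavenumberDeriv φ) x)

/-- The temporal derivative of the modulated wave train. -/
noncomputable def modulatedTime (k₀ : ℝ) (φ : ℝ → ℝ → V) (d : ModulationData a r₀ R) (x : ℝ) : V :=
  (d.p 0 x * (1 + d.g 1 x) + d.g 0 x * d.p 1 x) • d.modulated k₀ (phaseDeriv φ) x
    + (k₀ * d.p 1 x) • d.modulated k₀ (wavenumberDeriv φ) x

lemma wavenumber_mem_Ioo {k₀ r : ℝ} (hr : |k₀| * r₀ < r) (d : ModulationData a r₀ R) (x : ℝ) :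
    d.wavenumber k₀ x ∈ Set.Ioo (k₀ - r) (k₀ + r) := by
  have := d.wavenumber_mem k₀ x
  exact ⟨by linarith [this.1], by linarith [this.2]⟩

lemma hasDerivAt_modulated {k₀ r : ℝ} (hr : |k₀| * r₀ < r) {φ : ℝ → ℝ → V}
    (hφ : IsProfile (Set.Ioo (k₀ - r) (k₀ + r)) φ) (d : ModulationData a r₀ R) (x : ℝ) :
    HasDerivAt (d.modulated k₀ φ) (d.modulatedFst k₀ φ x) x :=
  hφ.comp_hasDerivAt isOpen_Ioo (d.hasDerivAt_phase x) (d.hasDerivAt_wavenumber k₀ x)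
    (d.wavenumber_mem_Ioo hr x)

lemma hasDerivAt_defect (d : ModulationData a r₀ R) (x : ℝ) :
    HasDerivAt (fun x => 1 + d.g 1 x + defect (d, x)) (d.phaseSnd x) x := by
  have h1 := d.hasDerivAt_g 1 (by lia) x
  have h := (h1.const_add 1).add ((h1.mul h1).add
    ((d.hasDerivAt_g 2 (by lia) x).mul (d.hasDerivAt_g 0 (by lia) x)))
  refine h.congr_deriv ?_
  simp only [phaseSnd]
  ring

lemma hasDerivAt_modulatedFst {k₀ r : ℝ} (hr : |k₀| * r₀ < r) {φ : ℝ → ℝ → V}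
    (hφ : IsProfile (Set.Ioo (k₀ - r) (k₀ + r)) φ) (d : ModulationData a r₀ R) (x : ℝ) :
    HasDerivAt (d.modulatedFst k₀ φ) (d.modulatedSnd k₀ φ x) x := by
  have h1 := (d.hasDerivAt_defect x).smul
    (d.hasDerivAt_modulated hr (hφ.phaseDeriv isOpen_Ioo) x)
  have h2 := ((d.hasDerivAt_g 2 (by lia) x).const_mul k₀).smul
    (d.hasDerivAt_modulated hr (hφ.wavenumberDeriv isOpen_Ioo) x)
  refine (h1.add h2).congr_deriv ?_
  simp only [modulatedSnd]
  rw [add_comm (d.phaseSnd x • _), add_comm ((k₀ * d.g 3 x) • _)]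

/-- The residual of the modulated wave train in the reaction-diffusion system. -/
noncomputable def residual (D : Matrix (Fin n) (Fin n) ℝ) (f : State n → State n) (k₀ ω₀ : ℝ)
    (φ : ℝ → ℝ → State n) (d : ModulationData a r₀ R) (x : ℝ) : State n :=
  (k₀ ^ 2) • act D (d.modulatedSnd k₀ φ x) + ω₀ • d.modulatedFst k₀ φ x
    + f (d.modulated k₀ φ x) - d.modulatedTime k₀ φ x

/-- The residual as a sum of small coefficients times bounded functions. -/
lemma residual_eq {D : Matrix (Fin n) (Fin n) ℝ} {f : State n → State n} {k₀ ω₀ r : ℝ}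
    {φ : ℝ → ℝ → State n} {freq : ℝ → ℝ} (hk₀ : k₀ ≠ 0) (hr₀ : r₀ < 1) (hr : |k₀| * r₀ < r)
    (hω₀ : freq k₀ = ω₀)
    (hwt : ∀ k ∈ Set.Ioo (k₀ - r) (k₀ + r), IsWaveTrain D f k (freq k) (fun y => φ y k))
    (ha : a = ω₀ - k₀ * deriv freq k₀) (d : ModulationData a r₀ R) (x : ℝ) :
    d.residual D f k₀ ω₀ φ x =
      (k₀ ^ 2 * (2 * (defect (d, x) * (1 + d.g 1 x)) + defect (d, x) * defect (d, x)))
          • act D (d.modulated k₀ (phaseDeriv (phaseDeriv φ)) x)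
        + (-1 * (d.p 0 x - a * d.g 1 x) + -1 * (d.g 1 x * d.p 0 x) + ω₀ * defect (d, x)
          + (-1 * (d.p 1 x * d.g 0 x) + -1 * (freq (d.wavenumber k₀ x) - freq k₀
            - deriv freq k₀ * (k₀ * d.g 1 x)))) • d.modulated k₀ (phaseDeriv φ) x
        + (k₀ ^ 2 * (d.g 2 x + 3 * (d.g 2 x * d.g 1 x) + d.g 3 x * d.g 0 x))
          • act D (d.modulated k₀ (phaseDeriv φ) x)
        + (k₀ ^ 3 * (d.g 2 x * (1 + d.g 1 x) + d.g 2 x * defect (d, x)))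
          • act D (d.modulated k₀ (wavenumberDeriv (phaseDeriv φ)) x
            + d.modulated k₀ (phaseDeriv (wavenumberDeriv φ)) x)
        + ((k₀ ^ 4 * (d.g 2 x * d.g 2 x))
            • act D (d.modulated k₀ (wavenumberDeriv (wavenumberDeriv φ)) x)
          + (k₀ ^ 3 * d.g 3 x) • act D (d.modulated k₀ (wavenumberDeriv φ) x))
        + (ω₀ * k₀ * d.g 2 x + -k₀ * d.p 1 x) • d.modulated k₀ (wavenumberDeriv φ) x := by
  have hκ := d.wavenumber_mem_Ioo (k₀ := k₀) hr x
  -- Since `r₀ < 1`, the local wavenumber does not vanish, so the profile equation at this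
  -- wavenumber is available to eliminate `f`.
  have hκ0 : d.wavenumber k₀ x ≠ 0 := by
    have := (abs_lt.1 ((d.small x).trans_lt hr₀)).1
    exact mul_ne_zero hk₀ (by linarith)
  have hf := eq_neg_of_add_eq_zero_right ((hwt _ hκ).profile_eq hκ0 (d.phase x))
  have hf' : f (d.modulated k₀ φ x)
      = -((d.wavenumber k₀ x ^ 2) • act D (d.modulated k₀ (phaseDeriv (phaseDeriv φ)) x)
        + freq (d.wavenumber k₀ x) • d.modulated k₀ (phaseDeriv φ) x) := hf
  have hadd : ∀ v w, act D (v + w) = act D v + act D w :=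
    map_add (Matrix.toEuclideanCLM (𝕜 := ℝ) D)
  have hsmul : ∀ (c : ℝ) v, act D (c • v) = c • act D v :=
    map_smul (Matrix.toEuclideanCLM (𝕜 := ℝ) D)
  rw [residual, hf']
  simp only [modulatedSnd, modulatedFst, modulatedTime, hadd, hsmul]
  generalize act D (d.modulated k₀ (phaseDeriv (phaseDeriv φ)) x) = vyy
  generalize act D (d.modulated k₀ (wavenumberDeriv (phaseDeriv φ)) x) = vyk
  generalize act D (d.modulated k₀ (phaseDeriv (wavenumberDeriv φ)) x) = vky
  generalize act D (d.modulated k₀ (wavenumberDeriv (wavenumberDeriv φ)) x) = vkk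
  generalize act D (d.modulated k₀ (phaseDeriv φ) x) = Avy
  generalize act D (d.modulated k₀ (wavenumberDeriv φ) x) = Avk
  generalize d.modulated k₀ (phaseDeriv φ) x = vy
  generalize d.modulated k₀ (wavenumberDeriv φ) x = vk
  generalize freq (d.wavenumber k₀ x) = ϖ
  -- Substituting `ω₀ = a + k₀ freq'(k₀)` lets the linear terms in `γ_ζ` and `γ_t` combine into
  -- `-(γ_t - a γ_ζ)`. What remains is an identity polynomial in the coefficients.
  rw [hω₀, eq_add_of_sub_eq ha.symm]
  simp only [phaseSnd, wavenumber]
  generalize defect (d, x) = δ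
  module

/-- Each coefficient in `residual_eq` is a sum of terms with a small factor, multiplied by a profile
evaluated along the modulation, which is bounded together with its derivative. -/
lemma residual_small {D : Matrix (Fin n) (Fin n) ℝ} {f : State n → State n} {k₀ ω₀ r : ℝ}
    {φ : ℝ → ℝ → State n} {freq : ℝ → ℝ} (hk₀ : k₀ ≠ 0) (hr₀ : r₀ < 1) (hr : |k₀| * r₀ < r)
    (hφ : IsProfile (Set.Ioo (k₀ - r) (k₀ + r)) φ)
    (hfreq : ContDiffOn ℝ ∞ freq (Set.Ioo (k₀ - r) (k₀ + r))) (hω₀ : freq k₀ = ω₀)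
    (hwt : ∀ k ∈ Set.Ioo (k₀ - r) (k₀ + r), IsWaveTrain D f k (freq k) (fun y => φ y k))
    (ha : a = ω₀ - k₀ * deriv freq k₀) :
    IsSmallFamily fun q : ModulationData a r₀ R × ℝ => q.1.residual D f k₀ ω₀ φ q.2 := by
  have hy := hφ.phaseDeriv isOpen_Ioo
  have hk := hφ.wavenumberDeriv isOpen_Ioo
  have hyk := hy.wavenumberDeriv isOpen_Ioo
  have hky := hk.phaseDeriv isOpen_Ioo
  have hb : ∀ {F : ℝ → ℝ → State n}, IsProfile (Set.Ioo (k₀ - r) (k₀ + r)) F →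
      IsBoundedFamily fun q : ModulationData a r₀ R × ℝ => q.1.modulated k₀ F q.2 :=
    fun h => comp_bounded hr h
  have hbA : ∀ {F : ℝ → ℝ → State n}, IsProfile (Set.Ioo (k₀ - r) (k₀ + r)) F →
      IsBoundedFamily fun q : ModulationData a r₀ R × ℝ => act D (q.1.modulated k₀ F q.2) :=
    fun h => comp_bounded hr (h.clm_comp (Matrix.toEuclideanCLM (𝕜 := ℝ) D))
  have g2 : IsSmallFamily fun q : ModulationData a r₀ R × ℝ => q.1.g 2 q.2 :=
    g_small le_rfl (by lia)
  have g3 : IsSmallFamily fun q : ModulationData a r₀ R × ℝ => q.1.g 3 q.2 :=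
    g_small (by lia) le_rfl
  have b2 := g_isBigO_one (a := a) (r₀ := r₀) (R := R) (j := 2) le_rfl
  have w := defect_small (a := a) (r₀ := r₀) (R := R)
  have bw := defect_isBigO_one (a := a) (r₀ := r₀) (R := R)
  have b0 := g_bounded (a := a) (r₀ := r₀) (R := R) (j := 0) (by lia)
  have b1 := g_bounded (a := a) (r₀ := r₀) (R := R) (j := 1) le_rfl
  have ob := one_add_g_bounded (a := a) (r₀ := r₀) (R := R)
  -- The families `c1` to `c7` are the coefficients in `residual_eq`, in the same order.
  have c1 := (((w.mul_bounded ob).const_mul 2).add (w.mul w bw bw)).const_mul (k₀ ^ 2)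
  have c2 := ((((transport_small (a := a) (r₀ := r₀) (R := R)).const_mul (-1)).add
    (g_one_mul_p_small.const_mul (-1))).add (w.const_mul ω₀)).add
    (((p_one_small.mul_bounded b0).const_mul (-1)).add
      ((taylor_small hr hfreq).const_mul (-1)))
  have c3 := ((g2.add ((g2.mul_bounded b1).const_mul 3)).add (g3.mul_bounded b0)).const_mul
    (k₀ ^ 2)
  have c4 := ((g2.mul_bounded ob).add (g2.mul w b2 bw)).const_mul (k₀ ^ 3)
  have c5 := (g2.mul g2 b2 b2).const_mul (k₀ ^ 4)
  have c6 := g3.const_mul (k₀ ^ 3)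
  have c7 := (g2.const_mul (ω₀ * k₀)).add
    ((p_one_small (a := a) (r₀ := r₀) (R := R)).const_mul (-k₀))
  have key := (((((c1.smul (hbA (hy.phaseDeriv isOpen_Ioo))).add (c2.smul (hb hy))).add
    (c3.smul (hbA hy))).add (c4.smul (hbA (hyk.add hky)))).add
    ((c5.smul (hbA (hk.wavenumberDeriv isOpen_Ioo))).add (c6.smul (hbA hk)))).add
    (c7.smul (hb hk))
  -- The bracketing and the factors `-1` in `residual_eq` are those produced by the closure rules
  -- for small families, so the terms match exactly.
  rw [show (fun q : ModulationData a r₀ R × ℝ => q.1.residual D f k₀ ω₀ φ q.2) = _ from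
    funext fun q => residual_eq hk₀ hr₀ hr hω₀ hwt ha q.1 q.2]
  exact key

end ModulationData

end Residual

/-! ## The reaction term -/

section Reaction

variable {E : Type*} [NormedAddCommGroup E] [NormedSpace ℝ E] [FiniteDimensional ℝ E]

/-- The difference `f(u) - f(w)` and its spatial derivative are controlled by `u - w` and its
spatial derivative, for bounded `u` and `w` and bounded derivative of `w`. -/
lemma exists_reaction_bound {f : E → E} (hf : ContDiff ℝ ∞ f) (ρ L : ℝ) :
    ∃ C, 0 ≤ C ∧ ∀ (u w : ℝ → E) (u' w' : E) (x : ℝ), HasDerivAt u u' x → HasDerivAt w w' x →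
      ‖u x‖ ≤ ρ → ‖w x‖ ≤ ρ → ‖w'‖ ≤ L →
      ‖f (u x) - f (w x)‖ ≤ C * ‖u x - w x‖ ∧
      ∃ F', HasDerivAt (fun x => f (u x) - f (w x)) F' x ∧
        ‖F'‖ ≤ C * (‖u x - w x‖ + ‖u' - w'‖) := by
  have hd : ∀ y, HasFDerivAt f (fderiv ℝ f y) y := fun y =>
    (hf.differentiable (by simp) y).hasFDerivAt
  have hf' : ContDiff ℝ ∞ (fderiv ℝ f) := hf.fderiv_right (by simp)
  have hd' : ∀ y, HasFDerivAt (fderiv ℝ f) (fderiv ℝ (fderiv ℝ f) y) y := fun y =>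
    (hf'.differentiable (by simp) y).hasFDerivAt
  have : ProperSpace E := FiniteDimensional.proper_real E
  have hK := isCompact_closedBall (0 : E) ρ
  obtain ⟨C₁, hC₁⟩ := hK.exists_bound_of_continuousOn hf'.continuous.continuousOn
  obtain ⟨C₂, hC₂⟩ := hK.exists_bound_of_continuousOn
    (hf'.continuous_fderiv (by simp)).continuousOn
  refine ⟨max 0 C₁ + max 0 C₂ * max 0 L, by positivity, fun u w u' w' x hu hw hub hwb hL => ?_⟩
  have mu : u x ∈ Metric.closedBall (0 : E) ρ := by simpa using hub
  have mw : w x ∈ Metric.closedBall (0 : E) ρ := by simpa using hwb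
  have hp : 0 ≤ max 0 C₂ * max 0 L := by positivity
  have e1 := (convex_closedBall (0 : E) ρ).norm_image_sub_le_of_norm_hasFDerivWithin_le
    (fun y _ => (hd y).hasFDerivWithinAt) hC₁ mw mu
  have e2 := (convex_closedBall (0 : E) ρ).norm_image_sub_le_of_norm_hasFDerivWithin_le
    (fun y _ => (hd' y).hasFDerivWithinAt) hC₂ mw mu
  refine ⟨e1.trans (mul_le_mul_of_nonneg_right ?_ (norm_nonneg _)),
    fderiv ℝ f (u x) u' - fderiv ℝ f (w x) w',
    ((hd _).comp_hasDerivAt x hu).sub ((hd _).comp_hasDerivAt x hw), ?_⟩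
  · linarith [le_max_right 0 C₁]
  -- In this splitting `u'` enters only through `u' - w'`, so the constant depends on bounds for
  -- `u`, `w` and `w'` alone.
  · have e3 : fderiv ℝ f (u x) u' - fderiv ℝ f (w x) w'
        = fderiv ℝ f (u x) (u' - w') + (fderiv ℝ f (u x) - fderiv ℝ f (w x)) w' := by
      simp
    rw [e3]
    have h1 : ‖fderiv ℝ f (u x) (u' - w')‖ ≤ max 0 C₁ * ‖u' - w'‖ :=
      (ContinuousLinearMap.le_opNorm _ _).trans (mul_le_mul_of_nonneg_right
        ((hC₁ _ mu).trans (le_max_right _ _)) (norm_nonneg _))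
    have h2 : ‖(fderiv ℝ f (u x) - fderiv ℝ f (w x)) w'‖
        ≤ max 0 C₂ * ‖u x - w x‖ * max 0 L := by
      refine (ContinuousLinearMap.le_opNorm _ _).trans (mul_le_mul (e2.trans ?_)
        (hL.trans (le_max_right _ _)) (norm_nonneg _) (by positivity))
      exact mul_le_mul_of_nonneg_right (le_max_right _ _) (norm_nonneg _)
    have h3 : 0 ≤ max 0 C₁ * ‖u x - w x‖ := by positivity
    have h4 : 0 ≤ max 0 C₂ * max 0 L * ‖u' - w'‖ := by positivity
    refine (norm_add_le _ _).trans ((add_le_add h1 h2).trans ?_)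
    nlinarith

end Reaction

/-! ## Damping of the gradient in reaction-diffusion systems -/

section Damping

/-- Cauchy-Schwarz with respect to the sub-probability density `e^{-(b-s)}` on `[a,b]`. -/
lemma integral_exp_mul_sq_le {N : ℝ → ℝ} {a b : ℝ} (hab : a ≤ b)
    (h1 : IntegrableOn N (Set.Icc a b)) (h2 : IntegrableOn (fun s => N s ^ 2) (Set.Icc a b)) :
    (∫ s in a..b, Real.exp (-(b - s)) * N s) ^ 2 ≤ ∫ s in a..b, Real.exp (-(b - s)) * N s ^ 2 := by
  have hc : Continuous fun s : ℝ => Real.exp (-(b - s)) := by fun_prop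
  have i1 : IntervalIntegrable (fun s => Real.exp (-(b - s)) * N s) volume a b :=
    ((intervalIntegrable_iff_integrableOn_Icc_of_le hab).2 h1).continuousOn_mul hc.continuousOn
  have i2 : IntervalIntegrable (fun s => Real.exp (-(b - s)) * N s ^ 2) volume a b :=
    ((intervalIntegrable_iff_integrableOn_Icc_of_le hab).2 h2).continuousOn_mul hc.continuousOn
  have i0 : IntervalIntegrable (fun s => Real.exp (-(b - s))) volume a b := hc.intervalIntegrable _ _
  have hw : ∫ s in a..b, Real.exp (-(b - s)) = 1 - Real.exp (-(b - a)) := by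
    have hd : ∀ s ∈ Set.uIcc a b,
        HasDerivAt (fun s => Real.exp (-(b - s))) (Real.exp (-(b - s))) s := fun s _ => by
      have h1 : HasDerivAt (fun s : ℝ => -(b - s)) 1 s :=
        ((hasDerivAt_id' s).const_sub b).fun_neg.congr_deriv (neg_neg _)
      simpa using h1.exp
    rw [intervalIntegral.integral_eq_sub_of_hasDerivAt hd i0]
    simp
  set I := ∫ s in a..b, Real.exp (-(b - s)) * N s with hI
  -- With `I` the weighted integral of `N` and `μ` the total mass of the weight, expanding this
  -- nonnegative integral gives `(2 - μ) I² ≤ ∫ e^{-(b-s)} N²`. The claim follows since `μ = 1 -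
  -- e^{-(b-a)} ≤ 1`.
  have hpos : 0 ≤ ∫ s in a..b, Real.exp (-(b - s)) * (N s - I) ^ 2 :=
    intervalIntegral.integral_nonneg hab fun s _ => by positivity
  have e : ∫ s in a..b, Real.exp (-(b - s)) * (N s - I) ^ 2
      = (∫ s in a..b, Real.exp (-(b - s)) * N s ^ 2) - 2 * I * I
        + I ^ 2 * ∫ s in a..b, Real.exp (-(b - s)) := by
    have e0 : ∀ s, Real.exp (-(b - s)) * (N s - I) ^ 2 = Real.exp (-(b - s)) * N s ^ 2
        - 2 * I * (Real.exp (-(b - s)) * N s) + I ^ 2 * Real.exp (-(b - s)) := fun s => by ring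
    simp only [e0]
    rw [intervalIntegral.integral_add (i2.sub (i1.const_mul _)) (i0.const_mul _),
      intervalIntegral.integral_sub i2 (i1.const_mul _), intervalIntegral.integral_const_mul,
      intervalIntegral.integral_const_mul]
  rw [e, hw] at hpos
  nlinarith [Real.exp_pos (-(b - a)), sq_nonneg I]

variable {n : ℕ}

/-- Symmetry of `D` makes its action diagonal on eigenvector components, which decouples the
second-order part of the system into scalar equations with diffusivities proportional to the
eigenvalues. -/
lemma inner_eigenvectorBasis_act {D : Matrix (Fin n) (Fin n) ℝ} (hD : D.PosDef) (i : Fin n)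
    (v : State n) : inner ℝ (hD.isHermitian.eigenvectorBasis i) (act D v)
      = hD.isHermitian.eigenvalues i * inner ℝ (hD.isHermitian.eigenvectorBasis i) v := by
  set A := Matrix.toEuclideanCLM (𝕜 := ℝ) D with hA
  have h1 : star A = A := by
    rw [hA, ← map_star]
    exact congrArg _ hD.isHermitian
  have h2 : A (hD.isHermitian.eigenvectorBasis i)
      = hD.isHermitian.eigenvalues i • hD.isHermitian.eigenvectorBasis i := by
    apply (WithLp.ofLp_injective 2)
    rw [hA, Matrix.ofLp_toEuclideanCLM]
    exact hD.isHermitian.mulVec_eigenvectorBasis i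
  change inner ℝ _ (A v) = _
  rw [← ContinuousLinearMap.adjoint_inner_left, ← ContinuousLinearMap.star_eq_adjoint, h1, h2,
    inner_smul_left]
  rfl

lemma norm_le_sum_inner {ι : Type*} [Fintype ι] {E : Type*} [NormedAddCommGroup E]
    [InnerProductSpace ℝ E] (b : OrthonormalBasis ι ℝ E) (v : E) :
    ‖v‖ ≤ ∑ i, |inner ℝ (b i) v| := by
  conv_lhs => rw [← b.sum_repr' v]
  refine (norm_sum_le _ _).trans (Finset.sum_le_sum fun i _ => ?_)
  rw [norm_smul, b.norm_eq_one, mul_one, Real.norm_eq_abs]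

/-- A solution `z` of a forced linear system `∂ₜz = k₀² D z_xx + ω₀ z_x + G` on the time interval
`[t₀,t₁]`, whose forcing is controlled by `N` and the sup norm `Y` of the gradient of `z`. -/
structure IsForcedSolution (D : Matrix (Fin n) (Fin n) ℝ) (k₀ ω₀ t₀ t₁ M C₀ : ℝ)
    (z zs zx zxx G : ℝ → ℝ → State n) (N Y : ℝ → ℝ) : Prop where
  fderiv : ∀ s ∈ Set.Icc t₀ t₁, ∀ x, HasFDerivAt (fun p : ℝ × ℝ => z p.1 p.2)
    ((ContinuousLinearMap.fst ℝ ℝ ℝ).smulRight (zs s x)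
      + (ContinuousLinearMap.snd ℝ ℝ ℝ).smulRight (zx s x)) (s, x)
  deriv_snd : ∀ s ∈ Set.Icc t₀ t₁, ∀ x, HasDerivAt (zx s) (zxx s x) x
  bound : ∀ s ∈ Set.Icc t₀ t₁, ∀ x, ‖z s x‖ ≤ M ∧ ‖zs s x‖ ≤ M ∧ ‖zx s x‖ ≤ M ∧ ‖zxx s x‖ ≤ M
  eq : ∀ s ∈ Set.Icc t₀ t₁, ∀ x,
    zs s x = (k₀ ^ 2) • act D (zxx s x) + ω₀ • zx s x + G s x
  forcing : ∀ s ∈ Set.Icc t₀ t₁, ∀ x, ‖z s x‖ ≤ N s ∧ ‖G s x‖ ≤ C₀ * N s ∧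
    ∃ G', HasDerivAt (G s) G' x ∧ ‖G'‖ ≤ C₀ * (N s + Y s)
  gradient_le : ∀ s ∈ Set.Icc t₀ t₁, ∀ x, ‖zx s x‖ ≤ Y s
  le_gradient : ∀ s ∈ Set.Icc t₀ t₁, ∀ B, (∀ x, ‖zx s x‖ ≤ B) → Y s ≤ B
  measurable : AEStronglyMeasurable N (volume.restrict (Set.Icc t₀ t₁))
  source_le : ∀ s ∈ Set.Icc t₀ t₁, N s ≤ M

/-! ### Componentwise gradient estimates for the forced system -/

namespace IsForcedSolution

variable {D : Matrix (Fin n) (Fin n) ℝ} {k₀ ω₀ t₀ t₁ M C₀ : ℝ}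
  {z zs zx zxx G : ℝ → ℝ → State n} {N Y : ℝ → ℝ}

lemma source_nonneg (h : IsForcedSolution D k₀ ω₀ t₀ t₁ M C₀ z zs zx zxx G N Y) {s : ℝ}
    (hs : s ∈ Set.Icc t₀ t₁) : 0 ≤ N s :=
  (norm_nonneg _).trans (h.forcing s hs 0).1

lemma integrableOn (h : IsForcedSolution D k₀ ω₀ t₀ t₁ M C₀ z zs zx zxx G N Y) :
    IntegrableOn N (Set.Icc t₀ t₁) :=
  IntegrableOn.of_bound (by simp) h.measurable M
    ((ae_restrict_iff' measurableSet_Icc).2 (ae_of_all _ fun s hs => by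
      rw [Real.norm_of_nonneg (h.source_nonneg hs)]
      exact h.source_le s hs))

lemma integrableOn_sq (h : IsForcedSolution D k₀ ω₀ t₀ t₁ M C₀ z zs zx zxx G N Y) :
    IntegrableOn (fun s => N s ^ 2) (Set.Icc t₀ t₁) :=
  IntegrableOn.of_bound (by simp) (h.measurable.pow 2) (M ^ 2)
    ((ae_restrict_iff' measurableSet_Icc).2 (ae_of_all _ fun s hs => by
      rw [Real.norm_of_nonneg (by positivity)]
      have := h.source_nonneg hs
      have := h.source_le s hs
      gcongr))

/-- The absorption argument applies the component estimate at every intermediate time, hence on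
every shorter interval with the same left endpoint. -/
lemma mono (h : IsForcedSolution D k₀ ω₀ t₀ t₁ M C₀ z zs zx zxx G N Y) {t : ℝ} (ht : t ≤ t₁) :
    IsForcedSolution D k₀ ω₀ t₀ t M C₀ z zs zx zxx G N Y :=
  have hsub : Set.Icc t₀ t ⊆ Set.Icc t₀ t₁ := Set.Icc_subset_Icc_right ht
  { fderiv := fun s hs => h.fderiv s (hsub hs)
    deriv_snd := fun s hs => h.deriv_snd s (hsub hs)
    bound := fun s hs => h.bound s (hsub hs)
    eq := fun s hs => h.eq s (hsub hs)
    forcing := fun s hs => h.forcing s (hsub hs)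
    gradient_le := fun s hs => h.gradient_le s (hsub hs)
    le_gradient := fun s hs => h.le_gradient s (hsub hs)
    measurable := h.measurable.mono_measure (Measure.restrict_mono hsub le_rfl)
    source_le := fun s hs => h.source_le s (hsub hs) }

/-- The damping term `-q` is introduced artificially: it is compensated by adding `z` to the source,
which is harmless because `N` also bounds `z`. -/
lemma component (h : IsForcedSolution D k₀ ω₀ t₀ t₁ M C₀ z zs zx zxx G N Y) (hD : D.PosDef)
    (i : Fin n) :
    IsDampedHeatSolution (k₀ ^ 2 * hD.isHermitian.eigenvalues i) ω₀ t₀ t₁ M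
      (fun s x => inner ℝ (hD.isHermitian.eigenvectorBasis i) (z s x))
      (fun s x => inner ℝ (hD.isHermitian.eigenvectorBasis i) (zs s x))
      (fun s x => inner ℝ (hD.isHermitian.eigenvectorBasis i) (zx s x))
      (fun s x => inner ℝ (hD.isHermitian.eigenvectorBasis i) (zxx s x))
      (fun s x => inner ℝ (hD.isHermitian.eigenvectorBasis i) (z s x + G s x)) := by
  set e := hD.isHermitian.eigenvectorBasis i with he
  have hb : ∀ v : State n, |inner ℝ e v| ≤ ‖v‖ := fun v => by
    simpa [he] using abs_real_inner_le_norm e v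
  refine ⟨fun s hs x => ?_, fun s hs x => ?_, fun s hs => ?_, fun s hs x => ?_, fun s hs x => ?_⟩
  · refine ((innerSL ℝ e).hasFDerivAt.comp (s, x) (h.fderiv s hs x)).congr_fderiv ?_
    ext <;> simp
  · exact (innerSL ℝ e).hasFDerivAt.comp_hasDerivAt x (h.deriv_snd s hs x)
  · have hz : Continuous (z s) := continuous_iff_continuousAt.2 fun x => by
      have := (h.fderiv s hs x).continuousAt
      exact ContinuousAt.comp (g := fun p : ℝ × ℝ => z p.1 p.2) (f := fun x => (s, x)) this
        (by fun_prop)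
    have hG : Continuous (G s) := continuous_iff_continuousAt.2 fun x => by
      obtain ⟨G', hG', -⟩ := (h.forcing s hs x).2.2
      exact hG'.continuousAt
    fun_prop
  · obtain ⟨h1, h2, h3, h4⟩ := h.bound s hs x
    exact ⟨(hb _).trans h1, (hb _).trans h2, (hb _).trans h3, (hb _).trans h4⟩
  · rw [h.eq s hs x, inner_add_right, inner_add_right, inner_smul_right, inner_smul_right,
      inner_eigenvectorBasis_act hD, inner_add_right]
    ring

/-- Estimate of a component of the gradient, with a small multiple of the gradient on the recent
past. -/
lemma abs_component_le (h : IsForcedSolution D k₀ ω₀ t₀ t₁ M C₀ z zs zx zxx G N Y)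
    (hD : D.PosDef) (hk₀ : k₀ ≠ 0) (hC₀ : 0 ≤ C₀) (ht : t₀ ≤ t₁) {m δ : ℝ} (hδ : 0 < δ)
    (hm : ∀ s ∈ Set.Icc t₀ t₁, Real.exp (s / 2) * Y s ≤ m) (i : Fin n) (x : ℝ) :
    |inner ℝ (hD.isHermitian.eigenvectorBasis i) (zx t₁ x)|
      ≤ Real.exp (-(t₁ - t₀)) * Y t₀
        + (1 + C₀) * (1 + (∫ x, |x| ∂stdGaussian)
            / √(2 * (k₀ ^ 2 * hD.isHermitian.eigenvalues i) * δ))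
          * √(∫ s in t₀..t₁, Real.exp (-(t₁ - s)) * N s ^ 2)
        + (1 + C₀) * δ * (m * Real.exp (-(t₁ / 2))) := by
  set e := hD.isHermitian.eigenvectorBasis i with he
  set d := k₀ ^ 2 * hD.isHermitian.eigenvalues i with hd
  set κ := ∫ x, |x| ∂stdGaussian with hκ
  have hκ0 : 0 ≤ κ := integral_nonneg fun _ => abs_nonneg _
  have hdpos : 0 < d := mul_pos (by positivity) (hD.eigenvalues_pos i)
  have hb : ∀ v : State n, |inner ℝ e v| ≤ ‖v‖ := fun v => by
    simpa [he] using abs_real_inner_le_norm e v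
  have h0 : t₀ ∈ Set.Icc t₀ t₁ := ⟨le_rfl, ht⟩
  have hY : ∀ s ∈ Set.Icc t₀ t₁, 0 ≤ Y s := fun s hs =>
    (norm_nonneg _).trans (h.gradient_le s hs 0)
  have hm0 : 0 ≤ m := (mul_nonneg (Real.exp_pos _).le (hY t₀ h0)).trans (hm t₀ h0)
  set c := (1 + C₀) * (1 + κ / √(2 * d * δ)) with hc
  set b := (1 + C₀) * (m * Real.exp (-(t₁ / 2))) with hbdef
  have hb0 : 0 ≤ b := by positivity
  have hcont : Continuous fun s : ℝ => Real.exp (-(t₁ - s)) := by fun_prop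
  have hi1 : IntegrableOn (fun s => Real.exp (-(t₁ - s)) * N s) (Set.Icc t₀ t₁) :=
    h.integrableOn.continuousOn_mul hcont.continuousOn isCompact_Icc
  have hi2 : Integrable ((Set.Icc (t₁ - δ) t₁).indicator fun _ => b) :=
    (integrable_indicator_iff measurableSet_Icc).2 (by simp)
  have hsqpos : 0 < √(2 * d * δ) := Real.sqrt_pos.2 (by positivity)
  have hx : ∀ s ∈ Set.Icc t₀ t₁, ∀ x, HasDerivAt (z s) (zx s x) x := fun s hs x => by
    have h1 := HasFDerivAt.comp_hasDerivAt (f := fun x : ℝ => (s, x)) x (h.fderiv s hs x)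
      ((hasDerivAt_const x s).prodMk (hasDerivAt_id' x))
    simpa [Function.comp_def] using h1
  choose! Gx hGx hGxb using fun s hs x => (h.forcing s hs x).2.2
  -- The source is the component of `z + G`. Its size is at most `N + C₀ N = A`, and that of its
  -- derivative at most `Y + C₀ (N + Y) ≤ B`, since `N` is nonnegative.
  have key := (h.component hD i).abs_deriv_le hdpos ht
    (Hx := fun s x => inner ℝ e (zx s x + Gx s x)) (A := fun s => (1 + C₀) * N s)
    (B := fun s => (1 + C₀) * (N s + Y s)) (K := Y t₀)
    (ψ := fun s => c * (Real.exp (-(t₁ - s)) * N s)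
      + (Set.Icc (t₁ - δ) t₁).indicator (fun _ => b) s)
    (fun s hs x => (innerSL ℝ e).hasFDerivAt.comp_hasDerivAt x
      ((hx s (Set.Ioo_subset_Icc_self hs) x).add (hGx s (Set.Ioo_subset_Icc_self hs) x)))
    (fun s hs x => by
      have hs' := Set.Ioo_subset_Icc_self hs
      refine (hb _).trans ((norm_add_le _ _).trans ?_)
      linarith [(h.forcing s hs' x).1, (h.forcing s hs' x).2.1])
    (fun s hs x => by
      have hs' := Set.Ioo_subset_Icc_self hs
      refine (hb _).trans ((norm_add_le _ _).trans ?_)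
      linarith [h.gradient_le s hs' x, hGxb s hs' x, h.source_nonneg hs'])
    (fun x => (hb _).trans (h.gradient_le t₀ h0 x))
    ((hi1.const_mul c).add hi2.integrableOn)
    (fun s hs => by
      have hs' := Set.Ioo_subset_Icc_self hs
      have hN := h.source_nonneg hs'
      have hE := Real.exp_pos (-(t₁ - s))
      -- Recent past: the bound through the derivative of the source avoids the singularity of the
      -- heat kernel and costs the gradient `Y`, but only on an interval of length `δ`.
      by_cases hsδ : t₁ - δ ≤ s
      · rw [Set.indicator_of_mem (show s ∈ Set.Icc (t₁ - δ) t₁ from ⟨hsδ, hs.2.le⟩)]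
        have h1 : Real.exp (-(t₁ - s)) * Y s ≤ m * Real.exp (-(t₁ / 2)) := by
          calc Real.exp (-(t₁ - s)) * Y s
              = (Real.exp (s / 2) * Y s) * (Real.exp (-(t₁ / 2)) * Real.exp (-((t₁ - s) / 2))) := by
                rw [show -(t₁ - s) = s / 2 + (-(t₁ / 2) + -((t₁ - s) / 2)) by ring, Real.exp_add,
                  Real.exp_add]
                ring
            _ ≤ m * (Real.exp (-(t₁ / 2)) * 1) := by
                have : Real.exp (-((t₁ - s) / 2)) ≤ 1 :=
                  Real.exp_le_one_iff.2 (by linarith [hs.2])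
                have := hm s hs'
                have := hY s hs'
                gcongr
            _ = m * Real.exp (-(t₁ / 2)) := by rw [mul_one]
        have h2 : 1 + C₀ ≤ c := by
          rw [hc]
          exact le_mul_of_one_le_right (by positivity) (le_add_of_nonneg_right (by positivity))
        calc _ ≤ Real.exp (-(t₁ - s)) * ((1 + C₀) * (N s + Y s)) :=
              mul_le_mul_of_nonneg_left (min_le_left _ _) hE.le
          _ = (1 + C₀) * (Real.exp (-(t₁ - s)) * N s) + (1 + C₀) * (Real.exp (-(t₁ - s)) * Y s) := by
              ring
          _ ≤ _ := by
              rw [hbdef]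
              gcongr
      -- Distant past: the Gaussian is wide, and smoothing bounds the gradient by `N` alone with the
      -- factor `1/√(2dδ)`.
      · rw [Set.indicator_of_notMem (fun hmem => hsδ hmem.1), add_zero]
        push Not at hsδ
        have h1 : √(2 * d * δ) ≤ √(2 * d * (t₁ - s)) := by
          refine Real.sqrt_le_sqrt ?_
          have : δ ≤ t₁ - s := by linarith
          gcongr
        calc _ ≤ Real.exp (-(t₁ - s)) * (κ * ((1 + C₀) * N s) / √(2 * d * (t₁ - s))) :=
              mul_le_mul_of_nonneg_left (min_le_right _ _) hE.le
          _ ≤ Real.exp (-(t₁ - s)) * (κ * ((1 + C₀) * N s) / √(2 * d * δ)) := by gcongr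
          _ = (1 + C₀) * (κ / √(2 * d * δ)) * (Real.exp (-(t₁ - s)) * N s) := by ring
          _ ≤ _ := by
              rw [hc]
              gcongr
              linarith)
    x
  refine key.trans ?_
  have hint : ∫ s in t₀..t₁, (c * (Real.exp (-(t₁ - s)) * N s)
      + (Set.Icc (t₁ - δ) t₁).indicator (fun _ => b) s)
      ≤ c * √(∫ s in t₀..t₁, Real.exp (-(t₁ - s)) * N s ^ 2) + δ * b := by
    rw [intervalIntegral.integral_add
      ((intervalIntegrable_iff_integrableOn_Icc_of_le ht).2 (hi1.const_mul c))
      hi2.intervalIntegrable, intervalIntegral.integral_const_mul]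
    refine add_le_add (mul_le_mul_of_nonneg_left ?_ (by positivity)) ?_
    · exact Real.le_sqrt_of_sq_le (integral_exp_mul_sq_le ht h.integrableOn h.integrableOn_sq)
    · rw [intervalIntegral.integral_of_le ht]
      refine (setIntegral_le_integral hi2 (ae_of_all _ fun s =>
        Set.indicator_nonneg (fun _ _ => hb0) s)).trans ?_
      rw [integral_indicator measurableSet_Icc, setIntegral_const]
      simp [hδ.le]
  have e1 : (1 + C₀) * δ * (m * Real.exp (-(t₁ / 2))) = δ * b := by rw [hbdef]; ring
  rw [e1, add_assoc]
  exact add_le_add_right hint _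

end IsForcedSolution

/-- Damping of the gradient. -/
theorem exists_gradient_bound {D : Matrix (Fin n) (Fin n) ℝ} (hD : D.PosDef) {k₀ : ℝ}
    (hk₀ : k₀ ≠ 0) (ω₀ : ℝ) {C₀ : ℝ} (hC₀ : 0 ≤ C₀) :
    ∃ C, 0 ≤ C ∧ ∀ (t₀ t₁ M : ℝ) (z zs zx zxx G : ℝ → ℝ → State n) (N Y : ℝ → ℝ), t₀ ≤ t₁ →
      IsForcedSolution D k₀ ω₀ t₀ t₁ M C₀ z zs zx zxx G N Y →
      Y t₁ ≤ C * √(Real.exp (t₀ - t₁) * Y t₀ ^ 2 + ∫ s in t₀..t₁, Real.exp (s - t₁) * N s ^ 2) := by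
  -- With this choice the `n` components together return at most `n (1 + C₀) δ = n / (2(n + 1)) ≤
  -- 1/2` times the supremum `m`; `n + 1` keeps the denominator positive for `n = 0`.
  set δ : ℝ := 1 / (2 * (n + 1) * (1 + C₀)) with hδ
  have hδ0 : 0 < δ := by positivity
  set c : Fin n → ℝ := fun i => (1 + C₀) * (1 + (∫ x, |x| ∂stdGaussian)
            / √(2 * (k₀ ^ 2 * hD.isHermitian.eigenvalues i) * δ)) with hc
  have hκ0 : 0 ≤ ∫ x, |x| ∂stdGaussian := integral_nonneg fun _ => abs_nonneg _
  have hc0 : ∀ i, 0 ≤ c i := fun i => by simp only [hc]; positivity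
  refine ⟨2 * ∑ i, (1 + c i), by positivity,
    fun t₀ t₁ M z zs zx zxx G N Y ht h => ?_⟩
  have hY : ∀ s ∈ Set.Icc t₀ t₁, 0 ≤ Y s := fun s hs =>
    (norm_nonneg _).trans (h.gradient_le s hs 0)
  have h0 : t₀ ∈ Set.Icc t₀ t₁ := ⟨le_rfl, ht⟩
  have h1 : t₁ ∈ Set.Icc t₀ t₁ := ⟨ht, le_rfl⟩
  set Q := Real.exp t₀ * Y t₀ ^ 2 + ∫ s in t₀..t₁, Real.exp s * N s ^ 2 with hQ
  have hint : IntegrableOn (fun s => Real.exp s * N s ^ 2) (Set.Icc t₀ t₁) :=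
    h.integrableOn_sq.continuousOn_mul Real.continuous_exp.continuousOn isCompact_Icc
  -- The weight `e^{s/2}` is the square root of the weight `e^s` that the squared quantities carry.
  -- The supremum is finite by the qualitative bound `M`, which makes absorption legitimate; `M`
  -- does not enter the constant.
  set m := sSup ((fun s => Real.exp (s / 2) * Y s) '' Set.Icc t₀ t₁) with hm
  have hbdd : BddAbove ((fun s => Real.exp (s / 2) * Y s) '' Set.Icc t₀ t₁) := by
    refine ⟨Real.exp (t₁ / 2) * M, ?_⟩
    rintro _ ⟨s, hs, rfl⟩
    have e1 : Y s ≤ M := h.le_gradient s hs M fun x => (h.bound s hs x).2.2.1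
    have e2 := hY s hs
    have e3 := hs.2
    simp only
    gcongr
  have hmle : ∀ s ∈ Set.Icc t₀ t₁, Real.exp (s / 2) * Y s ≤ m := fun s hs =>
    le_csSup hbdd ⟨s, hs, rfl⟩
  have hm0 : 0 ≤ m := (mul_nonneg (Real.exp_pos _).le (hY t₀ h0)).trans (hmle t₀ h0)
  -- The estimate is needed at all intermediate times, since the supremum `m` runs over the whole
  -- interval.
  have hstep : ∀ t ∈ Set.Icc t₀ t₁, Real.exp (t / 2) * Y t ≤ (∑ i, (1 + c i)) * √Q + m / 2 := by
    intro t htI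
    have ht' := h.mono htI.2
    have hsub : Set.Icc t₀ t ⊆ Set.Icc t₀ t₁ := Set.Icc_subset_Icc_right htI.2
    have hE := Real.exp_pos (t / 2)
    have hQ1 : Real.exp (t₀ / 2) * Y t₀ ≤ √Q := by
      refine Real.le_sqrt_of_sq_le ?_
      rw [mul_pow, ← Real.exp_nat_mul]
      have e1 : ((2 : ℕ) : ℝ) * (t₀ / 2) = t₀ := by push_cast; ring
      rw [e1, hQ]
      exact le_add_of_nonneg_right (intervalIntegral.integral_nonneg ht fun s _ => by positivity)
    have hQ2 : Real.exp (t / 2) * √(∫ s in t₀..t, Real.exp (-(t - s)) * N s ^ 2) ≤ √Q := by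
      rw [show Real.exp (t / 2) = √(Real.exp t) from Real.exp_half t, ← Real.sqrt_mul (Real.exp_pos _).le,
        ← intervalIntegral.integral_const_mul]
      refine Real.sqrt_le_sqrt ?_
      have e1 : ∀ s, Real.exp t * (Real.exp (-(t - s)) * N s ^ 2) = Real.exp s * N s ^ 2 :=
        fun s => by rw [← mul_assoc, ← Real.exp_add]; congr 2; ring
      simp only [e1]
      have e2 : ∫ s in t₀..t, Real.exp s * N s ^ 2 ≤ ∫ s in t₀..t₁, Real.exp s * N s ^ 2 :=
        intervalIntegral.integral_mono_interval le_rfl htI.1 htI.2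
          (ae_of_all _ fun s => by positivity)
          ((intervalIntegrable_iff_integrableOn_Icc_of_le ht).2 hint)
      exact e2.trans (le_add_of_nonneg_left (by positivity))
    have hcomp : ∀ i x, Real.exp (t / 2) * |inner ℝ (hD.isHermitian.eigenvectorBasis i) (zx t x)|
        ≤ (1 + c i) * √Q + (1 + C₀) * δ * m := by
      intro i x
      have e := ht'.abs_component_le hD hk₀ hC₀ htI.1 hδ0 (fun s hs => hmle s (hsub hs)) i x
      have e3 : Real.exp (t / 2) * (Real.exp (-(t - t₀)) * Y t₀) ≤ √Q := by
        refine le_trans ?_ hQ1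
        rw [← mul_assoc, ← Real.exp_add]
        have := hY t₀ h0
        have := htI.1
        gcongr
        linarith
      have e4 : Real.exp (t / 2) * ((1 + C₀) * δ * (m * Real.exp (-(t / 2))))
          = (1 + C₀) * δ * m := by
        rw [Real.exp_neg]
        field_simp
      calc _ ≤ Real.exp (t / 2) * _ := mul_le_mul_of_nonneg_left e hE.le
        _ = Real.exp (t / 2) * (Real.exp (-(t - t₀)) * Y t₀)
          + c i * (Real.exp (t / 2) * √(∫ s in t₀..t, Real.exp (-(t - s)) * N s ^ 2))
          + Real.exp (t / 2) * ((1 + C₀) * δ * (m * Real.exp (-(t / 2)))) := by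
            simp only [hc]; ring
        _ ≤ √Q + c i * √Q + (1 + C₀) * δ * m := by
            rw [e4]
            gcongr
        _ = _ := by ring
    have hx : ∀ x, ‖zx t x‖ ≤ Real.exp (-(t / 2)) * ((∑ i, (1 + c i)) * √Q + m / 2) := by
      intro x
      have e1 : Real.exp (t / 2) * ‖zx t x‖ ≤ (∑ i, (1 + c i)) * √Q + m / 2 := by
        calc _ ≤ Real.exp (t / 2)
                * ∑ i, |inner ℝ (hD.isHermitian.eigenvectorBasis i) (zx t x)| :=
              mul_le_mul_of_nonneg_left (norm_le_sum_inner _ _) hE.le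
          _ ≤ ∑ i, ((1 + c i) * √Q + (1 + C₀) * δ * m) := by
              rw [Finset.mul_sum]
              exact Finset.sum_le_sum fun i _ => hcomp i x
          _ = (∑ i, (1 + c i)) * √Q + n * ((1 + C₀) * δ) * m := by
              rw [Finset.sum_add_distrib, Finset.sum_mul]
              simp
              ring
          _ ≤ _ := by
              have : n * ((1 + C₀) * δ) ≤ 1 / 2 := by
                rw [hδ, div_eq_mul_inv, one_mul, mul_inv, ← mul_assoc, ← mul_assoc,
                  mul_right_comm _ _ (1 + C₀)⁻¹, mul_assoc (n : ℝ),
                  mul_inv_cancel₀ (by positivity), mul_one, ← div_eq_mul_inv,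
                  div_le_iff₀ (by positivity)]
                linarith
              nlinarith
      rw [Real.exp_neg, inv_mul_eq_div, le_div_iff₀ hE, mul_comm]
      exact e1
    have := ht'.le_gradient t ⟨htI.1, le_rfl⟩ _ hx
    rwa [Real.exp_neg, inv_mul_eq_div, le_div_iff₀ hE, mul_comm] at this
  -- Taking the supremum over `t` lets the finite term `m / 2` be absorbed on the left.
  have hm2 : m ≤ (∑ i, (1 + c i)) * √Q + m / 2 := by
    refine csSup_le ⟨_, ⟨t₀, h0, rfl⟩⟩ ?_
    rintro _ ⟨s, hs, rfl⟩
    exact hstep s hs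
  have hfin : Real.exp (t₁ / 2) * Y t₁ ≤ 2 * (∑ i, (1 + c i)) * √Q := by
    have := hmle t₁ h1
    linarith
  have hQe : Real.exp (t₀ - t₁) * Y t₀ ^ 2 + ∫ s in t₀..t₁, Real.exp (s - t₁) * N s ^ 2
      = Real.exp (-(t₁ / 2)) ^ 2 * Q := by
    have e0 : Real.exp (-(t₁ / 2)) ^ 2 = Real.exp (-t₁) := by
      rw [← Real.exp_nat_mul]; congr 1; push_cast; ring
    rw [e0, hQ, mul_add, ← intervalIntegral.integral_const_mul]
    have e1 : ∀ s, Real.exp (-t₁) * (Real.exp s * N s ^ 2) = Real.exp (s - t₁) * N s ^ 2 :=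
      fun s => by rw [← mul_assoc, ← Real.exp_add]; congr 2; ring
    simp only [e1]
    rw [← mul_assoc, ← Real.exp_add]
    congr 3
    ring
  rw [hQe, Real.sqrt_mul (by positivity), Real.sqrt_sq (Real.exp_pos _).le, Real.exp_neg]
  rw [mul_left_comm, inv_mul_eq_div, le_div_iff₀ (Real.exp_pos _), mul_comm]
  exact hfin

end Damping

/-! ## The modified forward-modulated perturbation -/

namespace ModulationData

variable {a r₀ R : ℝ}

lemma source_nonneg (d : ModulationData a r₀ R) : 0 ≤ d.S :=
  (abs_nonneg _).trans (d.source_g 2 le_rfl (by norm_num) 0)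

lemma isBigO_one_add_of_one {E : Type*} [NormedAddCommGroup E]
    {T : ModulationData a r₀ R × ℝ → E} (h : T =O[⊤] fun _ => (1 : ℝ)) :
    T =O[⊤] fun q => 1 + q.1.S :=
  h.trans (Asymptotics.isBigO_top.2 ⟨1, fun q => by
    have := q.1.source_nonneg
    rw [one_mul, norm_one, Real.norm_of_nonneg (by positivity)]
    linarith⟩)

lemma isBigO_one_add_of_source {E : Type*} [NormedAddCommGroup E]
    {T : ModulationData a r₀ R × ℝ → E}
    (h : T =O[⊤] fun q => q.1.S) : T =O[⊤] fun q => 1 + q.1.S :=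
  h.trans (Asymptotics.isBigO_top.2 ⟨1, fun q => by
    have := q.1.source_nonneg
    rw [one_mul, Real.norm_of_nonneg this, Real.norm_of_nonneg (by positivity)]
    linarith⟩)

variable {V : Type*} [NormedAddCommGroup V] [NormedSpace ℝ V] {k₀ r : ℝ} {φ : ℝ → ℝ → V}

lemma modulated_isBigO (hr : |k₀| * r₀ < r) (hφ : IsProfile (Set.Ioo (k₀ - r) (k₀ + r)) φ) :
    (fun q : ModulationData a r₀ R × ℝ => q.1.modulated k₀ φ q.2) =O[⊤] fun _ => (1 : ℝ) :=
  (comp_bounded hr hφ).1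

lemma modulatedFst_isBigO (hr : |k₀| * r₀ < r) (hφ : IsProfile (Set.Ioo (k₀ - r) (k₀ + r)) φ) :
    (fun q : ModulationData a r₀ R × ℝ => q.1.modulatedFst k₀ φ q.2) =O[⊤] fun _ => (1 : ℝ) := by
  have h1 := (one_add_g_bounded.1.add (defect_isBigO_one (a := a) (r₀ := r₀) (R := R))).smul
    (modulated_isBigO hr (hφ.phaseDeriv isOpen_Ioo))
  have h2 := ((g_isBigO_one (a := a) (r₀ := r₀) (R := R) (j := 2) le_rfl).const_mul_left k₀).smul
    (modulated_isBigO hr (hφ.wavenumberDeriv isOpen_Ioo))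
  simp only [smul_eq_mul, mul_one] at h1 h2
  exact h1.add h2

/-- The bound `R` covers `γ` only up to second order, so `γ_ζζζ` is controlled through `S`. The
resulting bound `1 + S` is used only for the qualitative constant `M`. -/
lemma modulatedSnd_isBigO (hr : |k₀| * r₀ < r) (hφ : IsProfile (Set.Ioo (k₀ - r) (k₀ + r)) φ) :
    (fun q : ModulationData a r₀ R × ℝ => q.1.modulatedSnd k₀ φ q.2)
      =O[⊤] fun q => 1 + q.1.S := by
  have g2 := g_isBigO_one (a := a) (r₀ := r₀) (R := R) (j := 2) le_rfl
  have g3 := isBigO_one_add_of_source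
    (g_isBigO_source (a := a) (r₀ := r₀) (R := R) (j := 3) (by lia) (by lia))
  have g1 := g_isBigO_one (a := a) (r₀ := r₀) (R := R) (j := 1) (by lia)
  have g0 := g_isBigO_one (a := a) (r₀ := r₀) (R := R) (j := 0) (by lia)
  have e1 := (isBigO_one_add_of_one g2).add ((isBigO_one_add_of_one
    (by simpa only [mul_one] using g2.mul g1)).const_mul_left 3)
  have e2 := e1.add (by simpa only [mul_one] using g3.mul g0)
  have h1 := e2.smul (modulated_isBigO (R := R) (a := a) hr (hφ.phaseDeriv isOpen_Ioo))
  have h2 := (isBigO_one_add_of_one (one_add_g_bounded.1.add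
    (defect_isBigO_one (a := a) (r₀ := r₀) (R := R)))).smul
    (modulatedFst_isBigO hr (hφ.phaseDeriv isOpen_Ioo))
  have h3 := (g3.const_mul_left k₀).smul
    (modulated_isBigO hr (hφ.wavenumberDeriv isOpen_Ioo))
  have h4 := ((isBigO_one_add_of_one g2).const_mul_left k₀).smul
    (modulatedFst_isBigO hr (hφ.wavenumberDeriv isOpen_Ioo))
  simp only [smul_eq_mul, mul_one] at h1 h2 h3 h4
  exact (h1.add h2).add (h3.add h4)

/-- The time derivative `γ_t` is controlled by writing it as `(γ_t - a γ_ζ) + a γ_ζ`, a small term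
plus a bounded one. -/
lemma modulatedTime_isBigO (hr : |k₀| * r₀ < r) (hφ : IsProfile (Set.Ioo (k₀ - r) (k₀ + r)) φ) :
    (fun q : ModulationData a r₀ R × ℝ => q.1.modulatedTime k₀ φ q.2)
      =O[⊤] fun q => 1 + q.1.S := by
  have g1 := g_isBigO_one (a := a) (r₀ := r₀) (R := R) (j := 1) (by lia)
  have g0 := g_isBigO_one (a := a) (r₀ := r₀) (R := R) (j := 0) (by lia)
  have p1 := isBigO_one_add_of_source
    (p_isBigO_source (a := a) (r₀ := r₀) (R := R) (j := 1) (by lia) (by lia))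
  have p0 : (fun q : ModulationData a r₀ R × ℝ => q.1.p 0 q.2) =O[⊤] fun q => 1 + q.1.S :=
    ((isBigO_one_add_of_source (transport_small (a := a) (r₀ := r₀) (R := R)).1).add
      (isBigO_one_add_of_one (g1.const_mul_left a))).congr_left fun q => by ring
  have h1 := ((p0.mul one_add_g_bounded.1).add
    (by simpa only [mul_one, one_mul] using g0.mul p1)).smul
    (modulated_isBigO hr (hφ.phaseDeriv isOpen_Ioo))
  have h2 := (p1.const_mul_left k₀).smul (modulated_isBigO hr (hφ.wavenumberDeriv isOpen_Ioo))
  simp only [smul_eq_mul, mul_one] at h1 h2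
  exact h1.add h2

end ModulationData

/-! ### The source terms as bounds on the phase modulation -/

section Source

variable {n : ℕ} {I : Set ℝ} {γ : ℝ → ℝ → ℝ} {U P : ℝ → ℕ → (ℝ →ᵇ ℝ)}

lemma IsCurveJet.iteratedDeriv_transport (h : IsCurveJet 5 I γ U P) {s : ℝ} (hs : s ∈ I) (a : ℝ)
    {j : ℕ} (hj : j ≤ 4) : iteratedDeriv j (P s 0 - a • U s 1 : ℝ →ᵇ ℝ)
      = (P s j - a • U s (j + 1) : ℝ →ᵇ ℝ) := by
  induction j with
  | zero => simp
  | succ j ih =>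
    rw [iteratedDeriv_succ, ih (by lia)]
    ext x
    exact ((h.space_time s hs j (by lia) x).sub
      ((h.space s hs (j + 1) (by lia) x).const_mul a)).deriv

lemma IsCurveJet.gammaTilde_eq (h : IsCurveJet 5 I γ U P) (hI : IsOpen I) {s : ℝ} (hs : s ∈ I)
    (k₀ ω₀ : ℝ) (freq : ℝ → ℝ) : gammaTilde k₀ ω₀ freq γ s
      = (P s 0 - (ω₀ - k₀ * deriv freq k₀) • U s 1 : ℝ →ᵇ ℝ) := by
  ext x
  simp [gammaTilde, h.dt_eq hI hs, h.deriv_eq hs]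

/-- The source terms, expressed through the jet of the phase modulation. -/
lemma IsCurveJet.dampingSource_eq (h : IsCurveJet 5 I γ U P) (hI : IsOpen I) {s : ℝ} (hs : s ∈ I)
    (k₀ ω₀ : ℝ) (freq : ℝ → ℝ) (z : ℝ → ℝ → State n) :
    dampingSource k₀ ω₀ freq z γ s = supNorm (z s) ^ 2
      + (∑ j ∈ Finset.range 4, ‖U s (2 + j)‖) ^ 2
      + (∑ j ∈ Finset.range 3, ‖P s (1 + j)‖) ^ 2
      + (∑ j ∈ Finset.range 3, ‖P s j - (ω₀ - k₀ * deriv freq k₀) • U s (j + 1)‖) ^ 2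
      + ‖U s 1‖ ^ 2 * (‖U s 1‖ ^ 2 + ‖P s 0‖ ^ 2) := by
  have e1 : deriv (γ s) = U s 1 := funext (h.deriv_eq hs (by lia))
  simp only [dampingSource, cubNorm]
  rw [h.dt_deriv_eq hI hs (by lia), h.gammaTilde_eq hI hs, h.iteratedDeriv_eq hs (by lia), e1,
    h.dt_eq hI hs, supNorm_coe, supNorm_coe]
  congr 1
  refine congrArg₂ (· + ·) (congrArg₂ (· + ·) (congrArg₂ (· + ·) rfl ?_) ?_) ?_ <;>
    refine congrArg (· ^ 2) (Finset.sum_congr rfl fun j hj => ?_) <;>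
    have := Finset.mem_range.1 hj
  · rw [h.iteratedDeriv_space hs 2 (by lia), supNorm_coe]
  · rw [h.iteratedDeriv_time hs 1 (by lia), supNorm_coe]
  · rw [h.iteratedDeriv_transport hs _ (by lia), supNorm_coe]

lemma dampingSource_nonneg (k₀ ω₀ : ℝ) (freq : ℝ → ℝ) (z : ℝ → ℝ → State n) (γ : ℝ → ℝ → ℝ)
    (s : ℝ) : 0 ≤ dampingSource k₀ ω₀ freq z γ s := by
  unfold dampingSource
  positivity

/-- The modulation data of a phase modulation at a fixed time. -/
lemma IsCurveJet.exists_modulationData (h : IsCurveJet 5 I γ U P) (hI : IsOpen I) {s : ℝ}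
    (hs : s ∈ I) {r₀ R : ℝ} (hr₀ : supNorm (deriv (γ s)) ≤ r₀) (hR : cubNorm 2 (γ s) ≤ R)
    (k₀ ω₀ : ℝ) (freq : ℝ → ℝ) (z : ℝ → ℝ → State n) :
    ∃ d : ModulationData (ω₀ - k₀ * deriv freq k₀) r₀ R, (∀ j x, d.g j x = U s j x) ∧
      (∀ j x, d.p j x = P s j x) ∧ d.S = √(dampingSource k₀ ω₀ freq z γ s) := by
  set a := ω₀ - k₀ * deriv freq k₀ with ha
  have e1 : deriv (γ s) = U s 1 := funext (h.deriv_eq hs (by lia))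
  have hsrc := h.dampingSource_eq hI hs k₀ ω₀ freq z
  have b : ∀ (g : ℝ →ᵇ ℝ) x, |g x| ≤ ‖g‖ := fun g x => g.norm_coe_le_norm x
  have hle : ∀ y : ℝ, y ^ 2 ≤ dampingSource k₀ ω₀ freq z γ s →
      y ≤ √(dampingSource k₀ ω₀ freq z γ s) := fun y hy => Real.le_sqrt_of_sq_le hy
  have n0 := sq_nonneg (supNorm (z s))
  have n1 := sq_nonneg (∑ j ∈ Finset.range 4, ‖U s (2 + j)‖)
  have n2 := sq_nonneg (∑ j ∈ Finset.range 3, ‖P s (1 + j)‖)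
  have n3 := sq_nonneg (∑ j ∈ Finset.range 3, ‖P s j - a • U s (j + 1)‖)
  have n4 : 0 ≤ ‖U s 1‖ ^ 2 * (‖U s 1‖ ^ 2 + ‖P s 0‖ ^ 2) := by positivity
  have h1 := hle (∑ j ∈ Finset.range 4, ‖U s (2 + j)‖) (by rw [hsrc]; linarith)
  have h2 := hle (∑ j ∈ Finset.range 3, ‖P s (1 + j)‖) (by rw [hsrc]; linarith)
  have h3 := hle (∑ j ∈ Finset.range 3, ‖P s j - a • U s (j + 1)‖) (by rw [hsrc]; linarith)
  refine ⟨⟨fun j x => U s j x, fun j x => P s j x, √(dampingSource k₀ ω₀ freq z γ s),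
    fun j hj x => h.space s hs j (by lia) x, fun j hj x => h.space_time s hs j (by lia) x,
    fun j hj x => ?_, fun x => ?_, fun j hj hj' x => ?_, fun j hj hj' x => ?_, fun j hj x => ?_,
    fun x => ?_, fun x => ?_⟩, fun _ _ => rfl, fun _ _ => rfl, rfl⟩
  · refine (b _ x).trans (le_trans ?_ hR)
    rw [← supNorm_coe, ← h.iteratedDeriv_eq hs (by lia)]
    exact supNorm_le_cubNorm hj _
  · refine (b _ x).trans (le_trans ?_ hr₀)
    rw [e1, supNorm_coe]
  · obtain ⟨i, rfl⟩ := Nat.exists_eq_add_of_le hj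
    exact (b _ x).trans (le_trans (Finset.single_le_sum (f := fun j => ‖U s (2 + j)‖)
      (fun _ _ => norm_nonneg _) (Finset.mem_range.2 (by lia))) h1)
  · obtain ⟨i, rfl⟩ := Nat.exists_eq_add_of_le hj
    exact (b _ x).trans (le_trans (Finset.single_le_sum (f := fun j => ‖P s (1 + j)‖)
      (fun _ _ => norm_nonneg _) (Finset.mem_range.2 (by lia))) h2)
  · exact (b (P s j - a • U s (j + 1)) x).trans (le_trans (Finset.single_le_sum
      (f := fun j => ‖P s j - a • U s (j + 1)‖) (fun _ _ => norm_nonneg _)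
      (Finset.mem_range.2 (by lia))) h3)
  -- The last summand of the source dominates both `‖γ_ζ‖⁴` and `‖γ_ζ‖² ‖γ_t‖²`; taking square roots
  -- gives the two remaining product bounds.
  all_goals
    have hbase : ‖U s 1‖ ^ 2 * (‖U s 1‖ ^ 2 + ‖P s 0‖ ^ 2) ≤ dampingSource k₀ ω₀ freq z γ s := by
      rw [hsrc]
      exact le_add_of_nonneg_left (by positivity)
  · refine (mul_le_mul (b _ x) (b _ x) (abs_nonneg _) (norm_nonneg _)).trans (hle _ ?_)
    refine le_trans ?_ hbase
    nlinarith [mul_nonneg (sq_nonneg ‖U s 1‖) (sq_nonneg ‖P s 0‖)]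
  · refine (mul_le_mul (b _ x) (b _ x) (abs_nonneg _) (norm_nonneg _)).trans (hle _ ?_)
    refine le_trans ?_ hbase
    nlinarith [mul_nonneg (sq_nonneg ‖U s 1‖) (sq_nonneg ‖U s 1‖)]

/-- The source terms are measurable and bounded in time. -/
lemma IsCurveJet.dampingSource_regular (h : IsCurveJet 5 I γ U P) (hI : IsOpen I) {b c B : ℝ}
    (hbc : b ≤ c) (hsub : Set.Icc b c ⊆ I) (k₀ ω₀ : ℝ) (freq : ℝ → ℝ) {z : ℝ → ℝ → State n}
    (hz : ∀ x, ContinuousOn (fun s => z s x) (Set.Icc b c))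
    (hB : ∀ s ∈ Set.Icc b c, ∀ x, ‖z s x‖ ≤ B) :
    AEStronglyMeasurable (dampingSource k₀ ω₀ freq z γ) (volume.restrict (Set.Icc b c)) ∧
      ∃ M, ∀ s ∈ Set.Icc b c, dampingSource k₀ ω₀ freq z γ s ≤ M := by
  set a := ω₀ - k₀ * deriv freq k₀ with ha
  -- `F` collects the terms that depend on the modulation alone and is continuous in time. For the
  -- term with `z`, measurability of the sup norm suffices.
  set F : ℝ → ℝ := fun s => (∑ j ∈ Finset.range 4, ‖U s (2 + j)‖) ^ 2
      + (∑ j ∈ Finset.range 3, ‖P s (1 + j)‖) ^ 2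
      + (∑ j ∈ Finset.range 3, ‖P s j - a • U s (j + 1)‖) ^ 2
      + ‖U s 1‖ ^ 2 * (‖U s 1‖ ^ 2 + ‖P s 0‖ ^ 2) with hF
  have hU : ∀ j ≤ 5, ContinuousOn (fun s => U s j) (Set.Icc b c) := fun j hj =>
    (h.continuousOn j hj).mono hsub
  have hP : ∀ j ≤ 5, ContinuousOn (fun s => P s j) (Set.Icc b c) := fun j hj =>
    (h.continuousOn_time j hj).mono hsub
  have hFc : ContinuousOn F (Set.Icc b c) := by
    refine ((((continuousOn_finsetSum _ fun j hj => ?_).pow 2).add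
      ((continuousOn_finsetSum _ fun j hj => ?_).pow 2)).add
      ((continuousOn_finsetSum _ fun j hj => ?_).pow 2)).add
      (((hU 1 (by lia)).norm.pow 2).mul (((hU 1 (by lia)).norm.pow 2).add
        ((hP 0 (by lia)).norm.pow 2)))
    all_goals have := Finset.mem_range.1 hj
    · exact (hU _ (by lia)).norm
    · exact (hP _ (by lia)).norm
    · exact ((hP _ (by lia)).sub ((hU _ (by lia)).const_smul a)).norm
  have heq : ∀ s ∈ Set.Icc b c, dampingSource k₀ ω₀ freq z γ s = supNorm (z s) ^ 2 + F s :=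
    fun s hs => by rw [h.dampingSource_eq hI (hsub hs)]; simp only [hF]; ring
  constructor
  · refine (((aestronglyMeasurable_supNorm hbc hz hB).pow 2).add
      (hFc.aestronglyMeasurable measurableSet_Icc)).congr ?_
    filter_upwards [ae_restrict_mem measurableSet_Icc] with s hs
    exact (heq s hs).symm
  · obtain ⟨M, hM⟩ := isCompact_Icc.exists_bound_of_continuousOn hFc
    refine ⟨B ^ 2 + M, fun s hs => ?_⟩
    rw [heq s hs]
    have h1 := supNorm_le (hB s hs)
    have h2 := supNorm_nonneg (z s)
    have h3 := (le_abs_self _).trans (hM s hs)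
    gcongr

end Source

/-! ### Regularity of classical solutions at positive times -/

section Solution

variable {n : ℕ}

/-- Differentiability and local boundedness of a classical solution. -/
lemma IsClassicalSolution.regular {D : Matrix (Fin n) (Fin n) ℝ} {f : State n → State n}
    {k₀ ω₀ : ℝ} {T : EReal} {u₀ : ℝ → State n} {u : ℝ → ℝ → State n}
    (hu : IsClassicalSolution D f k₀ ω₀ T u₀ u) :
    (∀ s ∈ positiveTimes T, ∀ x, HasFDerivAt (fun p : ℝ × ℝ => u p.1 p.2)
      ((ContinuousLinearMap.fst ℝ ℝ ℝ).smulRight (dt u s x)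
        + (ContinuousLinearMap.snd ℝ ℝ ℝ).smulRight (deriv (u s) x)) (s, x)) ∧
    (∀ s ∈ positiveTimes T, ∀ x, HasDerivAt (deriv (u s)) (iteratedDeriv 2 (u s) x) x) ∧
    ∀ b c, Set.Icc b c ⊆ positiveTimes T → ∃ M, ∀ s ∈ Set.Icc b c, ∀ x,
      ‖u s x‖ ≤ M ∧ ‖dt u s x‖ ≤ M ∧ ‖deriv (u s) x‖ ≤ M ∧ ‖iteratedDeriv 2 (u s) x‖ ≤ M := by
  have hI := isOpen_positiveTimes T
  obtain ⟨U, P, hj⟩ := hu.differentiable.exists_jet hI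
  obtain ⟨W, hW, hWj⟩ := hu.continuous_two.exists_continuous_jet
  have hd : ∀ s ∈ positiveTimes T, ∀ x, HasDerivAt (u s) (deriv (u s) x) x := fun s hs x => by
    simpa using (hWj s hs).1.hasDerivAt_iteratedDeriv (j := 0) (by lia) x
  refine ⟨fun s hs x => ?_, fun s hs x => ?_, fun b c hbc => ?_⟩
  · have e : (U s 0 : ℝ → State n) = u s := funext fun x => (hj.eq_value hs x).symm
    rw [hj.dt_eq hI hs]
    refine (hasFDerivAt_eval (hj.time s hs 0 le_rfl) (e ▸ hd s hs x)).congr_of_eventuallyEq ?_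
    filter_upwards [(hI.preimage continuous_fst).mem_nhds (show ((s, x) : ℝ × ℝ) ∈ _ from hs)]
      with p hp
    exact hj.eq_value hp p.2
  · simpa using (hWj s hs).1.hasDerivAt_iteratedDeriv (j := 1) (by lia) x
  · obtain ⟨M, hM0, hM⟩ := hj.exists_bound hbc
    obtain ⟨M₁, hM₁⟩ := isCompact_Icc.exists_bound_of_continuousOn ((hW 1 (by lia)).mono hbc)
    obtain ⟨M₂, hM₂⟩ := isCompact_Icc.exists_bound_of_continuousOn ((hW 2 (by lia)).mono hbc)
    refine ⟨max M (max M₁ M₂), fun s hs x => ⟨?_, ?_, ?_, ?_⟩⟩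
    · rw [hj.eq_value (hbc hs)]
      exact (hM s hs 0 le_rfl x).1.trans (by simp)
    · rw [hj.dt_eq hI (hbc hs)]
      exact (hM s hs 0 le_rfl x).2.trans (by simp)
    · have := (hWj s (hbc hs)).2 1 (by lia) x
      rw [iteratedDeriv_one] at this
      rw [← this]
      exact ((W s 1).norm_coe_le_norm x).trans ((hM₁ s hs).trans (by simp))
    · rw [← (hWj s (hbc hs)).2 2 (by lia) x]
      exact ((W s 2).norm_coe_le_norm x).trans ((hM₂ s hs).trans (by simp))

end Solution

/-! ### The equation satisfied by the modified perturbation -/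

section ModifiedPerturbation

variable {n : ℕ}

/-- The modulated wave train is differentiable in time and space. -/
lemma IsCurveJet.hasFDerivAt_modulated {I : Set ℝ} {γ : ℝ → ℝ → ℝ} {U P : ℝ → ℕ → (ℝ →ᵇ ℝ)}
    (h : IsCurveJet 5 I γ U P) {s : ℝ} (hs : s ∈ I) {a r₀ R k₀ r : ℝ}
    (hr : |k₀| * r₀ < r) {φ : ℝ → ℝ → State n} (hφ : IsProfile (Set.Ioo (k₀ - r) (k₀ + r)) φ)
    {d : ModulationData a r₀ R} (hg : ∀ j x, d.g j x = U s j x) (hp : ∀ j x, d.p j x = P s j x)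
    (x : ℝ) :
    HasFDerivAt
      (fun p : ℝ × ℝ => φ (p.2 + U p.1 0 p.2 * (1 + U p.1 1 p.2)) (k₀ * (1 + U p.1 1 p.2)))
      ((ContinuousLinearMap.fst ℝ ℝ ℝ).smulRight (d.modulatedTime k₀ φ x)
        + (ContinuousLinearMap.snd ℝ ℝ ℝ).smulRight (d.modulatedFst k₀ φ x)) (s, x) := by
  have h0 := h.hasFDerivAt hs (j := 0) (by lia) x
  have h1 := h.hasFDerivAt hs (j := 1) (by lia) x
  have hθ : HasFDerivAt (fun p : ℝ × ℝ => p.2 + U p.1 0 p.2 * (1 + U p.1 1 p.2))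
      ((ContinuousLinearMap.fst ℝ ℝ ℝ).smulRight
          (d.p 0 x * (1 + d.g 1 x) + d.g 0 x * d.p 1 x)
        + (ContinuousLinearMap.snd ℝ ℝ ℝ).smulRight
          (1 + d.g 1 x + ModulationData.defect (d, x))) (s, x) := by
    refine (hasFDerivAt_snd.add (h0.mul (h1.const_add 1))).congr_fderiv ?_
    simp only [ModulationData.defect, hg, hp]
    ext
    · simp; ring
    · simp; ring
  have hκ : HasFDerivAt (fun p : ℝ × ℝ => k₀ * (1 + U p.1 1 p.2))
      ((ContinuousLinearMap.fst ℝ ℝ ℝ).smulRight (k₀ * d.p 1 x)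
        + (ContinuousLinearMap.snd ℝ ℝ ℝ).smulRight (k₀ * d.g 2 x)) (s, x) := by
    refine ((h1.const_add 1).const_mul k₀).congr_fderiv ?_
    simp only [hg, hp]
    ext <;> simp
  have hmem := d.wavenumber_mem_Ioo (k₀ := k₀) hr x
  have e1 : d.phase x = x + U s 0 x * (1 + U s 1 x) := by simp only [ModulationData.phase, hg]
  have e2 : d.wavenumber k₀ x = k₀ * (1 + U s 1 x) := by
    simp only [ModulationData.wavenumber, hg]
  rw [e2] at hmem
  have key := hφ.comp_hasFDerivAt isOpen_Ioo hθ hκ hmem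
  rw [ModulationData.modulatedTime, ModulationData.modulatedFst]
  simp only [ModulationData.modulated, e1, e2]
  exact key

/-- The modified forward-modulated perturbation solves a forced linear system. -/
theorem exists_isForcedSolution {D : Matrix (Fin n) (Fin n) ℝ} {f : State n → State n}
    (hf : ContDiff ℝ ∞ f) {k₀ ω₀ r r₀ R : ℝ} (hk₀ : k₀ ≠ 0) (hr₀ : r₀ < 1) (hr : |k₀| * r₀ < r)
    {φ : ℝ → ℝ → State n} {freq : ℝ → ℝ} (hφ : IsProfile (Set.Ioo (k₀ - r) (k₀ + r)) φ)
    (hfreq : ContDiffOn ℝ ∞ freq (Set.Ioo (k₀ - r) (k₀ + r))) (hω₀ : freq k₀ = ω₀)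
    (hwt : ∀ k ∈ Set.Ioo (k₀ - r) (k₀ + r), IsWaveTrain D f k (freq k) (fun y => φ y k)) :
    ∃ C₀, 0 ≤ C₀ ∧ ∀ (T : EReal) (u₀ : ℝ → State n) (u : ℝ → ℝ → State n),
      IsClassicalSolution D f k₀ ω₀ T u₀ u → ∀ (τ : EReal) (γ : ℝ → ℝ → ℝ),
      CurveContDiff 1 5 (positiveTimes τ) γ → ∀ t₀ t₁, t₀ ≤ t₁ →
      Set.Icc t₀ t₁ ⊆ positiveTimes T → Set.Icc t₀ t₁ ⊆ positiveTimes τ →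
      (∀ s ∈ Set.Icc t₀ t₁, supNorm (deriv (γ s)) ≤ r₀) →
      (∀ s ∈ Set.Icc t₀ t₁, cubNorm 1 (modPert k₀ φ u γ s) + cubNorm 2 (γ s) ≤ R) →
      ∃ M zs zxx G, IsForcedSolution D k₀ ω₀ t₀ t₁ M C₀ (modPert k₀ φ u γ) zs
        (fun s => deriv (modPert k₀ φ u γ s)) zxx G
        (fun s => √(dampingSource k₀ ω₀ freq (modPert k₀ φ u γ) γ s))
        (fun s => supNorm (deriv (modPert k₀ φ u γ s))) := by
  set a := ω₀ - k₀ * deriv freq k₀ with ha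
  obtain ⟨B₀, hB₀⟩ := Asymptotics.isBigO_top.1
    (ModulationData.modulated_isBigO (a := a) (R := R) hr hφ)
  obtain ⟨B₁, hB₁⟩ := Asymptotics.isBigO_top.1
    (ModulationData.modulatedFst_isBigO (a := a) (R := R) hr hφ)
  obtain ⟨B₂, hB₂⟩ := Asymptotics.isBigO_top.1
    (ModulationData.modulatedSnd_isBigO (a := a) (R := R) hr hφ)
  obtain ⟨B₃, hB₃⟩ := Asymptotics.isBigO_top.1
    (ModulationData.modulatedTime_isBigO (a := a) (R := R) hr hφ)
  obtain ⟨Cr, hCr0, hCr⟩ := (ModulationData.residual_small (R := R) hk₀ hr₀ hr hφ hfreq hω₀ hwt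
    ha).exists_bound
  simp only [norm_one, mul_one, Prod.forall] at hB₀ hB₁ hB₂ hB₃ hCr
  -- The perturbation is bounded by `R` and the modulated wave train by `B₀`, so `u` stays in the
  -- ball of radius `R + B₀`; `B₁` bounds the gradient of the wave train. All constants are fixed
  -- before the solution is introduced.
  obtain ⟨Cf, hCf0, hCf⟩ := exists_reaction_bound hf (R + B₀) B₁
  refine ⟨Cf + Cr, by positivity, fun T u₀ u hu τ γ hγ t₀ t₁ ht hT hτ hsmall hbd => ?_⟩
  have hI := isOpen_positiveTimes τ
  obtain ⟨U, P, hj⟩ := hγ.exists_jet hI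
  obtain ⟨hu1, hu2, hu3⟩ := hu.regular
  obtain ⟨Mu, hMu⟩ := hu3 t₀ t₁ hT
  set z := modPert k₀ φ u γ with hz
  have hdata : ∀ s ∈ Set.Icc t₀ t₁, ∃ d : ModulationData a r₀ R, (∀ j x, d.g j x = U s j x) ∧
      (∀ j x, d.p j x = P s j x) ∧ d.S = √(dampingSource k₀ ω₀ freq z γ s) := fun s hs =>
    hj.exists_modulationData hI (hτ hs) (hsmall s hs)
      (by have := hbd s hs; linarith [cubNorm_nonneg 1 (z s)]) k₀ ω₀ freq z
  -- The choice below assigns modulation data to every real time, with an arbitrary value outside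
  -- the interval.
  have : Nonempty (ModulationData a r₀ R) := ⟨(hdata t₀ ⟨le_rfl, ht⟩).choose⟩
  choose! d hg hp hS using hdata
  have hzeq : ∀ s ∈ Set.Icc t₀ t₁, ∀ x, z s x = u s x - (d s).modulated k₀ φ x := by
    intro s hs x
    simp only [hz, modPert, ModulationData.modulated, ModulationData.phase,
      ModulationData.wavenumber, hg s hs, hj.deriv_eq (hτ hs) (by lia), hj.eq_value (hτ hs)]
  have hFD : ∀ s ∈ Set.Icc t₀ t₁, ∀ x, HasFDerivAt (fun p : ℝ × ℝ => z p.1 p.2)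
      ((ContinuousLinearMap.fst ℝ ℝ ℝ).smulRight (dt u s x - (d s).modulatedTime k₀ φ x)
        + (ContinuousLinearMap.snd ℝ ℝ ℝ).smulRight
          (deriv (u s) x - (d s).modulatedFst k₀ φ x)) (s, x) := by
    intro s hs x
    have h1 := (hu1 s (hT hs) x).sub
      (hj.hasFDerivAt_modulated (hτ hs) hr hφ (hg s hs) (hp s hs) x)
    refine (h1.congr_fderiv ?_).congr_of_eventuallyEq ?_
    · ext <;> simp
    · filter_upwards [(hI.preimage continuous_fst).mem_nhds
        (show ((s, x) : ℝ × ℝ) ∈ _ from hτ hs)] with p hp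
      simp only [hz, modPert, Pi.sub_apply, hj.deriv_eq hp (by lia), hj.eq_value hp]
  have hdz : ∀ s ∈ Set.Icc t₀ t₁, ∀ x,
      HasDerivAt (z s) (deriv (u s) x - (d s).modulatedFst k₀ φ x) x := by
    intro s hs x
    have h1 := HasFDerivAt.comp_hasDerivAt (f := fun x : ℝ => (s, x)) x (hFD s hs x)
      ((hasDerivAt_const x s).prodMk (hasDerivAt_id' x))
    simpa [Function.comp_def] using h1
  have hzx : ∀ s ∈ Set.Icc t₀ t₁,
      deriv (z s) = fun x => deriv (u s) x - (d s).modulatedFst k₀ φ x :=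
    fun s hs => funext fun x => (hdz s hs x).deriv
  have hzb : ∀ s ∈ Set.Icc t₀ t₁, ∀ x, ‖z s x‖ ≤ Mu + B₀ := fun s hs x => by
    rw [hzeq s hs]
    exact (norm_sub_le _ _).trans (add_le_add (hMu s hs x).1 (hB₀ _ _))
  have hzxb : ∀ s ∈ Set.Icc t₀ t₁, ∀ x, ‖deriv (z s) x‖ ≤ Mu + B₁ := fun s hs x => by
    rw [hzx s hs]
    exact (norm_sub_le _ _).trans (add_le_add (hMu s hs x).2.2.1 (hB₁ _ _))
  -- The solution-dependent bounds `hzb` and `hzxb` ensure that the real suprema are genuine sup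
  -- norms; the uniform bound `R` can then be read off pointwise.
  have hzR : ∀ s ∈ Set.Icc t₀ t₁, ∀ x, ‖z s x‖ ≤ R := fun s hs x => by
    have h1 := hbd s hs
    rw [cubNorm_one] at h1
    linarith [norm_le_supNorm (hzb s hs) x, supNorm_nonneg (deriv (z s)),
      cubNorm_nonneg 2 (γ s)]
  obtain ⟨hmeas, Ms, hMs⟩ := hj.dampingSource_regular hI ht hτ k₀ ω₀ freq
    (fun x s hs => ContinuousAt.continuousWithinAt
      (ContinuousAt.comp (g := fun p : ℝ × ℝ => z p.1 p.2) (f := fun s => (s, x))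
        (hFD s hs x).continuousAt (by fun_prop))) hzb
  have hSle : ∀ s ∈ Set.Icc t₀ t₁, (d s).S ≤ √Ms := fun s hs => by
    rw [hS s hs]
    exact Real.sqrt_le_sqrt (hMs s hs)
  have hzN : ∀ s ∈ Set.Icc t₀ t₁, ∀ x, ‖z s x‖ ≤ (d s).S := fun s hs x => by
    rw [hS s hs]
    refine (norm_le_supNorm (hzb s hs) x).trans (Real.le_sqrt_of_sq_le ?_)
    unfold dampingSource
    have e : ∀ A B C E F : ℝ, 0 ≤ B → 0 ≤ C → 0 ≤ E → 0 ≤ F → A ≤ A + B + C + E + F :=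
      fun A B C E F _ _ _ _ => by linarith
    exact e _ _ _ _ _ (by positivity) (by positivity) (by positivity) (by positivity)
  have hN0 : 0 ≤ √Ms := Real.sqrt_nonneg _
  have hub : ∀ s ∈ Set.Icc t₀ t₁, ∀ x, ‖u s x‖ ≤ R + B₀ := fun s hs x => by
    have e : u s x = z s x + (d s).modulated k₀ φ x := by rw [hzeq s hs]; abel
    rw [e]
    exact (norm_add_le _ _).trans (add_le_add (hzR s hs x) (hB₀ _ _))
  have hR0 : 0 ≤ R := (norm_nonneg _).trans (hzR t₀ ⟨le_rfl, ht⟩ 0)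
  have hSb : ∀ s ∈ Set.Icc t₀ t₁, ‖1 + (d s).S‖ ≤ 1 + √Ms := fun s hs => by
    rw [Real.norm_of_nonneg (by linarith [(d s).source_nonneg])]
    linarith [hSle s hs]
  have hB₂' : ∀ s ∈ Set.Icc t₀ t₁, ∀ x, ‖(d s).modulatedSnd k₀ φ x‖ ≤ |B₂| * (1 + √Ms) :=
    fun s hs x => (hB₂ _ _).trans (mul_le_mul (le_abs_self _) (hSb s hs) (norm_nonneg _)
      (abs_nonneg _))
  have hB₃' : ∀ s ∈ Set.Icc t₀ t₁, ∀ x, ‖(d s).modulatedTime k₀ φ x‖ ≤ |B₃| * (1 + √Ms) :=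
    fun s hs x => (hB₃ _ _).trans (mul_le_mul (le_abs_self _) (hSb s hs) (norm_nonneg _)
      (abs_nonneg _))
  set M := max (max (Mu + B₀) (Mu + B₁)) (max (max (Mu + |B₂| * (1 + √Ms))
    (Mu + |B₃| * (1 + √Ms))) (√Ms)) with hM
  refine ⟨M, fun s x => dt u s x - (d s).modulatedTime k₀ φ x,
    fun s x => iteratedDeriv 2 (u s) x - (d s).modulatedSnd k₀ φ x,
    fun s x => (f (u s x) - f ((d s).modulated k₀ φ x)) + (d s).residual D f k₀ ω₀ φ x,
    ?_, ?_, ?_, ?_, ?_, ?_, ?_, ?_, ?_⟩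
  · intro s hs x
    rw [hzx s hs]
    exact hFD s hs x
  · intro s hs x
    rw [hzx s hs]
    exact (hu2 s (hT hs) x).sub ((d s).hasDerivAt_modulatedFst hr hφ x)
  · intro s hs x
    refine ⟨(hzb s hs x).trans (by simp [hM]), ?_, (hzxb s hs x).trans (by simp [hM]), ?_⟩
    · exact ((norm_sub_le _ _).trans (add_le_add (hMu s hs x).2.1 (hB₃' s hs x))).trans
        (by simp [hM])
    · exact ((norm_sub_le _ _).trans (add_le_add (hMu s hs x).2.2.2 (hB₂' s hs x))).trans
        (by simp [hM])
  · intro s hs x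
    rw [hzx s hs, hu.solves s (hT hs) x]
    have hsub : ∀ v w, act D (v - w) = act D v - act D w :=
      map_sub (Matrix.toEuclideanCLM (𝕜 := ℝ) D)
    simp only [hsub, ModulationData.residual]
    module
  · intro s hs x
    rw [← hS s hs]
    have hN := hzN s hs x
    obtain ⟨hf1, F', hF', hF'b⟩ := hCf (u s) ((d s).modulated k₀ φ) (deriv (u s) x)
      ((d s).modulatedFst k₀ φ x) x
      (by
        have h1 := (hdz s hs x).add ((d s).hasDerivAt_modulated hr hφ x)
        rw [sub_add_cancel] at h1
        exact h1.congr_of_eventuallyEq (Eventually.of_forall fun y => by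
          simp [hzeq s hs y]))
      ((d s).hasDerivAt_modulated hr hφ x) (hub s hs x)
      ((hB₀ _ _).trans (le_add_of_nonneg_left hR0)) (hB₁ _ _)
    obtain ⟨hr1, R', hR', hR'b⟩ := hCr (d s) x
    rw [← hzeq s hs] at hf1 hF'b
    have hzx' : ‖deriv (u s) x - (d s).modulatedFst k₀ φ x‖ ≤ supNorm (deriv (z s)) := by
      have := norm_le_supNorm (hzxb s hs) x
      rwa [hzx s hs] at this ⊢
    have hY := supNorm_nonneg (deriv (z s))
    refine ⟨hN, (norm_add_le _ _).trans ?_, F' + R', hF'.add hR', (norm_add_le _ _).trans ?_⟩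
    · rw [add_mul]
      exact add_le_add (hf1.trans (mul_le_mul_of_nonneg_left hN hCf0)) hr1
    · calc ‖F'‖ + ‖R'‖ ≤ Cf * ((d s).S + supNorm (deriv (z s)))
            + Cr * ((d s).S + supNorm (deriv (z s))) :=
          add_le_add (hF'b.trans (mul_le_mul_of_nonneg_left (add_le_add hN hzx') hCf0))
            (hR'b.trans (mul_le_mul_of_nonneg_left (le_add_of_nonneg_right hY) hCr0))
        _ = _ := by ring
  · exact fun s hs x => norm_le_supNorm (hzxb s hs) x
  · exact fun s hs B hB => supNorm_le hB
  · exact Real.continuous_sqrt.comp_aestronglyMeasurable hmeas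
  · intro s hs
    rw [← hS s hs]
    exact (hSle s hs).trans (by simp [hM])

end ModifiedPerturbation

end Library

end WaveTrain

/-! ### The damping estimate -/

theorem proposition5p12 {n : ℕ} (D : Matrix (Fin n) (Fin n) ℝ) (hD : D.PosDef)
    (f : State n → State n) (hf : ContDiff ℝ ∞ f)
    (k₀ ω₀ : ℝ) (φ₀ : ℝ → State n)
    (hH1 : HypH1 D f k₀ ω₀ φ₀) (hD3 : HypD3 D f k₀ ω₀ φ₀)
    -- the critical spectral curve and the cut-off functions, which define `S_p⁰(t)`
    (ξ₀ : ℝ) (lam : ℝ → ℂ) (Φ Φt : ℝ → ℝ → Fin n → ℂ)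
    (hcurve : IsCriticalCurve D f k₀ ω₀ φ₀ ξ₀ lam Φ Φt)
    (ρ χ : ℝ → ℝ) (hρ : IsFrequencyCutoff ξ₀ ρ) (hχ : IsTemporalCutoff χ)
    -- the family of wave trains, defined for `|k - k₀| < r`
    (r : ℝ) (φ : ℝ → ℝ → State n) (freq : ℝ → ℝ)
    (hfam : IsWaveTrainFamily D f k₀ ω₀ φ₀ (Φt 0) r φ freq)
    (r₀ : ℝ) (hr₀ : r₀ ∈ Set.Ioo (0 : ℝ) (1 / 2)) (hr : |k₀| * r₀ < r)
    (tstar : ℝ) (htstar : tstar ∈ Set.Ioc (0 : ℝ) 1)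
    (R : ℝ) (hR : 0 < R) :
    ∃ C : ℝ, 0 < C ∧
      ∀ (v₀ : ℝ → State n) (γ₀ : ℝ → ℝ), IsCub 0 v₀ → IsCub 1 γ₀ → supNorm (deriv γ₀) < r₀ →
      ∀ (T : EReal) (u : ℝ → ℝ → State n),
        IsClassicalSolution D f k₀ ω₀ T (fun ζ => φ₀ (ζ + γ₀ ζ) + v₀ ζ) u →
      ∀ (τ : EReal) (γ : ℝ → ℝ → ℝ),
        IsPhaseModulation D f k₀ ω₀ φ₀ ρ χ lam Φt r₀ (fun ζ => φ₀ (ζ + γ₀ ζ) + v₀ ζ) γ₀ T u τ γ →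
      ∀ t : ℝ, tstar ≤ t → (t : EReal) < τ → (t : EReal) < T →
        (∀ s ∈ Set.Icc tstar t, cubNorm 1 (modPert k₀ φ u γ s) + cubNorm 2 (γ s) ≤ R) →
        cubNorm 1 (modPert k₀ φ u γ t) ≤
          C * (supNorm (modPert k₀ φ u γ t)
            + Real.sqrt (Real.exp (tstar - t) * cubNorm 2 (modPert k₀ φ u γ tstar) ^ 2
              + ∫ s in tstar..t, Real.exp (s - t)
                  * dampingSource k₀ ω₀ freq (modPert k₀ φ u γ) γ s)) := by
  have hr₀1 : r₀ < 1 := by linarith [hr₀.2]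
  have hφ : IsProfile (Set.Ioo (k₀ - r) (k₀ + r)) φ :=
    ⟨hfam.smooth, fun k hk => (hfam.isWaveTrain k hk).periodic⟩
  obtain ⟨C₀, hC₀, hforced⟩ := exists_isForcedSolution (R := R) hf hH1.wavenumber_ne_zero hr₀1 hr
    hφ hfam.smooth_freq hfam.freq_eq hfam.isWaveTrain
  obtain ⟨C, hC, hgrad⟩ := exists_gradient_bound hD hH1.wavenumber_ne_zero ω₀ hC₀
  -- The constant `C` accounts for the gradient and `1` for the sup norm of the perturbation.
  refine ⟨C + 1, by positivity, fun v₀ γ₀ _ _ _ T u hu τ γ hγ t ht htτ htT hbd => ?_⟩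
  have hsub : ∀ {S : EReal}, (t : EReal) < S → Set.Icc tstar t ⊆ positiveTimes S :=
    fun hS s hs => ⟨htstar.1.trans_le hs.1, (EReal.coe_le_coe_iff.2 hs.2).trans_lt hS⟩
  have hsmall : ∀ s ∈ Set.Icc tstar t, supNorm (deriv (γ s)) ≤ r₀ := fun s hs =>
    (hγ.small s ⟨(hsub htτ hs).1.le, (hsub htτ hs).2⟩).le
  obtain ⟨M, zs, zxx, G, h⟩ := hforced T _ u hu τ γ (hγ.smooth 1 5) tstar t ht (hsub htT)
    (hsub htτ) hsmall hbd
  have key := hgrad _ _ _ _ _ _ _ _ _ _ ht h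
  simp only [Real.sq_sqrt (dampingSource_nonneg _ _ _ _ _ _)] at key
  set z := modPert k₀ φ u γ with hz
  -- Of the data at the initial time only the gradient enters; it is dominated by the `C²` norm.
  have hY : supNorm (deriv (z tstar)) ≤ cubNorm 2 (z tstar) := by
    have := supNorm_le_cubNorm (m := 2) (j := 1) (by norm_num) (z tstar)
    rwa [iteratedDeriv_one] at this
  have h0 := supNorm_nonneg (deriv (z tstar))
  have hmono : √(Real.exp (tstar - t) * supNorm (deriv (z tstar)) ^ 2
        + ∫ s in tstar..t, Real.exp (s - t) * dampingSource k₀ ω₀ freq z γ s)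
      ≤ √(Real.exp (tstar - t) * cubNorm 2 (z tstar) ^ 2
        + ∫ s in tstar..t, Real.exp (s - t) * dampingSource k₀ ω₀ freq z γ s) :=
    Real.sqrt_le_sqrt (by gcongr)
  have hs0 := supNorm_nonneg (z t)
  have hsq := Real.sqrt_nonneg (Real.exp (tstar - t) * cubNorm 2 (z tstar) ^ 2
        + ∫ s in tstar..t, Real.exp (s - t) * dampingSource k₀ ω₀ freq z γ s)
  rw [cubNorm_one]
  have h1 := key.trans (mul_le_mul_of_nonneg_left hmono hC)
  have h2 := mul_nonneg hC hs0
  linarith
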